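/- **Lemma (Commutator condition).** *Setting.* Let $M\in\mathbb N_0$, $m_x,m_y,\delta>0$, let $\varphi:\mathbb R^3\to\mathbb R$ be smooth with support in the ball of radius $\delta$ around $0$, and let $g=(g_{rr's})\in\mathbb C^{4\times4\times4}$. Let $G_{rr's}\in C^\infty(\mathbb R\times\mathbb R^3)$ be the cut-off Green functions, i.e. for all $r,r'$ the $\mathbb C^4$-valued function $G_{rr'}=(G_{rr's})_s$ is a smooth solution of the free Dirac equation $i\partial_tG_{rr'}=\bigl(-i\sum_{a=1}^3\alpha^a\partial_{a}+m_y\beta\bigr)G_{rr'}$ with $G_{rr's}(0,\boldsymbol y)=g_{rr's}\varphi(\boldsymbol y)$, where $\alpha^a,\beta$ are the Dirac matrices. A configuration $q=(x_1,\dots,x_M,y_1,\dots,y_N)$ consists of space-time points $x_k=(x_k^0,\boldsymbol x_k)$, $y_\ell=(y_\ell^0,\boldsymbol y_\ell)$ of $\mathbb R\times\mathbb R^3$; the number $N\in\mathbb N_0$ varies. Put $d(x_k,x_{k'})=2\delta$, $d(x_k,y_\ell)=\delta$, $d(y_\ell,y_{\ell'})=0$; two particles $z,z'$ *keep their safety distance*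 if $\|\boldsymbol z-\boldsymbol z'\|>|z^0-z'^0|+d(z,z')$. A wave function $\Phi$ assigns to $q$ and spin indices $r_1,\dots,r_M,s_1,\dots,s_N\in\{1,2,3,4\}$ a complex number $\Phi^{(N)}_{r,s}(q)$; it is called *boson-symmetric* if it is invariant under permutations of the pairs $(y_\ell,s_\ell)$. No symmetry in the $x$-particles is required. For a partition $P=\{P_1,\dots,P_J\}$ of the set of particles $\{x_1,\dots,x_M,y_1,\dots,y_N\}$ let $\mathscr S_\delta^P$ be the set of configurations in which particles of the same family $P_j$ have equal times and particles of different families keep their safety distance, and let $\widehat{\mathscr S}{}_\delta^P\supseteq\mathscr S_\delta^P$ be the set in which particles of the same family have equal times and *$x$-particles* of different families keep their safety distance. Let $\mathscr S_\delta$, $\widehat{\mathscr S}_\delta$ be the unions of these sets over all $N$ and $P$. Functions in $C^\infty(\mathscr S_\delta)$, resp. $C^\infty(\widehat{\mathscr S}_\delta)$, are those wave functions that for every $N$ and $P$ and every choice of the spin indices are smooth on $\mathscr S_\delta^P$, resp. $\widehat{\mathscr S}{}_\delta^P$, in the family times $t_1,\dots,t_J$ and all space coordinates; $C^\infty(\mathcal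 Q)$ denotes the wave functions that are smooth on all configurations. Let $H^{\rm free}_{x_k}$, $H^{\rm free}_{y_\ell}$ be the Dirac operators of mass $m_x$, $m_y$ acting on the indicated particle, and let $$(A_k\Phi)(q)=\sqrt{N+1}\sum_{r_k',s}g^*_{r_k'r_ks}\int_{B_\delta(\boldsymbol x_k)}d^3\tilde{\boldsymbol y}\;\varphi(\tilde{\boldsymbol y}-\boldsymbol x_k)\,\Phi^{(N+1)}_{r_k',s_{N+1}=s}\bigl(x,(y,(x_k^0,\tilde{\boldsymbol y}))\bigr),$$ $$H_{x_k}\Phi(q)=H^{\rm free}_{x_k}\Phi(q)+(A_k\Phi)(q)+\tfrac1{\sqrt N}\sum_{\ell=1}^N\sum_{r_k'}G_{r_kr_k's_\ell}(y_\ell-x_k)\,\Phi^{(N-1)}_{r_k'\widehat{s_\ell}}(x,y\setminus y_\ell),\qquad H_{y_\ell}=H^{\rm free}_{y_\ell}$$ (for $N=0$ the sum over $\ell$ is absent). For a family $P_j$ let $$H_j^P\Phi(q)=\sum_{x_k\in P_j}\bigl(H^{\rm free}_{x_k}+A_k\bigr)\Phi(q)+\sum_{y_\ell\in P_j}H^{\rm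 free}_{y_\ell}\Phi(q)+\tfrac1{\sqrt N}\sum_{x_k\in P_j}\sum_{y_\ell\in P_j}\sum_{r_k'}g_{r_kr_k's_\ell}\,\varphi(\boldsymbol y_\ell-\boldsymbol x_k)\,\Phi^{(N-1)}_{r_k'\widehat{s_\ell}}(x,y\setminus y_\ell),$$ $K_j^P=i\partial_{t_j}-H_j^P$, and $\tilde K_j^P=i\partial_{t_j}-\sum_{z\in P_j}H_z$; on $C^\infty(\mathcal Q)$, $\tilde K_j^P=\sum_{z\in P_j}(i\partial_{z^0}-H_z)$. In products of these operators particles keep their names when another $y$-particle is added or removed, an added $y$-particle belongs to none of the families or single particles to which the other operator refers, and the terms of an operator that refer to a removed particle are omitted. *Claim.* 1. For every boson-symmetric $\Phi\in C^\infty(\mathscr S_\delta)$, all $N$, $P$, $j,j'$, the functions $[K_j^P,K_{j'}^P]\Phi$ and $[\tilde K_j^P,\tilde K_{j'}^P]\Phi$ vanish at every $q\in\mathscr S_\delta^P$. 2. For every boson-symmetric $\Phi$ in $C^\infty(\widehat{\mathscr S}_\delta)$ or in $C^\infty(\mathcal Q)$, all $N$, $P$, $j,j'$, the function $[\tilde K_j^P,\tilde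 K_{j'}^P]\Phi$ vanishes at every $q\in\widehat{\mathscr S}{}_\delta^P$. 3. For every $\Phi\in C^\infty(\mathcal Q)$ (boson-symmetric or not), at every configuration and for all $k,\ell,\ell'$, $$[i\partial_{y_\ell^0}-H_{y_\ell},\,i\partial_{y_{\ell'}^0}-H_{y_{\ell'}}]\Phi=0,\qquad[i\partial_{x_k^0}-H_{x_k},\,i\partial_{y_\ell^0}-H_{y_\ell}]\Phi=0.$$ 4. For every boson-symmetric $\Phi\in C^\infty(\mathcal Q)$, $$[i\partial_{x_k^0}-H_{x_k},\,i\partial_{x_{k'}^0}-H_{x_{k'}}]\Phi=0$$ at every configuration with $\|\boldsymbol x_k-\boldsymbol x_{k'}\|>|x_k^0-x_{k'}^0|+2\delta$. -/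

import Mathlib

open scoped ContDiff ComplexConjugate

namespace MultiTime

noncomputable section

/-- Physical space `ℝ³` with its Euclidean norm. -/
abbrev Space := EuclideanSpace ℝ (Fin 3)

/-- Space-time; a point is `(time coordinate, space coordinate)`. -/
abbrev Spacetime := ℝ × Space

/-- The Dirac matrices `α¹, α², α³`. -/
def diracAlpha : Fin 3 → Matrix (Fin 4) (Fin 4) ℂ :=
  ![!![0, 0, 0, 1; 0, 0, 1, 0; 0, 1, 0, 0; 1, 0, 0, 0],
    !![0, 0, 0, -Complex.I; 0, 0, Complex.I, 0; 0, -Complex.I, 0, 0; Complex.I, 0, 0, 0],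
    !![0, 0, 1, 0; 0, 0, 0, -1; 1, 0, 0, 0; 0, -1, 0, 0]]

/-- The Dirac matrix `β`. -/
def diracBeta : Matrix (Fin 4) (Fin 4) ℂ := Matrix.diagonal ![1, 1, -1, -1]

/-- The free one-particle Dirac operator `-i ∑ₐ αᵃ ∂ₐ + m β` (component `s`, at the point `v`). -/
def diracFree (m : ℝ) (f : Fin 4 → Space → ℂ) (v : Space) (s : Fin 4) : ℂ :=
  -Complex.I * ∑ a : Fin 3, ∑ u : Fin 4,
      diracAlpha a s u * lineDeriv ℝ (f u) v (EuclideanSpace.single a (1 : ℝ))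
    + (m : ℂ) * ∑ u : Fin 4, diracBeta s u * f u v

/-- The data of the model: masses, cut-off length `δ`, cut-off function `φ` supported in the ball
of radius `δ`, and coupling coefficients `g r r' s`. -/
structure CutoffModel where
  mx : ℝ
  my : ℝ
  δ : ℝ
  φ : Space → ℝ
  g : Fin 4 → Fin 4 → Fin 4 → ℂ
  mx_pos : 0 < mx
  my_pos : 0 < my
  δ_pos : 0 < δ
  φ_smooth : ContDiff ℝ ∞ φ
  φ_supp : tsupport φ ⊆ Metric.closedBall 0 δ

/-- `G r r' s` is the family of cut-off Green functions: `G r r'` is the smooth `ℂ⁴`-valued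
solution (components `s`) of the free Dirac equation of the `y`-particle with initial values
`g r r' s * φ` at time `0`. -/
structure IsCutoffGreen (A : CutoffModel) (G : Fin 4 → Fin 4 → Fin 4 → Spacetime → ℂ) : Prop where
  smooth : ∀ r r' s, ContDiff ℝ ∞ (G r r' s)
  dirac : ∀ r r' s (t : ℝ) (y : Space),
    Complex.I * deriv (fun τ : ℝ => G r r' s (τ, y)) t
      = diracFree A.my (fun u v => G r r' u (t, v)) y s
  initial : ∀ r r' s (y : Space), G r r' s (0, y) = A.g r r' s * (A.φ y : ℂ)

/-! ### Configurations -/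

/-- Space-time configurations of `M` `x`-particles (`Sum.inl k`) and `N` `y`-particles
(`Sum.inr l`). -/
abbrev Config (M N : ℕ) := Fin M ⊕ Fin N → Spacetime

/-- Partitions of the set of particle labels into families. -/
abbrev LabelPartition (M N : ℕ) := Finpartition (Finset.univ : Finset (Fin M ⊕ Fin N))

/-- The safety distance `d(m, n)` of two particles. -/
def safetyDist {M N : ℕ} (δ : ℝ) : Fin M ⊕ Fin N → Fin M ⊕ Fin N → ℝ
  | .inl _, .inl _ => 2 * δ
  | .inl _, .inr _ => δ
  | .inr _, .inl _ => δ
  | .inr _, .inr _ => 0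

/-- The particles `m` and `n` keep their safety distance in the configuration `q`. -/
def KeepsSafety {M N : ℕ} (δ : ℝ) (q : Config M N) (m n : Fin M ⊕ Fin N) : Prop :=
  ‖(q m).2 - (q n).2‖ > |(q m).1 - (q n).1| + safetyDist δ m n

/-- The `δ`-spacelike configurations with `N` `y`-particles. -/
def Sdelta (M : ℕ) (δ : ℝ) (N : ℕ) : Set (Config M N) :=
  {q | (∀ k k' : Fin M, KeepsSafety δ q (.inl k) (.inl k') ∨ (q (.inl k)).1 = (q (.inl k')).1) ∧
    (∀ (k : Fin M) (l : Fin N),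
      KeepsSafety δ q (.inl k) (.inr l) ∨ (q (.inl k)).1 = (q (.inr l)).1) ∧
    (∀ l l' : Fin N, KeepsSafety δ q (.inr l) (.inr l') ∨ q (.inr l) = q (.inr l'))}

/-- The larger set of configurations, restricting only the `x`-particles. -/
def SdeltaHat (M : ℕ) (δ : ℝ) (N : ℕ) : Set (Config M N) :=
  {q | ∀ k k' : Fin M, KeepsSafety δ q (.inl k) (.inl k') ∨ (q (.inl k)).1 = (q (.inl k')).1}

/-- Particles in the same family have equal times, particles in different families keep their
safety distance. -/
def SdeltaPart {M N : ℕ} (δ : ℝ) (P : LabelPartition M N) : Set (Config M N) :=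
  {q | (∀ F ∈ P.parts, ∀ m ∈ F, ∀ n ∈ F, (q m).1 = (q n).1) ∧
    ∀ F ∈ P.parts, ∀ F' ∈ P.parts, F ≠ F' → ∀ m ∈ F, ∀ n ∈ F', KeepsSafety δ q m n}

/-- Particles in the same family have equal times, `x`-particles in different families keep their
safety distance. -/
def SdeltaHatPart {M N : ℕ} (δ : ℝ) (P : LabelPartition M N) : Set (Config M N) :=
  {q | (∀ F ∈ P.parts, ∀ m ∈ F, ∀ n ∈ F, (q m).1 = (q n).1) ∧
    ∀ F ∈ P.parts, ∀ F' ∈ P.parts, F ≠ F' →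
      ∀ k k' : Fin M, .inl k ∈ F → .inl k' ∈ F' → KeepsSafety δ q (.inl k) (.inl k')}

/-! ### Wave functions -/

/-- Multi-time wave functions: for every `N` a function of the space-time configuration and of the
spin indices. Where only the values on a set of configurations matter, the other values are
irrelevant. -/
abbrev WaveFun (M : ℕ) := (N : ℕ) → Config M N → (Fin M ⊕ Fin N → Fin 4) → ℂ

/-- Smoothness on all of configuration space, sector by sector and component by component. -/
def SmoothEverywhere {M : ℕ} (Φ : WaveFun M) : Prop :=
  ∀ N σ, ContDiff ℝ ∞ (fun q : Config M N => Φ N q σ)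

/-- The configuration with family times `t` and positions `v`. -/
def familyConfig {M N : ℕ} (P : LabelPartition M N) (t : ↥P.parts → ℝ)
    (v : Fin M ⊕ Fin N → Space) : Config M N :=
  fun m => (t ⟨P.part m, P.part_mem.2 (Finset.mem_univ m)⟩, v m)

/-- `f` is smooth on `S` as a function of the family times and of the positions. -/
def SmoothInFamilies {M N : ℕ} (P : LabelPartition M N) (S : Set (Config M N))
    (f : Config M N → ℂ) : Prop :=
  ContDiffOn ℝ ∞
    (fun w : (↥P.parts → ℝ) × (Fin M ⊕ Fin N → Space) => f (familyConfig P w.1 w.2))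
    {w | familyConfig P w.1 w.2 ∈ S}

/-- Smooth wave functions on the set of `δ`-spacelike (spin-)configurations. -/
def SmoothOnSdelta {M : ℕ} (δ : ℝ) (Φ : WaveFun M) : Prop :=
  ∀ N (P : LabelPartition M N) σ, SmoothInFamilies P (SdeltaPart δ P) (fun q => Φ N q σ)

/-- Smooth wave functions on the larger set of (spin-)configurations. -/
def SmoothOnSdeltaHat {M : ℕ} (δ : ℝ) (Φ : WaveFun M) : Prop :=
  ∀ N (P : LabelPartition M N) σ, SmoothInFamilies P (SdeltaHatPart δ P) (fun q => Φ N q σ)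

/-- Symmetry on `S` under permutations of the (bosonic) `y`-particles. -/
def BosonSymmetricOn {M : ℕ} (S : (N : ℕ) → Set (Config M N)) (Φ : WaveFun M) : Prop :=
  ∀ N, ∀ q ∈ S N, ∀ (σ : Fin M ⊕ Fin N → Fin 4) (π : Equiv.Perm (Fin N)),
    Φ N (q ∘ Sum.map id π) (σ ∘ Sum.map id π) = Φ N q σ

/-! ### Labelled configurations

An operator such as `H_{y_l}` refers to one particle by its name, also when it is evaluated after
another `y`-particle was added or removed. Hence operators act on functions of configurations in
which the `y`-particles present carry the names in a finite set `L` of natural numbers. Only the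
values of positions and spins at the names of particles that are present matter. -/

/-- Names of particles. -/
abbrev Name (M : ℕ) := Fin M ⊕ ℕ

/-- Functions of labelled configurations (and spin indices). -/
abbrev LabelledFun (M : ℕ) :=
  Finset ℕ → (Name M → Spacetime) → (Name M → Fin 4) → ℂ

/-- A wave function as a function of labelled configurations: the `y`-particles present are listed
in the order of their names. -/
def toLabelled {M : ℕ} (Φ : WaveFun M) : LabelledFun M := fun L z σ =>
  Φ L.card (fun m => z (Sum.map id (L.orderEmbOfFin rfl) m))
    (fun m => σ (Sum.map id (L.orderEmbOfFin rfl) m))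

/-- The data of the particles `x_1, …, x_M, y_1, …, y_N` as data indexed by names (the `y`-particles
have the names in `Finset.range N`; the value at absent names is irrelevant). -/
def nameData {M N : ℕ} {X : Type} [Inhabited X] (q : Fin M ⊕ Fin N → X) : Name M → X
  | .inl k => q (.inl k)
  | .inr n => if h : n < N then q (.inr ⟨n, h⟩) else default

/-- The names of a set of particles. -/
def names {M N : ℕ} (F : Finset (Fin M ⊕ Fin N)) : Finset (Name M) :=
  F.image (Sum.map id Fin.val)

/-- The name of a newly added `y`-particle; it comes last in the order of names. -/
def freshName (L : Finset ℕ) : ℕ := L.sup Nat.succ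

/-- The derivative with respect to the common time of the particles named in `F`. -/
def timeDeriv {M : ℕ} (F : Finset (Name M)) (Ψ : LabelledFun M) : LabelledFun M := fun L z σ =>
  deriv (fun τ : ℝ => Ψ L (fun m => if m ∈ F then ((z m).1 + τ, (z m).2) else z m) σ) 0

/-- The free Dirac operator with mass `mass` acting on the particle named `m`. -/
def freeH {M : ℕ} (mass : ℝ) (m : Name M) (Ψ : LabelledFun M) : LabelledFun M := fun L z σ =>
  diracFree mass
    (fun u v => Ψ L (Function.update z m ((z m).1, v)) (Function.update σ m u)) (z m).2 (σ m)

/-- The term of `H_{x_k}` that leads to the sector with one more `y`-particle. -/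
def absorbH {M : ℕ} (A : CutoffModel) (k : Fin M) (Ψ : LabelledFun M) : LabelledFun M :=
  fun L z σ =>
    (Real.sqrt (L.card + 1) : ℂ) * ∑ r' : Fin 4, ∑ s : Fin 4, conj (A.g r' (σ (.inl k)) s) *
      ∫ y in Metric.ball (z (.inl k)).2 A.δ,
        (A.φ (y - (z (.inl k)).2) : ℂ) *
          Ψ (insert (freshName L) L)
            (Function.update z (.inr (freshName L)) ((z (.inl k)).1, y))
            (Function.update (Function.update σ (.inl k) r') (.inr (freshName L)) s)

/-- The term of `H_{x_k}` that leads to the sector with one less `y`-particle, with the Green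
functions `G` and a sum over all `y`-particles. -/
def emitGreenH {M : ℕ} (G : Fin 4 → Fin 4 → Fin 4 → Spacetime → ℂ) (k : Fin M)
    (Ψ : LabelledFun M) : LabelledFun M := fun L z σ =>
  (1 / Real.sqrt L.card : ℂ) * ∑ l ∈ L, ∑ r' : Fin 4,
    G (σ (.inl k)) r' (σ (.inr l)) (z (.inr l) - z (.inl k)) *
      Ψ (L.erase l) z (Function.update σ (.inl k) r')

/-- The same term with the cut-off function itself and a sum over the `y`-particles of the
family `F`. -/
def emitFamilyH {M : ℕ} (A : CutoffModel) (F : Finset (Name M)) (k : Fin M)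
    (Ψ : LabelledFun M) : LabelledFun M := fun L z σ =>
  (1 / Real.sqrt L.card : ℂ) * ∑ l ∈ L with .inr l ∈ F, ∑ r' : Fin 4,
    A.g (σ (.inl k)) r' (σ (.inr l)) * (A.φ ((z (.inr l)).2 - (z (.inl k)).2) : ℂ) *
      Ψ (L.erase l) z (Function.update σ (.inl k) r')

/-- The partial Hamiltonian of a family `F` in the multi-time equations with cut-off. -/
def familyH {M : ℕ} (A : CutoffModel) (F : Finset (Name M)) (Ψ : LabelledFun M) :
    LabelledFun M := fun L z σ =>
  (∑ k : Fin M with .inl k ∈ F,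
      (freeH A.mx (.inl k) Ψ L z σ + absorbH A k Ψ L z σ + emitFamilyH A F k Ψ L z σ))
    + ∑ l ∈ L with .inr l ∈ F, freeH A.my (.inr l) Ψ L z σ

/-- The operator `i ∂_{t_j} - H_j` of a family `F`, in terms of the cut-off function. -/
def familyK {M : ℕ} (A : CutoffModel) (F : Finset (Name M)) (Ψ : LabelledFun M) :
    LabelledFun M := fun L z σ =>
  Complex.I * timeDeriv F Ψ L z σ - familyH A F Ψ L z σ

/-- The partial Hamiltonian `H_{x_k}` or `H_{y_l}` of a single particle, in terms of the Green
functions; it is zero for a particle that is not present. -/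
def particleH {M : ℕ} (A : CutoffModel) (G : Fin 4 → Fin 4 → Fin 4 → Spacetime → ℂ) :
    Name M → LabelledFun M → LabelledFun M
  | .inl k, Ψ => fun L z σ =>
      freeH A.mx (.inl k) Ψ L z σ + absorbH A k Ψ L z σ + emitGreenH G k Ψ L z σ
  | .inr l, Ψ => fun L z σ => if l ∈ L then freeH A.my (.inr l) Ψ L z σ else 0

/-- The operator `i ∂_{z⁰} - H_z` of a single particle. -/
def particleK {M : ℕ} (A : CutoffModel) (G : Fin 4 → Fin 4 → Fin 4 → Spacetime → ℂ)
    (m : Name M) (Ψ : LabelledFun M) : LabelledFun M := fun L z σ =>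
  Complex.I * timeDeriv {m} Ψ L z σ - particleH A G m Ψ L z σ

/-- The operator `∑ (i ∂_{z⁰} - H_z)`, the sum over the particles `z` of a family `F`. -/
def sumParticleK {M : ℕ} (A : CutoffModel) (G : Fin 4 → Fin 4 → Fin 4 → Spacetime → ℂ)
    (F : Finset (Name M)) (Ψ : LabelledFun M) : LabelledFun M := fun L z σ =>
  ∑ m ∈ F, particleK A G m Ψ L z σ

/-- The operator `i ∂_{t_j} - ∑ H_z`, the sum over the particles `z` of a family `F`, in terms of
the Green functions. -/
def familyGreenK {M : ℕ} (A : CutoffModel) (G : Fin 4 → Fin 4 → Fin 4 → Spacetime → ℂ)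
    (F : Finset (Name M)) (Ψ : LabelledFun M) : LabelledFun M := fun L z σ =>
  Complex.I * timeDeriv F Ψ L z σ - ∑ m ∈ F, particleH A G m Ψ L z σ

/-- The value of `[X, Y] Φ` at the configuration `q` and the spin indices `σ`. -/
def commutatorAt {M N : ℕ} (X Y : LabelledFun M → LabelledFun M) (Φ : WaveFun M)
    (q : Config M N) (σ : Fin M ⊕ Fin N → Fin 4) : ℂ :=
  X (Y (toLabelled Φ)) (Finset.range N) (nameData q) (nameData σ)
    - Y (X (toLabelled Φ)) (Finset.range N) (nameData q) (nameData σ)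

end

end MultiTime

open MultiTime

/-!
# The commutator condition for the multi-time equations with cut-off

The operators `i ∂_t - H` of a family, of a single particle, with the cut-off function or with the
Green functions, are all instances of one operator `familyOp`, with general emission coefficients
`γ`. It has three parts: the free part (time derivative and Dirac operators), the absorption part
and the emission part. It is enough to show that the operators of two disjoint families `F`, `F'`
commute (`familyOp_comm`), part by part:

* free parts commute because second derivatives of smooth functions are symmetric
  (`freePart_comm`);
* a derivative commutes with the absorption by the other family by differentiation under the
  integral sign (`hasDerivAt_absorbInt`);
* a free part commutes with the emission by the other family. If the emitted particle belongs to
  the family of the free part, the terms in which the coefficient is differentiated cancel by the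
  free Dirac equation for the coefficient (`freePart_emitTerm`);
* two absorptions commute by Fubini's theorem and the bosonic symmetry, which exchanges the two
  absorbed particles (`doubleAbsorbInt_comm`);
* absorption and emission commute (`absorbH_emitH_comm`), once the term is excluded in which one
  `x`-particle emits a particle that the other absorbs. For the cut-off function this term is absent
  by definition. For the Green functions it vanishes by finite propagation speed
  (`dirac_eq_zero_of_spacelike`): the absorbed particle is within `δ` of its absorber, and hence
  outside the light cone of the `δ`-ball around the emitter;
* two emissions commute because the sums over the removed particles can be exchanged (`emitH_comm`).

Finite propagation speed follows from an energy estimate: the density of a solution, integrated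
with a smooth weight that is supported in a shrinking backward light cone, does not increase,
because the Dirac current is at most the density (`cone_energy_eq_zero`).

The three function spaces differ only in the domain on which wave functions are smooth. This is
encoded in a `Separation`: a wave function is smooth along every smooth family of configurations in
which any two particles are separated or have equal times throughout (`IsSmoothLabelled`). The
domain is preserved when a `y`-particle is created within distance `δ` of an `x`-particle, which
makes the absorption integrals smooth in the coordinates of the other family.
-/

namespace MultiTime

open Filter Topology MeasureTheory

noncomputable section

variable {M : ℕ} {δ : ℝ}

/-! ### Configurations depending smoothly on parameters -/

variable {M : ℕ} {δ : ℝ}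

/-- A relation "keep their distance" between two named particles at two space-time points. The law
`absorb` says that a `y`-particle created within distance `δ` of an `x`-particle inherits the
relation from it. This covers the safety distance of all particles, the safety distance of the
`x`-particles only, and no condition at all. -/
structure Separation (M : ℕ) (δ : ℝ) where
  rel : Name M → Name M → Spacetime → Spacetime → Prop
  symm : ∀ {m n p p'}, rel m n p p' → rel n m p' p
  absorb : ∀ {k n p p'} (a : ℕ) {y : Space}, y ∈ Metric.closedBall p.2 δ →
    rel (.inl k) n p p' → rel (.inr a) n (p.1, y) p'

/-- The particle named `m` is present if the `y`-particles have the names in `L`. -/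
def Present (L : Finset ℕ) : Name M → Prop
  | .inl _ => True
  | .inr l => l ∈ L

/-- The family `ζ` of configurations stays, near the parameter `e₀`, in the domain on which wave
functions are smooth: any two particles are separated at `e₀` or have equal times throughout. -/
def Admissible (S : Separation M δ) {E : Type} (L : Finset ℕ) (ζ : E → Name M → Spacetime)
    (e₀ : E) : Prop :=
  ∀ m n, Present L m → Present L n →
    S.rel m n (ζ e₀ m) (ζ e₀ n) ∨ ∀ e, (ζ e m).1 = (ζ e n).1

/-- What the argument uses about a wave function: the values depend only on the particles present
and not on the name of the last `y`-particle, and they are smooth along admissible families. -/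
structure IsSmoothLabelled (S : Separation M δ) (Ψ : LabelledFun M) : Prop where
  congr : ∀ {L : Finset ℕ} {z z' : Name M → Spacetime} {σ σ' : Name M → Fin 4},
    (∀ m, Present L m → z m = z' m) → (∀ m, Present L m → σ m = σ' m) → Ψ L z σ = Ψ L z' σ'
  insert_congr : ∀ {L : Finset ℕ} {a b : ℕ}, (∀ l ∈ L, l < a) → (∀ l ∈ L, l < b) →
    ∀ (z : Name M → Spacetime) (σ : Name M → Fin 4) (p : Spacetime) (s : Fin 4),
      Ψ (insert a L) (Function.update z (.inr a) p) (Function.update σ (.inr a) s)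
        = Ψ (insert b L) (Function.update z (.inr b) p) (Function.update σ (.inr b) s)
  smooth : ∀ {E : Type} [NormedAddCommGroup E] [NormedSpace ℝ E] {L : Finset ℕ}
    {ζ : E → Name M → Spacetime} {e₀ : E} (σ : Name M → Fin 4),
    (∀ m, ContDiff ℝ ∞ (fun e => ζ e m)) → Admissible S L ζ e₀ →
      ContDiffAt ℝ ∞ (fun e => Ψ L (ζ e) σ) e₀

/-- Symmetry under the exchange of two `y`-particles, at configurations in the domain. -/
def SwapSymmetric (S : Separation M δ) (Ψ : LabelledFun M) : Prop :=
  ∀ {L : Finset ℕ} {a b : ℕ}, a ∈ L → b ∈ L →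
    ∀ (z : Name M → Spacetime) (σ : Name M → Fin 4),
      (∀ m n, Present L m → Present L n → S.rel m n (z m) (z n) ∨ (z m).1 = (z n).1) →
      Ψ L (z ∘ Equiv.swap (.inr a) (.inr b)) (σ ∘ Equiv.swap (.inr a) (.inr b)) = Ψ L z σ

/-! ### Wave functions as functions of labelled configurations -/

/-- The name of the particle with label `m` if the `y`-particles present have the names in `L`. -/
def labelName (L : Finset ℕ) {N : ℕ} (h : L.card = N) (m : Fin M ⊕ Fin N) : Name M :=
  Sum.map id (L.orderEmbOfFin h) m

theorem present_labelName (L : Finset ℕ) {N : ℕ} (h : L.card = N) (m : Fin M ⊕ Fin N) :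
    Present L (labelName L h m) := by
  rcases m with k | l
  · trivial
  · exact Finset.orderEmbOfFin_mem L h l

theorem toLabelled_eq (Φ : WaveFun M) (L : Finset ℕ) {N : ℕ} (h : L.card = N)
    (z : Name M → Spacetime) (σ : Name M → Fin 4) :
    toLabelled Φ L z σ = Φ N (z ∘ labelName L h) (σ ∘ labelName L h) := by
  subst h
  rfl

theorem toLabelled_congr (Φ : WaveFun M) {L : Finset ℕ} {z z' : Name M → Spacetime}
    {σ σ' : Name M → Fin 4} (hz : ∀ m, Present L m → z m = z' m)
    (hσ : ∀ m, Present L m → σ m = σ' m) : toLabelled Φ L z σ = toLabelled Φ L z' σ' := by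
  rw [toLabelled_eq Φ L rfl, toLabelled_eq Φ L rfl]
  congr 1
  · funext m
    exact hz _ (present_labelName L rfl m)
  · funext m
    exact hσ _ (present_labelName L rfl m)

/-- Renaming the `y`-particles by an order-preserving map does not change the wave function. -/
theorem toLabelled_image (Φ : WaveFun M) {L : Finset ℕ} {θ : ℕ → ℕ}
    (hθ : StrictMonoOn θ L) (z : Name M → Spacetime) (σ : Name M → Fin 4) :
    toLabelled Φ (L.image θ) z σ
      = toLabelled Φ L (z ∘ Sum.map id θ) (σ ∘ Sum.map id θ) := by
  have hc : (L.image θ).card = L.card := Finset.card_image_of_injOn hθ.injOn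
  have hu : (fun i => θ (L.orderEmbOfFin rfl i)) = (L.image θ).orderEmbOfFin hc := by
    refine Finset.orderEmbOfFin_unique hc
      (fun i => Finset.mem_image_of_mem θ (Finset.orderEmbOfFin_mem L rfl i)) ?_
    intro i j hij
    exact hθ (Finset.orderEmbOfFin_mem L rfl i) (Finset.orderEmbOfFin_mem L rfl j)
      ((L.orderEmbOfFin rfl).strictMono hij)
  have hl : (labelName (L.image θ) hc : Fin M ⊕ Fin L.card → Name M)
      = Sum.map id θ ∘ labelName L rfl := by
    funext m
    rcases m with k | l
    · rfl
    · exact congrArg Sum.inr (congrFun hu l).symm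
  rw [toLabelled_eq Φ _ hc, toLabelled_eq Φ L rfl, hl]
  rfl

theorem toLabelled_insert_congr (Φ : WaveFun M) {L : Finset ℕ} {a b : ℕ} (ha : ∀ l ∈ L, l < a)
    (hb : ∀ l ∈ L, l < b) (z : Name M → Spacetime) (σ : Name M → Fin 4) (p : Spacetime)
    (s : Fin 4) :
    toLabelled Φ (insert a L) (Function.update z (.inr a) p) (Function.update σ (.inr a) s)
      = toLabelled Φ (insert b L) (Function.update z (.inr b) p)
          (Function.update σ (.inr b) s) := by
  have hθ : ∀ l ∈ L, (Function.update id a b : ℕ → ℕ) l = l := fun l hl => by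
    rw [Function.update_of_ne (ha l hl).ne, id]
  have hθa : (Function.update id a b : ℕ → ℕ) a = b := Function.update_self ..
  have him : (insert a L).image (Function.update id a b) = insert b L := by
    rw [Finset.image_insert, hθa]
    congr 1
    ext l
    constructor
    · intro hl
      obtain ⟨l', hl', rfl⟩ := Finset.mem_image.1 hl
      rwa [hθ l' hl']
    · intro hl
      exact Finset.mem_image.2 ⟨l, hl, hθ l hl⟩
  have hm : StrictMonoOn (Function.update id a b : ℕ → ℕ) (insert a L : Finset ℕ) := by
    intro i hi j hj hij
    rw [Finset.mem_coe, Finset.mem_insert] at hi hj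
    rcases hi with rfl | hi <;> rcases hj with rfl | hj
    · exact absurd hij (lt_irrefl _)
    · exact absurd hij (ha j hj).not_gt
    · rw [hθ i hi, hθa]
      exact hb i hi
    · rwa [hθ i hi, hθ j hj]
  rw [← him, toLabelled_image Φ hm]
  have key : ∀ {X : Type} (w : Name M → X) (x : X) (m : Name M), Present (insert a L) m →
      Function.update w (.inr a) x m
        = (Function.update w (.inr b) x ∘ Sum.map id (Function.update id a b)) m := by
    intro X w x m hm
    rcases m with k | l
    · simp
    · rcases Finset.mem_insert.1 hm with rfl | hl
      · simp
      · have h1 : l ≠ a := (ha l hl).ne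
        have h2 : l ≠ b := (hb l hl).ne
        simp [Function.update_of_ne, h1, h2]
  exact toLabelled_congr Φ (fun m hm => key z p m hm) (fun m hm => key σ s m hm)

theorem toLabelled_swap (Φ : WaveFun M) {L : Finset ℕ} {a b : ℕ} (ha : a ∈ L) (hb : b ∈ L)
    (z : Name M → Spacetime) (σ : Name M → Fin 4) {T : (N : ℕ) → Set (Config M N)}
    (hΦ : BosonSymmetricOn T Φ) (hz : z ∘ labelName L rfl ∈ T L.card) :
    toLabelled Φ L (z ∘ Equiv.swap (.inr a) (.inr b)) (σ ∘ Equiv.swap (.inr a) (.inr b))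
      = toLabelled Φ L z σ := by
  have hr := Finset.range_orderEmbOfFin L (rfl : L.card = L.card)
  obtain ⟨i, rfl⟩ : a ∈ Set.range (L.orderEmbOfFin rfl) := by rw [hr]; exact ha
  obtain ⟨j, rfl⟩ : b ∈ Set.range (L.orderEmbOfFin rfl) := by rw [hr]; exact hb
  have key : (Equiv.swap (.inr (L.orderEmbOfFin rfl i)) (.inr (L.orderEmbOfFin rfl j)) :
        Name M → Name M) ∘ labelName L rfl
      = labelName L rfl ∘ Sum.map id (Equiv.swap i j) := by
    funext m
    rcases m with k | l
    · simp [labelName, Equiv.swap_apply_def]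
    · simp only [labelName, Function.comp_apply, Sum.map_inr, Equiv.swap_apply_def,
        Sum.inr.injEq, EmbeddingLike.apply_eq_iff_eq]
      split_ifs <;> rfl
  rw [toLabelled_eq Φ L rfl, toLabelled_eq Φ L rfl, Function.comp_assoc, Function.comp_assoc, key]
  exact hΦ _ _ hz (σ ∘ labelName L rfl) (Equiv.swap i j)

/-! ### Smoothness along admissible families -/

theorem exists_partition_of_times {E : Type} {N : ℕ} (ζ : E → Config M N) :
    ∃ P : LabelPartition M N, ∀ m n, n ∈ P.part m ↔ ∀ e, (ζ e m).1 = (ζ e n).1 := by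
  classical
  let s : Setoid (Fin M ⊕ Fin N) :=
    { r := fun m n => ∀ e, (ζ e m).1 = (ζ e n).1
      iseqv := ⟨fun _ _ => rfl, fun h e => (h e).symm, fun h h' e => (h e).trans (h' e)⟩ }
  exact ⟨Finpartition.ofSetoid s, fun m n => Finpartition.mem_part_ofSetoid_iff_rel⟩

theorem contDiffAt_of_smoothInFamilies {E : Type} [NormedAddCommGroup E] [NormedSpace ℝ E]
    {N : ℕ} {P : LabelPartition M N} {T : Set (Config M N)} {f : Config M N → ℂ}
    (hf : SmoothInFamilies P T f)
    (hT : IsOpen {w : (↥P.parts → ℝ) × (Fin M ⊕ Fin N → Space) | familyConfig P w.1 w.2 ∈ T})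
    {ζ : E → Config M N} (hζ : ∀ m, ContDiff ℝ ∞ (fun e => ζ e m))
    (hP : ∀ m n, n ∈ P.part m → ∀ e, (ζ e m).1 = (ζ e n).1) {e₀ : E} (he₀ : ζ e₀ ∈ T) :
    ContDiffAt ℝ ∞ (fun e => f (ζ e)) e₀ := by
  have hne : ∀ F : ↥P.parts, ∃ m, m ∈ F.1 := fun F => P.nonempty_of_mem_parts F.2
  choose rep hrep using hne
  let w : E → (↥P.parts → ℝ) × (Fin M ⊕ Fin N → Space) :=
    fun e => (fun F => (ζ e (rep F)).1, fun m => (ζ e m).2)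
  have hw : ∀ e, familyConfig P (w e).1 (w e).2 = ζ e := by
    intro e
    funext m
    exact Prod.ext (hP m _ (hrep _) e).symm rfl
  have hwc : ContDiff ℝ ∞ w :=
    (contDiff_pi.2 fun F => (hζ (rep F)).fst).prodMk (contDiff_pi.2 fun m => (hζ m).snd)
  have h0 : w e₀ ∈ {w : (↥P.parts → ℝ) × (Fin M ⊕ Fin N → Space) |
      familyConfig P w.1 w.2 ∈ T} := by
    rw [Set.mem_ofPred_eq, hw]
    exact he₀
  have := (hf.contDiffAt (hT.mem_nhds h0)).comp e₀ hwc.contDiffAt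
  refine this.congr_of_eventuallyEq (Eventually.of_forall fun e => ?_)
  simp only [Function.comp_apply, hw]

theorem continuous_familyConfig {N : ℕ} (P : LabelPartition M N) (m : Fin M ⊕ Fin N) :
    Continuous fun w : (↥P.parts → ℝ) × (Fin M ⊕ Fin N → Space) =>
      familyConfig P w.1 w.2 m := by
  unfold familyConfig
  fun_prop

theorem isOpen_keepsSafety {N : ℕ} (P : LabelPartition M N) (δ : ℝ) (m n : Fin M ⊕ Fin N) :
    IsOpen {w : (↥P.parts → ℝ) × (Fin M ⊕ Fin N → Space) |
      KeepsSafety δ (familyConfig P w.1 w.2) m n} := by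
  have hm := continuous_familyConfig P m
  have hn := continuous_familyConfig P n
  exact isOpen_lt (((hm.fst.sub hn.fst).abs).add continuous_const) (hm.snd.sub hn.snd).norm

theorem familyConfig_time_eq {N : ℕ} (P : LabelPartition M N) (t : ↥P.parts → ℝ)
    (v : Fin M ⊕ Fin N → Space) {F : Finset (Fin M ⊕ Fin N)} (hF : F ∈ P.parts)
    {m n : Fin M ⊕ Fin N} (hm : m ∈ F) (hn : n ∈ F) :
    (familyConfig P t v m).1 = (familyConfig P t v n).1 := by
  have h : P.part m = P.part n := (P.part_eq_of_mem hF hm).trans (P.part_eq_of_mem hF hn).symm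
  simp only [familyConfig, h]

theorem isOpen_sdeltaPart {N : ℕ} (P : LabelPartition M N) (δ : ℝ) :
    IsOpen {w : (↥P.parts → ℝ) × (Fin M ⊕ Fin N → Space) |
      familyConfig P w.1 w.2 ∈ SdeltaPart δ P} := by
  have h : {w : (↥P.parts → ℝ) × (Fin M ⊕ Fin N → Space) |
        familyConfig P w.1 w.2 ∈ SdeltaPart δ P}
      = {w | ∀ F ∈ P.parts, ∀ F' ∈ P.parts, F ≠ F' → ∀ m ∈ F, ∀ n ∈ F',
          KeepsSafety δ (familyConfig P w.1 w.2) m n} := by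
    ext w
    exact ⟨fun h => h.2, fun h => ⟨fun F hF m hm n hn => familyConfig_time_eq P _ _ hF hm hn, h⟩⟩
  rw [h]
  simp only [Set.ofPred_forall]
  refine isOpen_biInter_finset fun F _ => isOpen_biInter_finset fun F' _ =>
    isOpen_iInter_of_finite fun _ => isOpen_biInter_finset fun m _ =>
      isOpen_biInter_finset fun n _ => isOpen_keepsSafety P δ m n

theorem isOpen_sdeltaHatPart {N : ℕ} (P : LabelPartition M N) (δ : ℝ) :
    IsOpen {w : (↥P.parts → ℝ) × (Fin M ⊕ Fin N → Space) |
      familyConfig P w.1 w.2 ∈ SdeltaHatPart δ P} := by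
  have h : {w : (↥P.parts → ℝ) × (Fin M ⊕ Fin N → Space) |
        familyConfig P w.1 w.2 ∈ SdeltaHatPart δ P}
      = {w | ∀ F ∈ P.parts, ∀ F' ∈ P.parts, F ≠ F' → ∀ k k' : Fin M, .inl k ∈ F → .inl k' ∈ F' →
          KeepsSafety δ (familyConfig P w.1 w.2) (.inl k) (.inl k')} := by
    ext w
    exact ⟨fun h => h.2, fun h => ⟨fun F hF m hm n hn => familyConfig_time_eq P _ _ hF hm hn, h⟩⟩
  rw [h]
  simp only [Set.ofPred_forall]
  refine isOpen_biInter_finset fun F _ => isOpen_biInter_finset fun F' _ =>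
    isOpen_iInter_of_finite fun _ => isOpen_iInter_of_finite fun k =>
      isOpen_iInter_of_finite fun k' => isOpen_iInter_of_finite fun _ =>
        isOpen_iInter_of_finite fun _ => isOpen_keepsSafety P δ _ _

/-! ### The three instances of separation -/

/-- The safety distance in terms of names. -/
def nameDist (δ : ℝ) : Name M → Name M → ℝ
  | .inl _, .inl _ => 2 * δ
  | .inl _, .inr _ => δ
  | .inr _, .inl _ => δ
  | .inr _, .inr _ => 0

theorem nameDist_labelName (δ : ℝ) (L : Finset ℕ) {N : ℕ} (h : L.card = N)
    (m n : Fin M ⊕ Fin N) :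
    nameDist δ (labelName L h m) (labelName L h n) = safetyDist δ m n := by
  rcases m with k | l <;> rcases n with k' | l' <;> rfl

/-- All particles keep their safety distance. -/
def Separation.safe (M : ℕ) (δ : ℝ) : Separation M δ where
  rel m n p p' := ‖p.2 - p'.2‖ > |p.1 - p'.1| + nameDist δ m n
  symm {m n p p'} h := by
    rw [norm_sub_rev, abs_sub_comm]
    convert h using 2
    rcases m with k | l <;> rcases n with k' | l' <;> rfl
  absorb {k n p p'} a {y} hy h := by
    rw [mem_closedBall_iff_norm, norm_sub_rev] at hy
    have h3 := norm_sub_le_norm_sub_add_norm_sub p.2 y p'.2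
    rcases n with k' | l' <;> simp only [nameDist] at h ⊢ <;> linarith

/-- The `x`-particles keep their safety distance. -/
def Separation.safeX (M : ℕ) (δ : ℝ) : Separation M δ where
  rel m n p p' := m.isLeft → n.isLeft → ‖p.2 - p'.2‖ > |p.1 - p'.1| + 2 * δ
  symm {m n p p'} h hn hm := by
    rw [norm_sub_rev, abs_sub_comm]
    exact h hm hn
  absorb _ _ _ _ := by simp

/-- No condition. -/
def Separation.trivial (M : ℕ) (δ : ℝ) : Separation M δ where
  rel _ _ _ _ := True
  symm h := h
  absorb _ _ _ h := h

theorem isSmoothLabelled_of_smoothOnSdelta {Φ : WaveFun M} (hΦ : SmoothOnSdelta δ Φ) :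
    IsSmoothLabelled (Separation.safe M δ) (toLabelled Φ) where
  congr := toLabelled_congr Φ
  insert_congr := toLabelled_insert_congr Φ
  smooth {E _ _ L ζ e₀} σ hζ hadm := by
    obtain ⟨P, hP⟩ := exists_partition_of_times
      (fun e => ζ e ∘ labelName L rfl : E → Config M L.card)
    refine contDiffAt_of_smoothInFamilies (hΦ L.card P (σ ∘ labelName L rfl))
      (isOpen_sdeltaPart P δ) (ζ := fun e => ζ e ∘ labelName L rfl) (fun m => hζ _)
      (fun m n h => (hP m n).1 h) ⟨fun F hF m hm n hn => ?_, fun F hF F' hF' hne m hm n hn => ?_⟩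
    · exact (hP m n).1 (by rwa [P.part_eq_of_mem hF hm]) e₀
    · rcases hadm _ _ (present_labelName L rfl m) (present_labelName L rfl n) with h | h
      · have h' : ‖(ζ e₀ (labelName L rfl m)).2 - (ζ e₀ (labelName L rfl n)).2‖ > _ := h
        rwa [nameDist_labelName] at h'
      · refine absurd ((hP m n).2 h) fun h' => hne ?_
        rw [P.part_eq_of_mem hF hm] at h'
        exact P.eq_of_mem_parts hF hF' h' hn

theorem isSmoothLabelled_of_smoothOnSdeltaHat {Φ : WaveFun M} (hΦ : SmoothOnSdeltaHat δ Φ) :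
    IsSmoothLabelled (Separation.safeX M δ) (toLabelled Φ) where
  congr := toLabelled_congr Φ
  insert_congr := toLabelled_insert_congr Φ
  smooth {E _ _ L ζ e₀} σ hζ hadm := by
    obtain ⟨P, hP⟩ := exists_partition_of_times
      (fun e => ζ e ∘ labelName L rfl : E → Config M L.card)
    refine contDiffAt_of_smoothInFamilies (hΦ L.card P (σ ∘ labelName L rfl))
      (isOpen_sdeltaHatPart P δ) (ζ := fun e => ζ e ∘ labelName L rfl) (fun m => hζ _)
      (fun m n h => (hP m n).1 h)
      ⟨fun F hF m hm n hn => ?_, fun F hF F' hF' hne k k' hm hn => ?_⟩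
    · exact (hP m n).1 (by rwa [P.part_eq_of_mem hF hm]) e₀
    · rcases hadm (.inl k) (.inl k') True.intro True.intro with h | h
      · exact h rfl rfl
      · refine absurd ((hP (.inl k) (.inl k')).2 h) fun h' => hne ?_
        rw [P.part_eq_of_mem hF hm] at h'
        exact P.eq_of_mem_parts hF hF' h' hn

theorem isSmoothLabelled_of_smoothEverywhere {Φ : WaveFun M} (hΦ : SmoothEverywhere Φ) :
    IsSmoothLabelled (Separation.trivial M δ) (toLabelled Φ) where
  congr := toLabelled_congr Φ
  insert_congr := toLabelled_insert_congr Φ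
  smooth {_ _ _ L _ _} σ hζ _ :=
    ((hΦ L.card (σ ∘ labelName L rfl)).comp
      (contDiff_pi.2 fun m => hζ (labelName L rfl m))).contDiffAt

theorem swapSymmetric_safe {Φ : WaveFun M} (hΦ : BosonSymmetricOn (Sdelta M δ) Φ) :
    SwapSymmetric (Separation.safe M δ) (toLabelled Φ) := by
  intro L a b ha hb z σ hz
  have hsep : ∀ m n : Fin M ⊕ Fin L.card, KeepsSafety δ (z ∘ labelName L rfl) m n ∨
      (z (labelName L rfl m)).1 = (z (labelName L rfl n)).1 := by
    intro m n
    refine (hz _ _ (present_labelName L rfl m) (present_labelName L rfl n)).imp_left fun h => ?_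
    have h' : ‖(z (labelName L rfl m)).2 - (z (labelName L rfl n)).2‖ > _ := h
    rwa [nameDist_labelName] at h'
  refine toLabelled_swap Φ ha hb z σ hΦ
    ⟨fun k k' => hsep _ _, fun k l => hsep _ _, fun l l' => ?_⟩
  rcases hsep (.inr l) (.inr l') with h | h
  · exact .inl h
  · by_cases he : (z (labelName L rfl (.inr l))).2 = (z (labelName L rfl (.inr l'))).2
    · exact .inr (Prod.ext h he)
    · left
      have h' := norm_pos_iff.2 (sub_ne_zero.2 he)
      simp only [KeepsSafety, safetyDist, Function.comp_apply, h, sub_self, abs_zero, add_zero]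
      exact h'

theorem swapSymmetric_safeX {Φ : WaveFun M} (hΦ : BosonSymmetricOn (SdeltaHat M δ) Φ) :
    SwapSymmetric (Separation.safeX M δ) (toLabelled Φ) := by
  intro L a b ha hb z σ hz
  exact toLabelled_swap Φ ha hb z σ hΦ fun k k' =>
    (hz (.inl k) (.inl k') True.intro True.intro).imp_left fun h => h rfl rfl

theorem swapSymmetric_trivial {Φ : WaveFun M} (hΦ : BosonSymmetricOn (fun _ => Set.univ) Φ) :
    SwapSymmetric (Separation.trivial M δ) (toLabelled Φ) := by
  intro L a b ha hb z σ _
  exact toLabelled_swap Φ ha hb z σ hΦ (Set.mem_univ _)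

/-! ### Derivatives and integrals depending on parameters -/

theorem two_le_infty : (1 + 1 : WithTop ℕ∞) ≤ ∞ := by
  exact WithTop.coe_le_coe.2 (le_top : (1 + 1 : ℕ∞) ≤ ⊤)

theorem contDiffAt_deriv_right {E : Type} [NormedAddCommGroup E] [NormedSpace ℝ E]
    {f : E × ℝ → ℂ} {e₀ : E} (hf : ContDiffAt ℝ ∞ f (e₀, 0)) :
    ContDiffAt ℝ ∞ (fun e => deriv (fun τ => f (e, τ)) 0) e₀ := by
  have h1 : ContDiffAt ℝ ∞ (fun e : E => fderiv ℝ f (e, 0)) e₀ :=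
    (hf.fderiv_right (m := ∞) (by simp)).comp e₀
      (contDiff_id.prodMk contDiff_const).contDiffAt
  have h2 : ContDiffAt ℝ ∞ (fun e : E => fderiv ℝ f (e, 0) (0, 1)) e₀ :=
    h1.clm_apply contDiffAt_const
  refine h2.congr_of_eventuallyEq ?_
  have h3 : ∀ᶠ p in 𝓝 (e₀, (0 : ℝ)), DifferentiableAt ℝ f p :=
    ((hf.of_le (m := 1) (mod_cast le_top)).eventually (by simp)).mono fun p hp =>
      hp.differentiableAt one_ne_zero
  have h4 : Tendsto (fun e : E => (e, (0 : ℝ))) (𝓝 e₀) (𝓝 (e₀, 0)) :=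
    (Continuous.prodMk_left (0 : ℝ)).tendsto e₀
  filter_upwards [h4.eventually h3] with e he
  have h5 : HasDerivAt (fun τ : ℝ => (e, τ)) ((0 : E), (1 : ℝ)) 0 :=
    (hasDerivAt_const (0 : ℝ) e).prodMk (hasDerivAt_id (0 : ℝ))
  exact (he.hasFDerivAt.comp_hasDerivAt (0 : ℝ) h5).deriv

theorem deriv_deriv_comm {f : ℝ × ℝ → ℂ} (hf : ContDiffAt ℝ ∞ f (0, 0)) :
    deriv (fun τ => deriv (fun τ' => f (τ, τ')) 0) 0
      = deriv (fun τ' => deriv (fun τ => f (τ, τ')) 0) 0 := by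
  have h3 : ∀ᶠ p in 𝓝 ((0 : ℝ), (0 : ℝ)), DifferentiableAt ℝ f p :=
    ((hf.of_le (m := 1) (mod_cast le_top)).eventually (by simp)).mono fun p hp =>
      hp.differentiableAt one_ne_zero
  have hd : DifferentiableAt ℝ (fderiv ℝ f) (0, 0) :=
    (hf.fderiv_right (m := 1) two_le_infty).differentiableAt one_ne_zero
  have hl : ∀ τ' : ℝ, HasDerivAt (fun τ : ℝ => (τ, τ')) ((1 : ℝ), (0 : ℝ)) 0 := fun τ' =>
    (hasDerivAt_id (0 : ℝ)).prodMk (hasDerivAt_const (0 : ℝ) τ')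
  have hr : ∀ τ : ℝ, HasDerivAt (fun τ' : ℝ => (τ, τ')) ((0 : ℝ), (1 : ℝ)) 0 := fun τ =>
    (hasDerivAt_const (0 : ℝ) τ).prodMk (hasDerivAt_id (0 : ℝ))
  have e1 : (fun τ => deriv (fun τ' => f (τ, τ')) 0) =ᶠ[𝓝 0]
      fun τ => fderiv ℝ f (τ, 0) (0, 1) := by
    have h4 : Tendsto (fun e : ℝ => (e, (0 : ℝ))) (𝓝 0) (𝓝 (0, 0)) :=
      (Continuous.prodMk_left (0 : ℝ)).tendsto 0
    filter_upwards [h4.eventually h3] with τ hτ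
    exact (hτ.hasFDerivAt.comp_hasDerivAt (0 : ℝ) (hr τ)).deriv
  have e2 : (fun τ' => deriv (fun τ => f (τ, τ')) 0) =ᶠ[𝓝 0]
      fun τ' => fderiv ℝ f (0, τ') (1, 0) := by
    have h4 : Tendsto (fun e : ℝ => ((0 : ℝ), e)) (𝓝 0) (𝓝 (0, 0)) :=
      (Continuous.prodMk_right (0 : ℝ)).tendsto 0
    filter_upwards [h4.eventually h3] with τ hτ
    exact (hτ.hasFDerivAt.comp_hasDerivAt (0 : ℝ) (hl τ)).deriv
  have d1 : HasDerivAt (fun τ : ℝ => fderiv ℝ f (τ, 0) (0, 1))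
      (fderiv ℝ (fderiv ℝ f) (0, 0) (1, 0) (0, 1)) 0 := by
    have := (HasFDerivAt.comp_hasDerivAt (0 : ℝ) (f := fun τ : ℝ => (τ, (0 : ℝ)))
      hd.hasFDerivAt (hl 0)).clm_apply
      (hasDerivAt_const (0 : ℝ) ((0 : ℝ), (1 : ℝ)))
    simpa using this
  have d2 : HasDerivAt (fun τ' : ℝ => fderiv ℝ f (0, τ') (1, 0))
      (fderiv ℝ (fderiv ℝ f) (0, 0) (0, 1) (1, 0)) 0 := by
    have := (HasFDerivAt.comp_hasDerivAt (0 : ℝ) (f := fun τ : ℝ => ((0 : ℝ), τ))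
      hd.hasFDerivAt (hr 0)).clm_apply
      (hasDerivAt_const (0 : ℝ) ((1 : ℝ), (0 : ℝ)))
    simpa using this
  rw [e1.deriv_eq, e2.deriv_eq, d1.deriv, d2.deriv]
  exact hf.isSymmSndFDerivAt (by simpa [one_add_one_eq_two] using two_le_infty) _ _

theorem integrableOn_ball_of_continuousOn {𝕜 : Type} [NormedRing 𝕜] [NormedAlgebra ℝ 𝕜]
    {f : Space → 𝕜} {c : Space} {r : ℝ}
    (hf : ContinuousOn f (Metric.closedBall c r)) : IntegrableOn f (Metric.ball c r) :=
  (hf.integrableOn_compact (isCompact_closedBall c r)).mono_set Metric.ball_subset_closedBall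

/-- Differentiation under the integral sign over a ball, for an integrand smooth near the closed
ball: by compactness the derivative is bounded uniformly for small parameters. -/
theorem hasDerivAt_integral_ball {𝕜 : Type} [NormedRing 𝕜] [NormedAlgebra ℝ 𝕜] {f : ℝ × Space → 𝕜}
    {w : Space → 𝕜} {c : Space} {r : ℝ}
    (hw : Continuous w) (hf : ∀ y ∈ Metric.closedBall c r, ContDiffAt ℝ ∞ f (0, y)) :
    HasDerivAt (fun τ => ∫ y in Metric.ball c r, w y * f (τ, y))
      (∫ y in Metric.ball c r, w y * deriv (fun τ => f (τ, y)) 0) 0 := by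
  set K := Metric.closedBall c r with hK
  have hKc : IsCompact K := isCompact_closedBall c r
  let U : Set (ℝ × Space) := {p | ContDiffAt ℝ 1 f p}
  have hUo : IsOpen U := isOpen_iff_mem_nhds.2 fun p hp =>
    ContDiffAt.eventually (n := 1) hp (by simp)
  have hUK : ({0} : Set ℝ) ×ˢ K ⊆ U := by
    rintro ⟨τ, y⟩ ⟨hτ, hy⟩
    obtain rfl : τ = 0 := hτ
    exact (hf y hy).of_le (m := 1) (mod_cast le_top)
  obtain ⟨V, W, hV, hW, h0V, hKW, hVW⟩ := generalized_tube_lemma isCompact_singleton hKc hUo hUK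
  obtain ⟨ε, hε, hεV⟩ := Metric.isOpen_iff.1 hV 0 (h0V rfl)
  have hI : Metric.closedBall (0 : ℝ) (ε / 2) ⊆ V :=
    (Metric.closedBall_subset_ball (by linarith)).trans hεV
  have hsub : Metric.closedBall (0 : ℝ) (ε / 2) ×ˢ K ⊆ U :=
    (Set.prod_mono hI hKW).trans hVW
  have hcd₀ : ∀ p ∈ Metric.closedBall (0 : ℝ) (ε / 2) ×ˢ K, ContDiffAt ℝ 1 f p :=
    fun p hp => hsub hp
  have hcd : ∀ τ ∈ Metric.closedBall (0 : ℝ) (ε / 2), ∀ y ∈ K,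
      ContDiffAt ℝ 1 f (τ, y) := fun τ hτ y hy => hcd₀ _ ⟨hτ, hy⟩
  have hfc : ContinuousOn f (Metric.closedBall (0 : ℝ) (ε / 2) ×ˢ K) := fun p hp =>
    (hcd₀ p hp).continuousAt.continuousWithinAt
  have hDc : ContinuousOn (fun p => fderiv ℝ f p ((1 : ℝ), (0 : Space)))
      (Metric.closedBall (0 : ℝ) (ε / 2) ×ˢ K) := fun p hp =>
    ((((hcd₀ p hp).fderiv_right (m := 0) (by simp)).continuousAt).clm_apply
      continuousAt_const).continuousWithinAt
  have hcomp : IsCompact (Metric.closedBall (0 : ℝ) (ε / 2) ×ˢ K) :=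
    (isCompact_closedBall _ _).prod hKc
  obtain ⟨C, hC⟩ := hcomp.exists_bound_of_continuousOn hDc
  obtain ⟨C', hC'⟩ := hKc.exists_bound_of_continuousOn hw.continuousOn
  have hslice : ∀ τ ∈ Metric.closedBall (0 : ℝ) (ε / 2), ContinuousOn (fun y => f (τ, y)) K :=
    fun τ hτ => hfc.comp (Continuous.prodMk_right τ).continuousOn fun y hy => ⟨hτ, hy⟩
  have hsliceD : ContinuousOn (fun y => fderiv ℝ f (0, y) ((1 : ℝ), (0 : Space))) K :=
    hDc.comp (Continuous.prodMk_right (0 : ℝ)).continuousOn fun y hy =>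
      ⟨Metric.mem_closedBall_self (by linarith), hy⟩
  have hder : ∀ τ ∈ Metric.closedBall (0 : ℝ) (ε / 2), ∀ y ∈ K,
      HasDerivAt (fun τ => f (τ, y)) (fderiv ℝ f (τ, y) ((1 : ℝ), (0 : Space))) τ :=
    fun τ hτ y hy => ((hcd τ hτ y hy).differentiableAt
      one_ne_zero).hasFDerivAt.comp_hasDerivAt τ
        ((hasDerivAt_id τ).prodMk (hasDerivAt_const τ y))
  have hnb : Metric.closedBall (0 : ℝ) (ε / 2) ∈ 𝓝 (0 : ℝ) :=
    Metric.closedBall_mem_nhds _ (by linarith)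
  have hmain := hasDerivAt_integral_of_dominated_loc_of_deriv_le
    (μ := volume.restrict (Metric.ball c r)) (F := fun τ y => w y * f (τ, y))
    (F' := fun τ y => w y * fderiv ℝ f (τ, y) ((1 : ℝ), (0 : Space)))
    (bound := fun _ => C' * C) (x₀ := (0 : ℝ)) hnb ?_ ?_ ?_ ?_ ?_ ?_
  · have h2 := hmain.2
    have he : (∫ y in Metric.ball c r, w y * fderiv ℝ f (0, y) ((1 : ℝ), (0 : Space)))
        = ∫ y in Metric.ball c r, w y * deriv (fun τ => f (τ, y)) 0 := by
      refine setIntegral_congr_fun measurableSet_ball fun y hy => ?_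
      rw [(hder 0 (mem_of_mem_nhds hnb) y (Metric.ball_subset_closedBall hy)).deriv]
    rwa [he] at h2
  · filter_upwards [hnb] with τ hτ
    exact (integrableOn_ball_of_continuousOn
      (hw.continuousOn.mul (hslice τ hτ))).aestronglyMeasurable
  · exact integrableOn_ball_of_continuousOn
      (hw.continuousOn.mul (hslice 0 (mem_of_mem_nhds hnb)))
  · exact (integrableOn_ball_of_continuousOn
      (hw.continuousOn.mul hsliceD)).aestronglyMeasurable
  · refine (ae_restrict_iff' measurableSet_ball).2 (Eventually.of_forall fun y hy τ hτ => ?_)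
    have hy' := Metric.ball_subset_closedBall hy
    exact (norm_mul_le _ _).trans <| mul_le_mul (hC' y hy') (hC (τ, y) ⟨hτ, hy'⟩) (norm_nonneg _)
      ((norm_nonneg _).trans (hC' y hy'))
  · exact integrableOn_const measure_ball_lt_top.ne
  · refine (ae_restrict_iff' measurableSet_ball).2 (Eventually.of_forall fun y hy τ hτ => ?_)
    exact (hder τ hτ y (Metric.ball_subset_closedBall hy)).const_mul (w y)

theorem integrable_prod_ball {f : Space × Space → ℂ} {c c' : Space} {r : ℝ}
    (hf : ContinuousOn f (Metric.closedBall c r ×ˢ Metric.closedBall c' r)) :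
    Integrable f ((volume.restrict (Metric.ball c r)).prod
      (volume.restrict (Metric.ball c' r))) := by
  rw [Measure.prod_restrict]
  exact ((hf.integrableOn_compact ((isCompact_closedBall c r).prod
    (isCompact_closedBall c' r)))).mono_set
      (Set.prod_mono Metric.ball_subset_closedBall Metric.ball_subset_closedBall)

/-! ### Finite propagation speed of the Dirac equation -/

/-- The real part of the sesquilinear form of a matrix `H` on spinors. -/
def spinForm (H : Matrix (Fin 4) (Fin 4) ℂ) (ψ χ : Fin 4 → ℂ) : ℝ :=
  (∑ s, ∑ u, conj (ψ s) * H s u * χ u).re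

theorem spinForm_comm {H : Matrix (Fin 4) (Fin 4) ℂ} (hH : H.IsHermitian) (ψ χ : Fin 4 → ℂ) :
    spinForm H ψ χ = spinForm H χ ψ := by
  have h : conj (∑ s, ∑ u, conj (ψ s) * H s u * χ u) = ∑ s, ∑ u, conj (χ s) * H s u * ψ u := by
    simp only [map_sum, map_mul, Complex.conj_conj]
    rw [Finset.sum_comm]
    refine Finset.sum_congr rfl fun s _ => Finset.sum_congr rfl fun u _ => ?_
    have h' : conj (H u s) = H s u := hH.apply s u
    rw [h']
    ring
  unfold spinForm
  rw [← h, Complex.conj_re]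

theorem hasDerivAt_spinForm {H : Matrix (Fin 4) (Fin 4) ℂ} (hH : H.IsHermitian)
    {ψ : ℝ → Fin 4 → ℂ} {ψ' : Fin 4 → ℂ} {t : ℝ}
    (hψ : ∀ s, HasDerivAt (fun τ => ψ τ s) (ψ' s) t) :
    HasDerivAt (fun τ => spinForm H (ψ τ) (ψ τ)) (2 * spinForm H (ψ t) ψ') t := by
  have h1 : HasDerivAt (fun τ => ∑ s, ∑ u, conj (ψ τ s) * H s u * ψ τ u)
      (∑ s, ∑ u, (conj (ψ' s) * H s u * ψ t u + conj (ψ t s) * H s u * ψ' u)) t :=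
    HasDerivAt.fun_sum fun s _ => HasDerivAt.fun_sum fun u _ =>
      (((hψ s).star).mul_const (H s u)).mul (hψ u)
  have h2 := Complex.reCLM.hasFDerivAt.comp_hasDerivAt t h1
  have h3 : Complex.reCLM
      (∑ s, ∑ u, (conj (ψ' s) * H s u * ψ t u + conj (ψ t s) * H s u * ψ' u))
      = 2 * spinForm H (ψ t) ψ' := by
    rw [two_mul]
    nth_rewrite 1 [spinForm_comm hH]
    simp only [Finset.sum_add_distrib, spinForm, Complex.reCLM_apply, Complex.add_re]
  rw [← h3]
  exact h2

theorem isHermitian_diracAlpha (a : Fin 3) : (diracAlpha a).IsHermitian := by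
  ext i j
  fin_cases a <;> fin_cases i <;> fin_cases j <;>
    simp [diracAlpha, Matrix.conjTranspose_apply]

/-- The velocity of the Dirac current is at most `1`. The reason is that the matrix
`∑ₐ wₐ αᵃ` has square `‖w‖²`. -/
theorem sum_mul_spinForm_diracAlpha_le {w : Fin 3 → ℝ} {c : ℝ} (hc : 0 < c)
    (hw : ∑ a, w a ^ 2 ≤ c ^ 2) (ψ : Fin 4 → ℂ) :
    ∑ a, w a * spinForm (diracAlpha a) ψ ψ ≤ c * spinForm 1 ψ ψ := by
  have h1 : 0 ≤ spinForm 1 ψ ψ := by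
    simp only [spinForm, Matrix.one_apply, mul_ite, mul_one, mul_zero, ite_mul, zero_mul,
      Finset.sum_ite_eq, Finset.mem_univ, if_true, Complex.re_sum]
    refine Finset.sum_nonneg fun s _ => ?_
    rw [Complex.mul_re, Complex.conj_re, Complex.conj_im]
    nlinarith [sq_nonneg (ψ s).re, sq_nonneg (ψ s).im]
  have h2 : 0 ≤ ∑ s, Complex.normSq (c * ψ s - ∑ u, (∑ a, (w a : ℂ) * diracAlpha a s u) * ψ u) :=
    Finset.sum_nonneg fun s _ => Complex.normSq_nonneg _
  have h3 : ∑ s, Complex.normSq (c * ψ s - ∑ u, (∑ a, (w a : ℂ) * diracAlpha a s u) * ψ u)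
      = (c ^ 2 + ∑ a, w a ^ 2) * spinForm 1 ψ ψ
        - 2 * c * ∑ a, w a * spinForm (diracAlpha a) ψ ψ := by
    simp only [spinForm, Fin.sum_univ_four, Fin.sum_univ_three, diracAlpha, Complex.normSq_apply]
    simp
    ring
  have h4 : 2 * c * ∑ a, w a * spinForm (diracAlpha a) ψ ψ ≤ 2 * c * (c * spinForm 1 ψ ψ) := by
    nlinarith
  exact le_of_mul_le_mul_left h4 (by linarith)

theorem spinForm_one_self (ψ : Fin 4 → ℂ) :
    spinForm 1 ψ ψ = ∑ s, Complex.normSq (ψ s) := by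
  simp only [spinForm, Matrix.one_apply, mul_ite, mul_one, mul_zero, ite_mul, zero_mul,
    Finset.sum_ite_eq, Finset.mem_univ, if_true, Complex.re_sum]
  refine Finset.sum_congr rfl fun s _ => ?_
  rw [Complex.mul_re, Complex.conj_re, Complex.conj_im, Complex.normSq_apply]
  ring

/-- The continuity equation: the density of a solution of the Dirac equation changes by the
negative divergence of the current. -/
theorem continuity_equation {m : ℝ} {ψ ψt : Fin 4 → ℂ} {D : Fin 3 → Fin 4 → ℂ}
    (h : ∀ s, Complex.I * ψt s = -Complex.I * ∑ a, ∑ u, diracAlpha a s u * D a u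
      + (m : ℂ) * ∑ u, diracBeta s u * ψ u) :
    spinForm 1 ψ ψt = -∑ a, spinForm (diracAlpha a) ψ (D a) := by
  have h1 : ∀ s, ψt s = -(∑ a, ∑ u, diracAlpha a s u * D a u)
      - Complex.I * ((m : ℂ) * ∑ u, diracBeta s u * ψ u) := by
    intro s
    have := congrArg (fun x => -Complex.I * x) (h s)
    simp only [mul_add, ← mul_assoc, neg_mul, Complex.I_mul_I, mul_neg, neg_neg, one_mul] at this
    rw [this]
    ring
  simp only [spinForm, h1, Fin.sum_univ_four, Fin.sum_univ_three, diracAlpha, diracBeta]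
  simp
  ring

/-- The weight of the energy estimate, positive inside the backward light cone with base the ball of
radius `R` around `y₀` and zero outside. -/
def coneWeight (R : ℝ) (y₀ : Space) (p : ℝ × Space) : ℝ :=
  expNegInvGlue ((R - p.1) ^ 2 - ‖p.2 - y₀‖ ^ 2)

theorem contDiff_coneWeight (R : ℝ) (y₀ : Space) : ContDiff ℝ ∞ (coneWeight R y₀) :=
  expNegInvGlue.contDiff.comp
    (((contDiff_const.sub contDiff_fst).pow 2).sub ((contDiff_snd.sub contDiff_const).norm_sq ℝ))

theorem hasDerivAt_expNegInvGlue (x : ℝ) :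
    HasDerivAt expNegInvGlue (deriv expNegInvGlue x) x :=
  ((expNegInvGlue.contDiff (n := 1)).differentiable (by simp) x).hasDerivAt

theorem deriv_expNegInvGlue_of_nonpos {x : ℝ} (hx : x ≤ 0) : deriv expNegInvGlue x = 0 := by
  refine IsLocalMin.deriv_eq_zero (Eventually.of_forall fun y => ?_)
  rw [expNegInvGlue.zero_of_nonpos hx]
  exact expNegInvGlue.nonneg y

theorem hasDerivAt_coneWeight_time (R : ℝ) (y₀ : Space) (t : ℝ) (y : Space) :
    HasDerivAt (fun τ => coneWeight R y₀ (τ, y))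
      (deriv expNegInvGlue ((R - t) ^ 2 - ‖y - y₀‖ ^ 2) * (-2 * (R - t))) t := by
  have h : HasDerivAt (fun τ : ℝ => (R - τ) ^ 2 - ‖y - y₀‖ ^ 2) (-2 * (R - t)) t := by
    have := (((hasDerivAt_id t).const_sub R).pow 2).sub_const (‖y - y₀‖ ^ 2)
    refine this.congr_deriv ?_
    simp only [id]
    ring
  exact (hasDerivAt_expNegInvGlue _).comp t h

theorem fderiv_coneWeight_space (R : ℝ) (y₀ : Space) (t : ℝ) (y : Space) (a : Fin 3) :
    fderiv ℝ (fun v => coneWeight R y₀ (t, v)) y (EuclideanSpace.single a 1)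
      = deriv expNegInvGlue ((R - t) ^ 2 - ‖y - y₀‖ ^ 2) * (-2 * (y a - y₀ a)) := by
  have h : HasFDerivAt (fun v : Space => (R - t) ^ 2 - ‖v - y₀‖ ^ 2)
      (-(2 • (innerSL ℝ (y - y₀)))) y := by
    have h1 : HasFDerivAt (fun v : Space => v - y₀) (ContinuousLinearMap.id ℝ Space) y :=
      (hasFDerivAt_id y).sub_const y₀
    have := h1.norm_sq.const_sub ((R - t) ^ 2)
    simpa using this
  have h2 := (hasDerivAt_expNegInvGlue ((R - t) ^ 2 - ‖y - y₀‖ ^ 2)).comp_hasFDerivAt y h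
  have h3 : fderiv ℝ (fun v => coneWeight R y₀ (t, v)) y = _ := h2.fderiv
  rw [h3]
  simp [EuclideanSpace.inner_single_right]

/-- The energy inside the light cone does not grow, because the current is at most the density.
Here `ε = 1` and `ε = -1` are the two directions of time. -/
theorem cone_energy_eq_zero {ρ : ℝ × Space → ℝ} {j : Fin 3 → ℝ × Space → ℝ} {ε R : ℝ} {y₀ : Space}
    (hε : ε ^ 2 = 1) (hR : 0 < R) (hρ : ContDiff ℝ ∞ ρ) (hj : ∀ a, ContDiff ℝ ∞ (j a))
    (hρ0 : ∀ p, 0 ≤ ρ p)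
    (hcont : ∀ t y, HasDerivAt (fun τ => ρ (τ, y))
      (-ε * ∑ a, fderiv ℝ (fun v => j a (t, v)) y (EuclideanSpace.single a 1)) t)
    (hle : ∀ p (w : Fin 3 → ℝ) (c : ℝ), 0 < c → ∑ a, w a ^ 2 ≤ c ^ 2 →
      ∑ a, w a * j a p ≤ c * ρ p)
    (hinit : ∀ y ∈ Metric.ball y₀ R, ρ (0, y) = 0) {t : ℝ} (ht : 0 ≤ t) (htR : t < R) :
    ρ (t, y₀) = 0 := by
  set B := Metric.ball y₀ R with hB
  let f : ℝ × Space → ℝ := fun p => coneWeight R y₀ p * ρ p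
  have hf : ContDiff ℝ ∞ f := (contDiff_coneWeight R y₀).mul hρ
  let En : ℝ → ℝ := fun t => ∫ y in B, f (t, y)
  let f' : ℝ → Space → ℝ := fun t y =>
    deriv expNegInvGlue ((R - t) ^ 2 - ‖y - y₀‖ ^ 2) * (-2 * (R - t)) * ρ (t, y)
      + coneWeight R y₀ (t, y) *
        (-ε * ∑ a, fderiv ℝ (fun v => j a (t, v)) y (EuclideanSpace.single a 1))
  have hEn : ∀ t, HasDerivAt En (∫ y in B, f' t y) t := by
    intro t
    have h1 := hasDerivAt_integral_ball (𝕜 := ℝ) (f := fun p => f (t + p.1, p.2))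
      (w := fun _ => 1) (c := y₀) (r := R) continuous_const
      (fun y _ => (hf.comp ((contDiff_const.add contDiff_fst).prodMk contDiff_snd)).contDiffAt)
    simp only [one_mul] at h1
    have h2 : ∀ y, HasDerivAt (fun τ => f (t + τ, y)) (f' t y) 0 := by
      intro y
      have h3 : HasDerivAt (fun τ => f (τ, y)) (f' t y) (t + 0) := by
        rw [add_zero]
        exact (hasDerivAt_coneWeight_time R y₀ t y).mul (hcont t y)
      exact h3.comp_const_add t 0
    simp only [fun y => (h2 y).deriv] at h1
    have h4 : HasDerivAt En (∫ y in B, f' t y) (t + 0) := by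
      have h5 : HasDerivAt (fun τ => En (t + τ)) (∫ y in B, f' t y) 0 := h1
      have h6 := (HasDerivAt.comp_sub_const (t + 0) t (f := fun τ => En (t + τ))
        (f' := ∫ y in B, f' t y) (by simpa using h5))
      simpa using h6
    simpa using h4
  have hjs : ∀ a t, ContDiff ℝ ∞ (fun v => j a (t, v)) := fun a t =>
    (hj a).comp (contDiff_const.prodMk contDiff_id)
  have hws : ∀ t, ContDiff ℝ ∞ (fun v => coneWeight R y₀ (t, v)) := fun t =>
    (contDiff_coneWeight R y₀).comp (contDiff_const.prodMk contDiff_id)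
  have hfc : ∀ {g : Space → ℝ}, ContDiff ℝ ∞ g → ∀ a : Fin 3,
      Continuous fun y => fderiv ℝ g y (EuclideanSpace.single a 1) := fun hg a =>
    (hg.continuous_fderiv (by simp)).clm_apply continuous_const
  -- integration by parts in each spatial direction
  have hparts : ∀ t, 0 ≤ t → t ≤ R → ∀ a : Fin 3,
      ∫ y in B, coneWeight R y₀ (t, y) *
          fderiv ℝ (fun v => j a (t, v)) y (EuclideanSpace.single a 1)
        = -∫ y in B, deriv expNegInvGlue ((R - t) ^ 2 - ‖y - y₀‖ ^ 2) * (-2 * (y a - y₀ a))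
            * j a (t, y) := by
    intro t ht htR a
    have hout : ∀ y, y ∉ B → (R - t) ^ 2 - ‖y - y₀‖ ^ 2 ≤ 0 := by
      intro y hy
      rw [hB, mem_ball_iff_norm, not_lt] at hy
      nlinarith [norm_nonneg (y - y₀)]
    have hw0 : ∀ y, y ∉ B → coneWeight R y₀ (t, y) = 0 := fun y hy =>
      expNegInvGlue.zero_of_nonpos (hout y hy)
    have hd0 : ∀ y, y ∉ B →
        fderiv ℝ (fun v => coneWeight R y₀ (t, v)) y (EuclideanSpace.single a 1) = 0 := by
      intro y hy
      rw [fderiv_coneWeight_space, deriv_expNegInvGlue_of_nonpos (hout y hy), zero_mul]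
    have hsupp : ∀ {g : Space → ℝ}, Continuous g → (∀ y, y ∉ B → g y = 0) →
        Integrable g := fun {g} hg h0 =>
      hg.integrable_of_hasCompactSupport (HasCompactSupport.intro (isCompact_closedBall y₀ R)
        fun y hy => h0 y fun hy' => hy (Metric.ball_subset_closedBall hy'))
    have hip := integral_mul_fderiv_eq_neg_fderiv_mul_of_integrable (μ := (volume : Measure Space))
      (f := fun v => coneWeight R y₀ (t, v)) (g := fun v => j a (t, v))
      (v := EuclideanSpace.single a 1)
      (hsupp ((hfc (hws t) a).mul (hjs a t).continuous) fun y hy => by rw [hd0 y hy, zero_mul])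
      (hsupp ((hws t).continuous.mul (hfc (hjs a t) a)) fun y hy => by rw [hw0 y hy, zero_mul])
      (hsupp ((hws t).continuous.mul (hjs a t).continuous) fun y hy => by
        rw [hw0 y hy, zero_mul])
      (fun y _ => (hws t).differentiable (by simp) y)
      (fun y _ => (hjs a t).differentiable (by simp) y)
    rw [setIntegral_eq_integral_of_forall_compl_eq_zero
      (fun y hy => by rw [hw0 y hy, zero_mul]), hip]
    simp only [fderiv_coneWeight_space]
    rw [setIntegral_eq_integral_of_forall_compl_eq_zero
      (fun y hy => by rw [deriv_expNegInvGlue_of_nonpos (hout y hy), zero_mul, zero_mul])]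
  have hdc : Continuous (deriv expNegInvGlue) :=
    (expNegInvGlue.contDiff (n := 1)).continuous_deriv (by simp)
  have hηc : ∀ t, Continuous fun y : Space =>
      deriv expNegInvGlue ((R - t) ^ 2 - ‖y - y₀‖ ^ 2) := fun t =>
    hdc.comp (by fun_prop)
  have hneg : ∀ t, 0 ≤ t → t < R → ∫ y in B, f' t y ≤ 0 := by
    intro t ht htR
    have hρc : Continuous fun y => ρ (t, y) :=
      hρ.continuous.comp (Continuous.prodMk_right t)
    have hI1 : IntegrableOn (fun y => deriv expNegInvGlue ((R - t) ^ 2 - ‖y - y₀‖ ^ 2)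
        * (-2 * (R - t)) * ρ (t, y)) B :=
      integrableOn_ball_of_continuousOn
        (((hηc t).mul continuous_const).mul hρc).continuousOn
    have hI2 : ∀ a, IntegrableOn (fun y => coneWeight R y₀ (t, y) *
          fderiv ℝ (fun v => j a (t, v)) y (EuclideanSpace.single a 1)) B := fun a =>
      integrableOn_ball_of_continuousOn ((hws t).continuous.mul (hfc (hjs a t) a)).continuousOn
    have hI3 : ∀ a, IntegrableOn (fun y => deriv expNegInvGlue ((R - t) ^ 2 - ‖y - y₀‖ ^ 2)
        * (-2 * (y a - y₀ a)) * j a (t, y)) B := fun a =>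
      integrableOn_ball_of_continuousOn (((hηc t).mul (continuous_const.mul
        (by fun_prop))).mul (hjs a t).continuous).continuousOn
    have h1 : ∀ y, f' t y = deriv expNegInvGlue ((R - t) ^ 2 - ‖y - y₀‖ ^ 2)
          * (-2 * (R - t)) * ρ (t, y)
        + -ε * ∑ a, coneWeight R y₀ (t, y) *
          fderiv ℝ (fun v => j a (t, v)) y (EuclideanSpace.single a 1) := by
      intro y
      simp only [f', Finset.mul_sum]
      congr 1
      exact Finset.sum_congr rfl fun a _ => by ring
    have h2 : ∫ y in B, f' t y = ∫ y in B,
        (deriv expNegInvGlue ((R - t) ^ 2 - ‖y - y₀‖ ^ 2) * (-2 * (R - t)) * ρ (t, y)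
        + ε * ∑ a, deriv expNegInvGlue ((R - t) ^ 2 - ‖y - y₀‖ ^ 2)
            * (-2 * (y a - y₀ a)) * j a (t, y)) := by
      simp only [h1]
      rw [integral_add hI1 ((integrable_finsetSum _ fun a _ => hI2 a).const_mul _),
        integral_add hI1 ((integrable_finsetSum _ fun a _ => hI3 a).const_mul _),
        integral_const_mul, integral_const_mul, integral_finsetSum _ (fun a _ => hI2 a),
        integral_finsetSum _ (fun a _ => hI3 a)]
      simp only [hparts t ht htR.le, Finset.sum_neg_distrib]
      ring
    rw [h2]
    refine integral_nonpos fun y => ?_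
    have h3 : deriv expNegInvGlue ((R - t) ^ 2 - ‖y - y₀‖ ^ 2) * (-2 * (R - t)) * ρ (t, y)
        + ε * ∑ a, deriv expNegInvGlue ((R - t) ^ 2 - ‖y - y₀‖ ^ 2)
            * (-2 * (y a - y₀ a)) * j a (t, y)
        = -(2 * deriv expNegInvGlue ((R - t) ^ 2 - ‖y - y₀‖ ^ 2) *
          ((R - t) * ρ (t, y) - ∑ a, (-ε * (y a - y₀ a)) * j a (t, y))) := by
      simp only [Fin.sum_univ_three]
      ring
    change _ ≤ (0 : ℝ)
    rw [h3, neg_nonpos]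
    rcases le_or_gt ((R - t) ^ 2 - ‖y - y₀‖ ^ 2) 0 with h | h
    · rw [deriv_expNegInvGlue_of_nonpos h]
      simp
    · refine mul_nonneg (mul_nonneg zero_le_two expNegInvGlue.monotone.deriv_nonneg)
        (sub_nonneg.2 (hle _ _ _ (by linarith) ?_))
      have h4 : ‖y - y₀‖ ^ 2 = ∑ a, (y a - y₀ a) ^ 2 := by
        rw [EuclideanSpace.norm_sq_eq]
        simp
      simp only [mul_pow, neg_sq, hε, one_mul]
      linarith
  have hanti : AntitoneOn En (Set.Icc 0 t) := by
    refine antitoneOn_of_deriv_nonpos (convex_Icc 0 t)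
      (fun s _ => (hEn s).continuousAt.continuousWithinAt)
      (fun s _ => (hEn s).differentiableAt.differentiableWithinAt) fun s hs => ?_
    rw [interior_Icc] at hs
    rw [(hEn s).deriv]
    exact hneg s hs.1.le (hs.2.trans htR)
  have hE0 : En 0 = 0 := by
    refine setIntegral_eq_zero_of_forall_eq_zero fun y hy => ?_
    simp only [f, hinit y hy, mul_zero]
  have hEt : En t ≤ 0 := hE0 ▸ hanti (Set.left_mem_Icc.2 ht) (Set.right_mem_Icc.2 ht) ht
  by_contra hne
  have hzero : ∀ y, y ∉ B → f (t, y) = 0 := by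
    intro y hy
    have : coneWeight R y₀ (t, y) = 0 := by
      refine expNegInvGlue.zero_of_nonpos ?_
      rw [hB, mem_ball_iff_norm, not_lt] at hy
      simp only
      nlinarith [norm_nonneg (y - y₀)]
    simp only [f, this, zero_mul]
  have hpos : 0 < ∫ y, f (t, y) := by
    refine Continuous.integral_pos_of_hasCompactSupport_nonneg_nonzero (x := y₀)
      (hf.continuous.comp (Continuous.prodMk_right t))
      (HasCompactSupport.intro (isCompact_closedBall y₀ R) fun y hy =>
        hzero y fun hy' => hy (Metric.ball_subset_closedBall hy'))
      (fun y => mul_nonneg (expNegInvGlue.nonneg _) (hρ0 _)) ?_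
    refine mul_ne_zero (expNegInvGlue.pos_of_pos ?_).ne' hne
    have : 0 < R - t := by linarith
    simp only [sub_self, norm_zero]
    nlinarith
  rw [← setIntegral_eq_integral_of_forall_compl_eq_zero hzero] at hpos
  exact absurd hpos hEt.not_gt

/-- A solution of the Dirac equation with initial values supported in the ball of radius `δ` vanishes
outside the light cone of this ball. -/
theorem dirac_eq_zero_of_spacelike {m δ : ℝ} {G : Fin 4 → Spacetime → ℂ}
    (hG : ∀ s, ContDiff ℝ ∞ (G s))
    (hD : ∀ s (t : ℝ) (y : Space), Complex.I * deriv (fun τ : ℝ => G s (τ, y)) t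
      = diracFree m (fun u v => G u (t, v)) y s)
    (h0 : ∀ s y, δ < ‖y‖ → G s (0, y) = 0) {t : ℝ} {y : Space} (hty : |t| + δ < ‖y‖) (s : Fin 4) :
    G s (t, y) = 0 := by
  obtain ⟨ε, hε, hεt⟩ : ∃ ε : ℝ, ε ^ 2 = 1 ∧ ε * |t| = t := by
    rcases le_total 0 t with h | h
    · exact ⟨1, by norm_num, by rw [abs_of_nonneg h, one_mul]⟩
    · exact ⟨-1, by norm_num, by rw [abs_of_nonpos h]; ring⟩
  let ψ : ℝ × Space → Fin 4 → ℂ := fun p s => G s (ε * p.1, p.2)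
  have hψ : ∀ s, ContDiff ℝ ∞ (fun p => ψ p s) := fun s =>
    (hG s).comp ((contDiff_const.mul contDiff_fst).prodMk contDiff_snd)
  have hform : ∀ H, ContDiff ℝ ∞ (fun p => spinForm H (ψ p) (ψ p)) := by
    intro H
    have h1 : ContDiff ℝ ∞ (fun p => ∑ s, ∑ u, conj (ψ p s) * H s u * ψ p u) :=
      ContDiff.sum fun s _ => ContDiff.sum fun u _ =>
        (((Complex.conjCLE.contDiff).comp (hψ s)).mul contDiff_const).mul (hψ u)
    exact Complex.reCLM.contDiff.comp h1
  have hGt : ∀ s t y, DifferentiableAt ℝ (fun τ => G s (τ, y)) t := fun s t y =>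
    ((hG s).comp (contDiff_id.prodMk contDiff_const)).differentiable (by simp) t
  have hGy : ∀ s t y, DifferentiableAt ℝ (fun v => G s (t, v)) y := fun s t y =>
    ((hG s).comp (contDiff_const.prodMk contDiff_id)).differentiable (by simp) y
  have hkey := cone_energy_eq_zero (ρ := fun p => spinForm 1 (ψ p) (ψ p))
    (j := fun a p => spinForm (diracAlpha a) (ψ p) (ψ p)) (ε := ε) (R := ‖y‖ - δ) (y₀ := y) hε
    (by linarith [abs_nonneg t]) (hform 1) (fun a => hform _)
    (fun p => by
      rw [spinForm_one_self]
      exact Finset.sum_nonneg fun s _ => Complex.normSq_nonneg _)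
    (fun t y => ?_)
    (fun p w c hc hw => sum_mul_spinForm_diracAlpha_le hc hw _)
    (fun v hv => ?_) (abs_nonneg t) (by linarith)
  · simp only [spinForm_one_self, ψ, hεt] at hkey
    exact Complex.normSq_eq_zero.1
      ((Finset.sum_eq_zero_iff_of_nonneg fun s _ => Complex.normSq_nonneg _).1 hkey s
        (Finset.mem_univ s))
  · have h1 : ∀ s, HasDerivAt (fun τ => ψ (τ, y) s)
        ((ε : ℂ) * deriv (fun τ => G s (τ, y)) (ε * t)) t := by
      intro s
      have h2 : HasDerivAt (fun τ : ℝ => ε * τ) ε t := by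
        simpa using (hasDerivAt_id t).const_mul ε
      have h3 := HasDerivAt.scomp t (hGt s (ε * t) y).hasDerivAt h2
      rw [← Complex.real_smul]
      exact h3
    have h4 := hasDerivAt_spinForm (Matrix.isHermitian_one) h1
    have h5 : ∀ a, fderiv ℝ (fun v => spinForm (diracAlpha a) (ψ (t, v)) (ψ (t, v))) y
        (EuclideanSpace.single a 1) = 2 * spinForm (diracAlpha a) (ψ (t, y))
          (fun u => lineDeriv ℝ (fun v => G u (ε * t, v)) y (EuclideanSpace.single a 1)) := by
      intro a
      have h6 : DifferentiableAt ℝ (fun v => spinForm (diracAlpha a) (ψ (t, v)) (ψ (t, v))) y :=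
        ((hform (diracAlpha a)).comp (contDiff_const.prodMk contDiff_id)).differentiable
          (by simp) y
      rw [← h6.lineDeriv_eq_fderiv]
      have h7 : ∀ u, HasDerivAt
          (fun τ : ℝ => ψ (t, y + τ • EuclideanSpace.single a (1 : ℝ)) u)
          (lineDeriv ℝ (fun v => G u (ε * t, v)) y (EuclideanSpace.single a 1)) 0 := fun u =>
        (hGy u (ε * t) y).lineDifferentiableAt.hasLineDerivAt
      have h8 := (hasDerivAt_spinForm (isHermitian_diracAlpha a) h7).deriv
      simp only [zero_smul, add_zero] at h8
      exact h8
    have h9 := continuity_equation (m := m) (ψ := ψ (t, y))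
      (ψt := fun s => deriv (fun τ => G s (τ, y)) (ε * t))
      (D := fun a u => lineDeriv ℝ (fun v => G u (ε * t, v)) y (EuclideanSpace.single a 1))
      (fun s => hD s (ε * t) y)
    have h10 : spinForm 1 (ψ (t, y)) (fun s => (ε : ℂ) * deriv (fun τ => G s (τ, y)) (ε * t))
        = ε * spinForm 1 (ψ (t, y)) (fun s => deriv (fun τ => G s (τ, y)) (ε * t)) := by
      unfold spinForm
      rw [← Complex.re_ofReal_mul, Finset.mul_sum]
      congr 1
      refine Finset.sum_congr rfl fun s _ => ?_
      rw [Finset.mul_sum]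
      exact Finset.sum_congr rfl fun u _ => by ring
    convert h4 using 1
    rw [h10, h9]
    simp only [h5, ← Finset.mul_sum]
    ring
  · have hv' : δ < ‖v‖ := by
      rw [mem_ball_iff_norm, norm_sub_rev] at hv
      linarith [norm_sub_norm_le y v]
    simp only [spinForm_one_self, ψ, mul_zero]
    exact Finset.sum_eq_zero fun s _ => by rw [h0 s v hv', map_zero]

/-! ### Admissible families of configurations -/

instance (L : Finset ℕ) : DecidablePred (Present (M := M) L)
  | .inl _ => isTrue trivial
  | .inr l => inferInstanceAs (Decidable (l ∈ L))

theorem Present.mono {L L' : Finset ℕ} (h : L ⊆ L') {m : Name M} (hm : Present L m) :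
    Present L' m := by
  rcases m with k | l
  · trivial
  · exact h hm

theorem Present.of_insert {L : Finset ℕ} {n : ℕ} {m : Name M} (hm : Present (insert n L) m)
    (hne : m ≠ .inr n) : Present L m := by
  rcases m with k | l
  · trivial
  · exact (Finset.mem_insert.1 hm).resolve_left fun h => hne (congrArg _ h)

theorem present_insert_iff {L : Finset ℕ} {n : ℕ} {m : Name M} (hne : m ≠ .inr n) :
    Present (insert n L) m ↔ Present L m :=
  ⟨fun h => h.of_insert hne, fun h => h.mono (Finset.subset_insert _ _)⟩

theorem present_erase_iff {L : Finset ℕ} {n : ℕ} {m : Name M} (hne : m ≠ .inr n) :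
    Present (L.erase n) m ↔ Present L m := by
  rcases m with k | l
  · rfl
  · have h : l ≠ n := fun h => hne (congrArg _ h)
    exact ⟨fun hm => Finset.mem_of_mem_erase hm, fun hm => Finset.mem_erase.2 ⟨h, hm⟩⟩

theorem lt_freshName {L : Finset ℕ} {l : ℕ} (hl : l ∈ L) : l < freshName L :=
  Finset.le_sup (f := Nat.succ) hl

theorem freshName_notMem (L : Finset ℕ) : freshName L ∉ L := fun h => lt_irrefl _ (lt_freshName h)

/-- Two present particles are separated in `z`, or they have equal times and are moved
simultaneously when the common times of `F` and of `F'` are changed. -/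
def Separated (S : Separation M δ) (F F' : Finset (Name M)) (L : Finset ℕ)
    (z : Name M → Spacetime) : Prop :=
  ∀ m n, Present L m → Present L n →
    S.rel m n (z m) (z n) ∨ ((z m).1 = (z n).1 ∧ (m ∈ F ↔ n ∈ F) ∧ (m ∈ F' ↔ n ∈ F'))

theorem Separated.symm {S : Separation M δ} {F F' : Finset (Name M)} {L : Finset ℕ}
    {z : Name M → Spacetime} (h : Separated S F F' L z) : Separated S F' F L z :=
  fun m n hm hn => (h m n hm hn).imp_right fun h => ⟨h.1, h.2.2, h.2.1⟩

theorem Admissible.mono {S : Separation M δ} {E : Type} {L L' : Finset ℕ}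
    {ζ : E → Name M → Spacetime} {e₀ : E} (h : Admissible S L ζ e₀) (hL : L' ⊆ L) :
    Admissible S L' ζ e₀ :=
  fun m n hm hn => h m n (hm.mono hL) (hn.mono hL)

theorem Admissible.insert {S : Separation M δ} {E : Type} {L : Finset ℕ}
    {ζ : E → Name M → Spacetime} {e₀ : E} (h : Admissible S L ζ e₀) (n₀ : ℕ) (k : Fin M)
    {y : E → Space} (hy : y e₀ ∈ Metric.closedBall (ζ e₀ (.inl k)).2 δ) :
    Admissible S (insert n₀ L)
      (fun e => Function.update (ζ e) (.inr n₀) ((ζ e (.inl k)).1, y e)) e₀ := by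
  intro m n hm hn
  by_cases hmn : m = .inr n₀ <;> by_cases hnn : n = .inr n₀
  · right
    intro e
    rw [hmn, hnn]
  · subst hmn
    simp only [Function.update_self, Function.update_of_ne hnn]
    exact (h (.inl k) n trivial (hn.of_insert hnn)).imp_left fun h => S.absorb n₀ hy h
  · subst hnn
    simp only [Function.update_self, Function.update_of_ne hmn]
    refine (h (.inl k) m trivial (hm.of_insert hmn)).imp (fun h => S.symm (S.absorb n₀ hy h))
      fun h e => (h e).symm
  · simp only [Function.update_of_ne hmn, Function.update_of_ne hnn]
    exact h m n (hm.of_insert hmn) (hn.of_insert hnn)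

theorem contDiff_update {E : Type} [NormedAddCommGroup E] [NormedSpace ℝ E]
    {ζ : E → Name M → Spacetime} (hζ : ∀ m, ContDiff ℝ ∞ (fun e => ζ e m)) (n₀ : ℕ) (k : Fin M)
    {y : E → Space} (hy : ContDiff ℝ ∞ y) (m : Name M) :
    ContDiff ℝ ∞
      (fun e => Function.update (ζ e) (.inr n₀) ((ζ e (.inl k)).1, y e) m) := by
  by_cases hm : m = .inr n₀
  · subst hm
    simp only [Function.update_self]
    exact (hζ _).fst.prodMk hy
  · simp only [Function.update_of_ne hm]
    exact hζ m

/-- The directions in which the particles of the family `F` move with common time. -/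
def IsDirection (F : Finset (Name M)) (ξ : Name M → Spacetime) : Prop :=
  (∃ a : ℝ, ∀ m ∈ F, (ξ m).1 = a) ∧ ∀ m, m ∉ F → ξ m = 0

theorem isDirection_zero (F : Finset (Name M)) : IsDirection F (0 : Name M → Spacetime) :=
  ⟨⟨0, fun _ _ => rfl⟩, fun _ _ => rfl⟩

theorem IsDirection.time_eq {F : Finset (Name M)} {ξ : Name M → Spacetime} (h : IsDirection F ξ)
    {m n : Name M} (hmn : m ∈ F ↔ n ∈ F) : (ξ m).1 = (ξ n).1 := by
  obtain ⟨⟨a, ha⟩, h0⟩ := h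
  by_cases hm : m ∈ F
  · rw [ha m hm, ha n (hmn.1 hm)]
  · rw [h0 m hm, h0 n fun hn => hm (hmn.2 hn)]

theorem Separated.admissible {S : Separation M δ} {F F' : Finset (Name M)} {L : Finset ℕ}
    {z : Name M → Spacetime} (h : Separated S F F' L z) {ξ ξ' : Name M → Spacetime}
    (hξ : IsDirection F ξ) (hξ' : IsDirection F' ξ') {E : Type} {e₀ : E} {a b : E → ℝ}
    (ha : a e₀ = 0) (hb : b e₀ = 0) :
    Admissible S L (fun e m => z m + a e • ξ m + b e • ξ' m) e₀ := by
  intro m n hm hn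
  simp only [ha, hb, zero_smul, add_zero]
  refine (h m n hm hn).imp_right fun h e => ?_
  simp only [Prod.fst_add, Prod.smul_fst, h.1, hξ.time_eq h.2.1, hξ'.time_eq h.2.2]

theorem update_add_smul {F : Finset (Name M)} {ξ : Name M → Spacetime} (hξ : IsDirection F ξ)
    {n₀ : ℕ} (hn : .inr n₀ ∉ F) {k : Fin M} (hk : .inl k ∉ F) (z : Name M → Spacetime) (y : Space)
    (τ : ℝ) :
    (fun m => Function.update z (.inr n₀) ((z (.inl k)).1, y) m + τ • ξ m)
      = Function.update (fun m => z m + τ • ξ m) (.inr n₀)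
          ((z (.inl k) + τ • ξ (.inl k)).1, y) := by
  funext m
  by_cases hm : m = .inr n₀
  · subst hm
    simp [hξ.2 _ hn, hξ.2 _ hk]
  · simp [Function.update_of_ne hm]

/-! ### Directional derivatives of functions of labelled configurations -/

/-- The derivative in the direction `ξ`; for `none` the function itself, so that the terms of order
zero of a Dirac operator have the same form as those of first order. -/
def derivAlong (o : Option (Name M → Spacetime)) (Ψ : LabelledFun M) : LabelledFun M :=
  fun L z σ => match o with
  | none => Ψ L z σ
  | some ξ => deriv (fun τ : ℝ => Ψ L (fun m => z m + τ • ξ m) σ) 0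

theorem derivAlong_const_mul (o : Option (Name M → Spacetime)) {Θ Θ' : LabelledFun M}
    {L L' : Finset ℕ} {σ σ' : Name M → Fin 4} (c : ℂ) (z : Name M → Spacetime)
    (h : ∀ z, Θ L z σ = c * Θ' L' z σ') :
    derivAlong o Θ L z σ = c * derivAlong o Θ' L' z σ' := by
  rcases o with _ | ξ
  · exact h z
  · simp only [derivAlong, h]
    exact deriv_const_mul_field _

theorem IsSmoothLabelled.contDiffAt_derivAlong {S : Separation M δ} {Ψ : LabelledFun M}
    (hΨ : IsSmoothLabelled S Ψ) {E : Type} [NormedAddCommGroup E] [NormedSpace ℝ E] {L : Finset ℕ}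
    {ζ : E → Name M → Spacetime} {e₀ : E} (σ : Name M → Fin 4)
    (hζ : ∀ m, ContDiff ℝ ∞ (fun e => ζ e m)) (o : Option (Name M → Spacetime))
    (h : Admissible S L (fun (p : E × ℝ) m => ζ p.1 m + p.2 • o.getD 0 m) (e₀, 0)) :
    ContDiffAt ℝ ∞ (fun e => derivAlong o Ψ L (ζ e) σ) e₀ := by
  rcases o with _ | ξ
  · refine hΨ.smooth σ hζ fun m n hm hn => (h m n hm hn).imp (fun h => ?_) fun h e => ?_
    · simpa using h
    · simpa using h (e, 0)
  · refine contDiffAt_deriv_right (hΨ.smooth σ (fun m => ?_) h)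
    exact ((hζ m).comp contDiff_fst).add (contDiff_snd.smul contDiff_const)

/-! ### Regular functions and linearity -/

/-- The regularity at `(L, z)` that makes the operators of the family `F` additive:
differentiability along the directions of `F`, and integrability of the integrands of the
absorption terms. -/
structure Regular (A : CutoffModel) (F : Finset (Name M)) (L : Finset ℕ)
    (z : Name M → Spacetime) (Θ : LabelledFun M) : Prop where
  differentiableAt : ∀ σ ξ, IsDirection F ξ →
    DifferentiableAt ℝ (fun τ : ℝ => Θ L (fun m => z m + τ • ξ m) σ) 0
  integrableOn : ∀ σ k, .inl k ∈ F →
    IntegrableOn (fun y => (A.φ (y - (z (.inl k)).2) : ℂ) *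
      Θ (insert (freshName L) L)
        (Function.update z (.inr (freshName L)) ((z (.inl k)).1, y)) σ)
      (Metric.ball (z (.inl k)).2 A.δ)

section Regular

variable {A : CutoffModel} {F : Finset (Name M)} {L : Finset ℕ} {z : Name M → Spacetime}

theorem Regular.add_smul {Θ₁ Θ₂ : LabelledFun M} (h₁ : Regular A F L z Θ₁)
    (h₂ : Regular A F L z Θ₂) (c : ℂ) : Regular A F L z (Θ₁ + c • Θ₂) where
  differentiableAt σ ξ hξ :=
    (h₁.differentiableAt σ ξ hξ).add ((h₂.differentiableAt σ ξ hξ).const_mul c)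
  integrableOn σ k hk := by
    refine ((h₁.integrableOn σ k hk).add ((h₂.integrableOn σ k hk).const_mul c)).congr ?_
    refine Eventually.of_forall fun y => ?_
    simp only [Pi.add_apply, Pi.smul_apply, smul_eq_mul]
    ring

theorem regular_zero : Regular A F L z (0 : LabelledFun M) where
  differentiableAt _ _ _ := differentiableAt_const _
  integrableOn σ k _ := by simp

theorem Regular.smul {Θ : LabelledFun M} (h : Regular A F L z Θ) (c : ℂ) :
    Regular A F L z (c • Θ) := by
  simpa using regular_zero.add_smul h c

theorem Regular.add {Θ₁ Θ₂ : LabelledFun M} (h₁ : Regular A F L z Θ₁)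
    (h₂ : Regular A F L z Θ₂) : Regular A F L z (Θ₁ + Θ₂) := by
  simpa using h₁.add_smul h₂ 1

theorem Regular.sub {Θ₁ Θ₂ : LabelledFun M} (h₁ : Regular A F L z Θ₁)
    (h₂ : Regular A F L z Θ₂) : Regular A F L z (Θ₁ - Θ₂) := by
  simpa [sub_eq_add_neg] using h₁.add_smul h₂ (-1)

theorem Regular.sum {ι : Type} {s : Finset ι} {Θ : ι → LabelledFun M}
    (h : ∀ i ∈ s, Regular A F L z (Θ i)) : Regular A F L z (∑ i ∈ s, Θ i) := by
  classical
  induction s using Finset.induction_on with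
  | empty => simpa using regular_zero
  | insert i s hi ih =>
    rw [Finset.sum_insert hi]
    exact (h i (Finset.mem_insert_self i s)).add
      (ih fun j hj => h j (Finset.mem_insert_of_mem hj))

/-- The operator `X` is linear on regular functions at `(L, z)`. -/
def LinearAt (A : CutoffModel) (F : Finset (Name M)) (L : Finset ℕ) (z : Name M → Spacetime)
    (X : LabelledFun M → LabelledFun M) : Prop :=
  ∀ Θ₁ Θ₂ (c : ℂ) σ, Regular A F L z Θ₁ → Regular A F L z Θ₂ →
    X (Θ₁ + c • Θ₂) L z σ = X Θ₁ L z σ + c * X Θ₂ L z σ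

variable {X : LabelledFun M → LabelledFun M}

theorem LinearAt.map_zero (hX : LinearAt A F L z X) (σ : Name M → Fin 4) : X 0 L z σ = 0 := by
  have h := hX 0 0 1 σ regular_zero regular_zero
  simpa using h

theorem LinearAt.map_smul (hX : LinearAt A F L z X) {Θ : LabelledFun M}
    (h : Regular A F L z Θ) (c : ℂ) (σ : Name M → Fin 4) :
    X (c • Θ) L z σ = c * X Θ L z σ := by
  have h := hX 0 Θ c σ regular_zero h
  rwa [zero_add, hX.map_zero, zero_add] at h

theorem LinearAt.map_sub (hX : LinearAt A F L z X) {Θ₁ Θ₂ : LabelledFun M}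
    (h₁ : Regular A F L z Θ₁) (h₂ : Regular A F L z Θ₂) (σ : Name M → Fin 4) :
    X (Θ₁ - Θ₂) L z σ = X Θ₁ L z σ - X Θ₂ L z σ := by
  have h := hX Θ₁ Θ₂ (-1) σ h₁ h₂
  rwa [neg_one_smul, ← sub_eq_add_neg, neg_one_mul, ← sub_eq_add_neg] at h

theorem LinearAt.map_sum (hX : LinearAt A F L z X) {ι : Type} {s : Finset ι}
    {Θ : ι → LabelledFun M} (h : ∀ i ∈ s, Regular A F L z (Θ i)) (σ : Name M → Fin 4) :
    X (∑ i ∈ s, Θ i) L z σ = ∑ i ∈ s, X (Θ i) L z σ := by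
  classical
  induction s using Finset.induction_on with
  | empty => simpa using hX.map_zero σ
  | insert i s hi ih =>
    have h1 := hX (Θ i) (∑ i ∈ s, Θ i) 1 σ (h i (Finset.mem_insert_self i s))
      (Regular.sum fun j hj => h j (Finset.mem_insert_of_mem hj))
    rw [one_smul, one_mul, ih fun j hj => h j (Finset.mem_insert_of_mem hj)] at h1
    rw [Finset.sum_insert hi, Finset.sum_insert hi, h1]

theorem LinearAt.sum {ι : Type} {s : Finset ι} {X : ι → LabelledFun M → LabelledFun M}
    (h : ∀ i ∈ s, LinearAt A F L z (X i)) :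
    LinearAt A F L z (fun Θ => ∑ i ∈ s, X i Θ) := by
  intro Θ₁ Θ₂ c σ h₁ h₂
  simp only [Finset.sum_apply]
  rw [Finset.mul_sum, ← Finset.sum_add_distrib]
  exact Finset.sum_congr rfl fun i hi => h i hi Θ₁ Θ₂ c σ h₁ h₂

theorem LinearAt.sub {X Y : LabelledFun M → LabelledFun M} (hX : LinearAt A F L z X)
    (hY : LinearAt A F L z Y) : LinearAt A F L z (fun Θ => X Θ - Y Θ) := by
  intro Θ₁ Θ₂ c σ h₁ h₂
  have h1 := hX Θ₁ Θ₂ c σ h₁ h₂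
  have h2 := hY Θ₁ Θ₂ c σ h₁ h₂
  simp only [Pi.sub_apply, h1, h2]
  ring

end Regular

/-- Sums of operators commute on `Ψ` if the summands do, provided that the summands are linear on
the functions that the others produce from `Ψ`. -/
theorem sum_commute {A : CutoffModel} {L : Finset ℕ}
    {z : Name M → Spacetime} {Ψ : LabelledFun M} {ι ι' : Type} {s : Finset ι} {s' : Finset ι'}
    {F : ι → Finset (Name M)} {F' : ι' → Finset (Name M)}
    {X : ι → LabelledFun M → LabelledFun M} {Y : ι' → LabelledFun M → LabelledFun M}
    (hX : ∀ i ∈ s, LinearAt A (F i) L z (X i)) (hY : ∀ j ∈ s', LinearAt A (F' j) L z (Y j))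
    (hXΨ : ∀ i ∈ s, ∀ j ∈ s', Regular A (F' j) L z (X i Ψ))
    (hYΨ : ∀ i ∈ s, ∀ j ∈ s', Regular A (F i) L z (Y j Ψ))
    {σ : Name M → Fin 4}
    (h : ∀ i ∈ s, ∀ j ∈ s', X i (Y j Ψ) L z σ = Y j (X i Ψ) L z σ) :
    (∑ i ∈ s, X i (∑ j ∈ s', Y j Ψ)) L z σ = (∑ j ∈ s', Y j (∑ i ∈ s, X i Ψ)) L z σ := by
  simp only [Finset.sum_apply]
  rw [Finset.sum_congr rfl fun i hi => (hX i hi).map_sum (hYΨ i hi) σ,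
    Finset.sum_congr rfl fun j hj => (hY j hj).map_sum (fun i hi => hXΨ i hi j hj) σ,
    Finset.sum_comm]
  exact Finset.sum_congr rfl fun j hj => Finset.sum_congr rfl fun i hi => h i hi j hj

/-! ### The free part as a sum of first-order terms -/

/-- A term of a free Hamiltonian or of a time derivative: the coefficient times a derivative, with
the spin index of one particle replaced. With `site = some (m, u)` the term refers to the particle
`m`, whose spin index becomes `u`. -/
structure FreeTerm (M : ℕ) where
  site : Option (Name M × Fin 4)
  coef : (Name M → Fin 4) → ℂ
  dir : Option (Name M → Spacetime)

/-- The spin indices after the action of the term. -/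
def FreeTerm.spin (t : FreeTerm M) (σ : Name M → Fin 4) : Name M → Fin 4 :=
  match t.site with
  | none => σ
  | some p => Function.update σ p.1 p.2

/-- The operator of a term; it vanishes if the particle concerned is absent. -/
def FreeTerm.op (t : FreeTerm M) (Ψ : LabelledFun M) : LabelledFun M := fun L z σ =>
  if ∀ p ∈ t.site, Present L p.1 then t.coef σ * derivAlong t.dir Ψ L z (t.spin σ) else 0

/-- The term involves only the particles of the family `F`, and these with a common time. -/
structure FreeTerm.IsOn (t : FreeTerm M) (F : Finset (Name M)) : Prop where
  site_mem : ∀ p ∈ t.site, p.1 ∈ F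
  coef_congr : ∀ σ σ' : Name M → Fin 4, (∀ m ∈ F, σ m = σ' m) → t.coef σ = t.coef σ'
  dir : IsDirection F (t.dir.getD 0)

section FreeTerm

variable {t t' : FreeTerm M} {F F' : Finset (Name M)}

theorem FreeTerm.IsOn.spin_apply (ht : t.IsOn F) (σ : Name M → Fin 4) {n : Name M}
    (hn : n ∉ F) : t.spin σ n = σ n := by
  rcases hp : t.site with _ | p
  · simp only [FreeTerm.spin, hp]
  · simp only [FreeTerm.spin, hp]
    rw [Function.update_of_ne]
    rintro rfl
    exact hn (ht.site_mem p hp)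

theorem FreeTerm.IsOn.spin_update (ht : t.IsOn F) (σ : Name M → Fin 4) {n : Name M}
    (hn : n ∉ F) (r : Fin 4) :
    t.spin (Function.update σ n r) = Function.update (t.spin σ) n r := by
  rcases hp : t.site with _ | p
  · simp only [FreeTerm.spin, hp]
  · simp only [FreeTerm.spin, hp]
    rw [Function.update_comm]
    rintro rfl
    exact hn (ht.site_mem p hp)

theorem FreeTerm.IsOn.coef_update (ht : t.IsOn F) (σ : Name M → Fin 4) {n : Name M}
    (hn : n ∉ F) (r : Fin 4) : t.coef (Function.update σ n r) = t.coef σ := by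
  refine ht.coef_congr _ _ fun m hm => Function.update_of_ne ?_ _ _
  rintro rfl
  exact hn hm

theorem FreeTerm.spin_comm (hFF' : Disjoint F F') (ht : t.IsOn F) (ht' : t'.IsOn F')
    (σ : Name M → Fin 4) : t'.spin (t.spin σ) = t.spin (t'.spin σ) := by
  rcases h : t.site with _ | p
  · simp only [FreeTerm.spin, h]
  · have h1 : ∀ σ, t.spin σ = Function.update σ p.1 p.2 := fun σ => by simp only [FreeTerm.spin, h]
    rw [h1, h1, ht'.spin_update]
    exact Finset.disjoint_left.1 hFF' (ht.site_mem p h)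

theorem FreeTerm.coef_spin (hFF' : Disjoint F F') (ht : t.IsOn F) (ht' : t'.IsOn F')
    (σ : Name M → Fin 4) : t'.coef (t.spin σ) = t'.coef σ :=
  ht'.coef_congr _ _ fun _ hm => ht.spin_apply σ (Finset.disjoint_right.1 hFF' hm)

theorem FreeTerm.IsOn.present_insert_iff (ht : t.IsOn F) {n₀ : ℕ} (hn : .inr n₀ ∉ F)
    (L : Finset ℕ) :
    (∀ p ∈ t.site, Present (insert n₀ L) p.1) ↔ ∀ p ∈ t.site, Present L p.1 := by
  refine forall₂_congr fun p hp => MultiTime.present_insert_iff ?_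
  intro h
  exact hn (h ▸ ht.site_mem p hp)

theorem FreeTerm.op_const_mul (t : FreeTerm M) {Θ Θ' : LabelledFun M}
    {L L' : Finset ℕ} {σ σ' : Name M → Fin 4} (c : ℂ) (z : Name M → Spacetime)
    (hL : (∀ p ∈ t.site, Present L p.1) ↔ ∀ p ∈ t.site, Present L' p.1)
    (hσ : t.coef σ = t.coef σ')
    (h : ∀ z, Θ L z (t.spin σ) = c * Θ' L' z (t.spin σ')) :
    t.op Θ L z σ = c * t.op Θ' L' z σ' := by
  simp only [FreeTerm.op, hL, hσ, derivAlong_const_mul t.dir c z h]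
  split_ifs <;> ring

theorem derivAlong_add_smul {A : CutoffModel} {L : Finset ℕ} {z : Name M → Spacetime}
    {Θ : LabelledFun M} (hΘ : Regular A F L z Θ) (c : ℂ) (Θ' : LabelledFun M)
    (hΘ' : Regular A F L z Θ') {o : Option (Name M → Spacetime)}
    (ho : IsDirection F (o.getD 0)) (σ : Name M → Fin 4) :
    derivAlong o (Θ + c • Θ') L z σ = derivAlong o Θ L z σ + c * derivAlong o Θ' L z σ := by
  rcases o with _ | ξ
  · rfl
  · have h1 := (hΘ.differentiableAt σ ξ ho).hasDerivAt
    have h2 := (hΘ'.differentiableAt σ ξ ho).hasDerivAt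
    exact (h1.add (h2.const_mul c)).deriv

theorem FreeTerm.IsOn.linearAt (ht : t.IsOn F) (A : CutoffModel) (L : Finset ℕ)
    (z : Name M → Spacetime) : LinearAt A F L z t.op := by
  intro Θ₁ Θ₂ c σ h₁ h₂
  simp only [FreeTerm.op, derivAlong_add_smul h₁ c Θ₂ h₂ ht.dir]
  split_ifs <;> ring

end FreeTerm

/-- The direction that changes the common time of `F`. -/
def timeDir (F : Finset (Name M)) : Name M → Spacetime := fun m => if m ∈ F then (1, 0) else 0

/-- The direction that moves the particle `m` along the `a`-th coordinate axis. -/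
def spaceDir (m : Name M) (a : Fin 3) : Name M → Spacetime :=
  Pi.single m (0, EuclideanSpace.single a 1)

theorem isDirection_timeDir (F : Finset (Name M)) : IsDirection F (timeDir F) :=
  ⟨⟨1, fun m hm => by simp [timeDir, hm]⟩, fun m hm => by simp [timeDir, hm]⟩

theorem isDirection_spaceDir {F : Finset (Name M)} {m : Name M} (hm : m ∈ F) (a : Fin 3) :
    IsDirection F (spaceDir m a) := by
  refine ⟨⟨0, fun n _ => ?_⟩, fun n hn => ?_⟩
  · by_cases h : n = m
    · subst h
      simp [spaceDir]
    · simp [spaceDir, Pi.single_eq_of_ne h]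
  · have h : n ≠ m := fun h => hn (h ▸ hm)
    simp [spaceDir, Pi.single_eq_of_ne h]

/-- The mass of a particle. -/
def CutoffModel.mass (A : CutoffModel) : Name M → ℝ
  | .inl _ => A.mx
  | .inr _ => A.my

/-- The matrix elements of a Dirac operator: `-i αᵃ` for `some a`, and the mass term for `none`. -/
def diracCoef (mass : ℝ) (s u : Fin 4) : Option (Fin 3) → ℂ
  | none => mass * diracBeta s u
  | some a => -Complex.I * diracAlpha a s u

/-- `i ∂_t - ∑ H^free` for the particles of a family that are present. -/
def freePart (A : CutoffModel) (F : Finset (Name M)) (Ψ : LabelledFun M) : LabelledFun M :=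
  fun L z σ => Complex.I * timeDeriv F Ψ L z σ
    - ∑ m ∈ F, if Present L m then freeH (A.mass m) m Ψ L z σ else 0

/-- The terms of `freePart`: `none` is the time derivative, the others are the matrix elements of
the Dirac operators. -/
def freePartTerm (A : CutoffModel) (F : Finset (Name M)) :
    Option (Name M × Fin 4 × Option (Fin 3)) → FreeTerm M
  | none => ⟨none, fun _ => Complex.I, some (timeDir F)⟩
  | some (m, u, o) =>
    ⟨some (m, u), fun σ => -diracCoef (A.mass m) (σ m) u o, o.map (spaceDir m)⟩

/-- The indices of the terms of `freePart`. -/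
def freePartIndex (F : Finset (Name M)) : Finset (Option (Name M × Fin 4 × Option (Fin 3))) :=
  Finset.insertNone (F ×ˢ Finset.univ)

theorem freePartTerm_isOn (A : CutoffModel) {F : Finset (Name M)}
    {i : Option (Name M × Fin 4 × Option (Fin 3))} (hi : i ∈ freePartIndex F) :
    (freePartTerm A F i).IsOn F := by
  rcases i with _ | ⟨m, u, o⟩
  · exact ⟨by simp [freePartTerm], fun _ _ _ => rfl, isDirection_timeDir F⟩
  · have hm : m ∈ F := by
      simpa [freePartIndex] using hi
    refine ⟨by simpa [freePartTerm] using hm, fun σ σ' h => ?_, ?_⟩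
    · simp only [freePartTerm, h m hm]
    · rcases o with _ | a
      · exact isDirection_zero F
      · exact isDirection_spaceDir hm a

theorem timeDeriv_eq_derivAlong (F : Finset (Name M)) (Ψ : LabelledFun M) (L : Finset ℕ)
    (z : Name M → Spacetime) (σ : Name M → Fin 4) :
    timeDeriv F Ψ L z σ = derivAlong (some (timeDir F)) Ψ L z σ := by
  have h : ∀ τ : ℝ, (fun m => if m ∈ F then ((z m).1 + τ, (z m).2) else z m)
      = fun m => z m + τ • timeDir F m := by
    intro τ
    funext m
    by_cases hm : m ∈ F
    · refine Prod.ext ?_ ?_ <;> simp [timeDir, hm]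
    · simp [timeDir, hm]
  simp only [timeDeriv, derivAlong, h]

theorem lineDeriv_eq_derivAlong (m : Name M) (a : Fin 3) (Ψ : LabelledFun M) (L : Finset ℕ)
    (z : Name M → Spacetime) (σ : Name M → Fin 4) :
    lineDeriv ℝ (fun v => Ψ L (Function.update z m ((z m).1, v)) σ) (z m).2
        (EuclideanSpace.single a 1)
      = derivAlong (some (spaceDir m a)) Ψ L z σ := by
  have h : ∀ τ : ℝ, Function.update z m ((z m).1, (z m).2 + τ • EuclideanSpace.single a (1 : ℝ))
      = fun n => z n + τ • spaceDir m a n := by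
    intro τ
    funext n
    by_cases hn : n = m
    · subst hn
      refine Prod.ext ?_ ?_ <;> simp [spaceDir]
    · simp [spaceDir, Function.update_of_ne hn, Pi.single_eq_of_ne hn]
  simp only [lineDeriv, derivAlong, h]

theorem freeH_eq_sum (mass : ℝ) (m : Name M) (Ψ : LabelledFun M) (L : Finset ℕ)
    (z : Name M → Spacetime) (σ : Name M → Fin 4) :
    freeH mass m Ψ L z σ = ∑ u, ∑ o, diracCoef mass (σ m) u o *
      derivAlong (o.map (spaceDir m)) Ψ L z (Function.update σ m u) := by
  simp only [freeH, diracFree, lineDeriv_eq_derivAlong, Fintype.sum_option, diracCoef,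
    Option.map_none, Option.map_some, Finset.sum_add_distrib, Finset.mul_sum]
  rw [add_comm, Finset.sum_comm]
  congr 1
  · refine Finset.sum_congr rfl fun u _ => ?_
    simp only [derivAlong, Prod.mk.eta, Function.update_eq_self]
    ring
  · exact Finset.sum_congr rfl fun u _ => Finset.sum_congr rfl fun a _ => by ring

theorem freePart_eq_sum (A : CutoffModel) (F : Finset (Name M)) (Ψ : LabelledFun M) :
    freePart A F Ψ = ∑ i ∈ freePartIndex F, (freePartTerm A F i).op Ψ := by
  funext L z σ
  simp only [Finset.sum_apply, freePartIndex, Finset.sum_insertNone, freePart,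
    Finset.sum_product, Fintype.sum_prod_type, sub_eq_add_neg, ← Finset.sum_neg_distrib]
  congr 1
  · simp [freePartTerm, FreeTerm.op, FreeTerm.spin, timeDeriv_eq_derivAlong]
  · refine Finset.sum_congr rfl fun m _ => ?_
    by_cases h : Present L m
    · simp only [if_pos h, freeH_eq_sum, ← Finset.sum_neg_distrib]
      refine Finset.sum_congr rfl fun u _ => Finset.sum_congr rfl fun o _ => ?_
      simp [freePartTerm, FreeTerm.op, FreeTerm.spin, h]
    · simp [freePartTerm, FreeTerm.op, h]

theorem linearAt_freePart (A : CutoffModel) (F : Finset (Name M)) (L : Finset ℕ)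
    (z : Name M → Spacetime) : LinearAt A F L z (freePart A F) := by
  have h : freePart A F = fun Θ => ∑ i ∈ freePartIndex F, (freePartTerm A F i).op Θ :=
    funext fun Θ => freePart_eq_sum A F Θ
  rw [h]
  exact LinearAt.sum fun i hi => (freePartTerm_isOn A hi).linearAt A L z

/-! ### Commutators of free terms -/

theorem Separated.admissible_left {S : Separation M δ} {F F' : Finset (Name M)} {L : Finset ℕ}
    {z : Name M → Spacetime} (h : Separated S F F' L z) {ξ : Name M → Spacetime}
    (hξ : IsDirection F ξ) {E : Type} {e₀ : E} {a : E → ℝ} (ha : a e₀ = 0) :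
    Admissible S L (fun e m => z m + a e • ξ m) e₀ := by
  have := h.admissible hξ (isDirection_zero F') ha ha
  simpa using this

theorem contDiff_add_smul {E : Type} [NormedAddCommGroup E] [NormedSpace ℝ E]
    (z ξ : Name M → Spacetime) {a : E → ℝ} (ha : ContDiff ℝ ∞ a) (m : Name M) :
    ContDiff ℝ ∞ (fun e => z m + a e • ξ m) :=
  contDiff_const.add (ha.smul contDiff_const)

section

variable {A : CutoffModel} {S : Separation M A.δ} {F F' : Finset (Name M)} {L : Finset ℕ}
  {z : Name M → Spacetime} {Ψ : LabelledFun M} {t t' : FreeTerm M}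

theorem differentiableAt_derivAlong (hΨ : IsSmoothLabelled S Ψ) (hsep : Separated S F F' L z)
    {ξ : Name M → Spacetime} (hξ : IsDirection F ξ) {o : Option (Name M → Spacetime)}
    (ho : IsDirection F' (o.getD 0)) (σ : Name M → Fin 4) :
    DifferentiableAt ℝ (fun τ : ℝ => derivAlong o Ψ L (fun m => z m + τ • ξ m) σ) 0 :=
  (hΨ.contDiffAt_derivAlong σ (contDiff_add_smul z ξ contDiff_id) o
    (hsep.admissible hξ ho (a := Prod.fst) (b := Prod.snd) rfl rfl)).differentiableAt (by simp)

theorem continuousOn_derivAlong_insert (hΨ : IsSmoothLabelled S Ψ)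
    (hsep : Separated S F F' L z) {k : Fin M} (hk : .inl k ∉ F') {n₀ : ℕ}
    (hn : .inr n₀ ∉ F') {o : Option (Name M → Spacetime)} (ho : IsDirection F' (o.getD 0))
    (σ : Name M → Fin 4) :
    ContinuousOn (fun y => derivAlong o Ψ (insert n₀ L)
      (Function.update z (.inr n₀) ((z (.inl k)).1, y)) σ)
      (Metric.closedBall (z (.inl k)).2 A.δ) := by
  intro y hy
  refine (ContDiffAt.continuousAt (hΨ.contDiffAt_derivAlong (e₀ := y) σ ?_ o ?_)).continuousWithinAt
  · exact contDiff_update (ζ := fun _ => z) (fun _ => contDiff_const) n₀ k contDiff_id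
  · refine Eq.subst (motive := fun ζ => Admissible S (insert n₀ L) ζ (y, (0 : ℝ)))
      (funext fun p => (update_add_smul ho hn hk z p.1 p.2).symm) ?_
    refine Admissible.insert (y := Prod.fst)
      (hsep.symm.admissible_left ho (a := Prod.snd) (e₀ := (y, (0 : ℝ))) rfl) n₀ k ?_
    simpa using hy

theorem FreeTerm.IsOn.regular (ht' : t'.IsOn F') (hΨ : IsSmoothLabelled S Ψ)
    (hFF' : Disjoint F F') (hsep : Separated S F F' L z) (hn' : .inr (freshName L) ∉ F') :
    Regular A F L z (t'.op Ψ) where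
  differentiableAt σ ξ hξ := by
    unfold FreeTerm.op
    split_ifs
    · exact (differentiableAt_derivAlong hΨ hsep hξ ht'.dir _).const_mul _
    · exact differentiableAt_const _
  integrableOn σ k hk := by
    have hk' : .inl k ∉ F' := Finset.disjoint_left.1 hFF' hk
    unfold FreeTerm.op
    split_ifs
    · refine integrableOn_ball_of_continuousOn (ContinuousOn.mul ?_ (continuousOn_const.mul
        (continuousOn_derivAlong_insert hΨ hsep hk' hn' ht'.dir _)))
      exact (Complex.continuous_ofReal.comp (A.φ_smooth.continuous.comp
        (continuous_id.sub continuous_const))).continuousOn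
    · simp

theorem derivAlong_comm (hΨ : IsSmoothLabelled S Ψ) (hsep : Separated S F F' L z)
    {o o' : Option (Name M → Spacetime)} (ho : IsDirection F (o.getD 0))
    (ho' : IsDirection F' (o'.getD 0)) (σ : Name M → Fin 4) :
    derivAlong o (derivAlong o' Ψ) L z σ = derivAlong o' (derivAlong o Ψ) L z σ := by
  rcases o with _ | ξ
  · rfl
  rcases o' with _ | ξ'
  · rfl
  have h := hΨ.smooth (ζ := fun (p : ℝ × ℝ) m => z m + p.1 • ξ m + p.2 • ξ' m) (e₀ := (0, 0)) σ
    (fun m => (contDiff_add_smul z ξ contDiff_fst m).add (contDiff_snd.smul contDiff_const))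
    (hsep.admissible ho ho' (a := Prod.fst) (b := Prod.snd) rfl rfl)
  have h' := deriv_deriv_comm h
  simp only [derivAlong]
  rw [h']
  simp only [add_right_comm _ (_ • ξ _)]

theorem FreeTerm.op_comm (ht : t.IsOn F) (ht' : t'.IsOn F') (hΨ : IsSmoothLabelled S Ψ)
    (hFF' : Disjoint F F') (hsep : Separated S F F' L z) (σ : Name M → Fin 4) :
    t.op (t'.op Ψ) L z σ = t'.op (t.op Ψ) L z σ := by
  by_cases h : ∀ p ∈ t.site, Present L p.1
  · by_cases h' : ∀ p ∈ t'.site, Present L p.1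
    · have e1 : t.op (t'.op Ψ) L z σ = t.coef σ * (t'.coef σ *
          derivAlong t.dir (derivAlong t'.dir Ψ) L z (t'.spin (t.spin σ))) := by
        rw [FreeTerm.op, if_pos h]
        congr 1
        refine derivAlong_const_mul _ _ z fun z' => ?_
        rw [FreeTerm.op, if_pos h', FreeTerm.coef_spin hFF' ht ht']
      have e2 : t'.op (t.op Ψ) L z σ = t'.coef σ * (t.coef σ *
          derivAlong t'.dir (derivAlong t.dir Ψ) L z (t.spin (t'.spin σ))) := by
        rw [FreeTerm.op, if_pos h']
        congr 1
        refine derivAlong_const_mul _ _ z fun z' => ?_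
        rw [FreeTerm.op, if_pos h, FreeTerm.coef_spin hFF'.symm ht' ht]
      rw [e1, e2, FreeTerm.spin_comm hFF' ht ht', derivAlong_comm hΨ hsep ht.dir ht'.dir]
      ring
    · rw [t.op_const_mul (Θ' := Ψ) 0 z Iff.rfl rfl fun z' => by
        rw [FreeTerm.op, if_neg h', zero_mul], zero_mul, FreeTerm.op, if_neg h']
  · rw [t'.op_const_mul (Θ' := Ψ) 0 z Iff.rfl rfl fun z' => by
        rw [FreeTerm.op, if_neg h, zero_mul], zero_mul, FreeTerm.op, if_neg h]

theorem freePart_comm (hΨ : IsSmoothLabelled S Ψ) (hFF' : Disjoint F F')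
    (hsep : Separated S F F' L z) (hn : .inr (freshName L) ∉ F) (hn' : .inr (freshName L) ∉ F')
    (σ : Name M → Fin 4) :
    freePart A F (freePart A F' Ψ) L z σ = freePart A F' (freePart A F Ψ) L z σ := by
  simp only [freePart_eq_sum]
  exact sum_commute (A := A) (F := fun _ => F) (F' := fun _ => F')
    (fun i hi => (freePartTerm_isOn A hi).linearAt A L z)
    (fun i hi => (freePartTerm_isOn A hi).linearAt A L z)
    (fun i hi _ _ => (freePartTerm_isOn A hi).regular hΨ hFF'.symm hsep.symm hn)
    (fun _ _ i hi => (freePartTerm_isOn A hi).regular hΨ hFF' hsep hn')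
    (fun i hi j hj =>
      FreeTerm.op_comm (freePartTerm_isOn A hi) (freePartTerm_isOn A hj) hΨ hFF' hsep σ)

theorem regular_freePart (hΨ : IsSmoothLabelled S Ψ) (hFF' : Disjoint F F')
    (hsep : Separated S F F' L z) (hn' : .inr (freshName L) ∉ F') :
    Regular A F L z (freePart A F' Ψ) := by
  rw [freePart_eq_sum]
  exact Regular.sum fun i hi => (freePartTerm_isOn A hi).regular hΨ hFF' hsep hn'

/-! ### Absorption terms -/

/-- The integral in the absorption term, for fixed spin indices of the `x`-particle and of the
absorbed particle. -/
def absorbInt (A : CutoffModel) (k : Fin M) (Ψ : LabelledFun M) : LabelledFun M := fun L z σ =>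
  ∫ y in Metric.ball (z (.inl k)).2 A.δ, (A.φ (y - (z (.inl k)).2) : ℂ) *
    Ψ (insert (freshName L) L) (Function.update z (.inr (freshName L)) ((z (.inl k)).1, y)) σ

theorem absorbH_eq (A : CutoffModel) (k : Fin M) (Ψ : LabelledFun M) (L : Finset ℕ)
    (z : Name M → Spacetime) (σ : Name M → Fin 4) :
    absorbH A k Ψ L z σ = (Real.sqrt (L.card + 1) : ℂ) * ∑ r, ∑ s, conj (A.g r (σ (.inl k)) s) *
      absorbInt A k Ψ L z
        (Function.update (Function.update σ (.inl k) r) (.inr (freshName L)) s) :=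
  rfl

theorem linearAt_absorbH {k : Fin M} (hk : .inl k ∈ F) : LinearAt A F L z (absorbH A k) := by
  intro Θ₁ Θ₂ c σ h₁ h₂
  have h : ∀ σ, absorbInt A k (Θ₁ + c • Θ₂) L z σ
      = absorbInt A k Θ₁ L z σ + c * absorbInt A k Θ₂ L z σ := by
    intro σ
    unfold absorbInt
    rw [← integral_const_mul, ← integral_add (h₁.integrableOn σ k hk)
      ((h₂.integrableOn σ k hk).const_mul c)]
    congr 1
    funext y
    simp only [Pi.add_apply, Pi.smul_apply, smul_eq_mul]
    ring
  simp only [absorbH_eq, h, mul_add, Finset.sum_add_distrib, Finset.mul_sum]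
  congr 1
  exact Finset.sum_congr rfl fun r _ => Finset.sum_congr rfl fun s _ => by ring

theorem continuous_phi_sub (A : CutoffModel) (x : Space) :
    Continuous fun y => (A.φ (y - x) : ℂ) :=
  Complex.continuous_ofReal.comp (A.φ_smooth.continuous.comp (continuous_id.sub continuous_const))

/-- Absorption by a particle of another family commutes with derivatives. -/
theorem hasDerivAt_absorbInt (hΨ : IsSmoothLabelled S Ψ) (hFF' : Disjoint F F')
    (hsep : Separated S F F' L z) (hn : .inr (freshName L) ∉ F) {ξ : Name M → Spacetime}
    (hξ : IsDirection F ξ) {k : Fin M} (hk : .inl k ∈ F') (σ : Name M → Fin 4) :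
    HasDerivAt (fun τ : ℝ => absorbInt A k Ψ L (fun m => z m + τ • ξ m) σ)
      (absorbInt A k (derivAlong (some ξ) Ψ) L z σ) 0 := by
  have hk' : .inl k ∉ F := Finset.disjoint_right.1 hFF' hk
  have h := hasDerivAt_integral_ball (c := (z (.inl k)).2) (r := A.δ)
    (w := fun y => (A.φ (y - (z (.inl k)).2) : ℂ))
    (f := fun p => Ψ (insert (freshName L) L) (Function.update (fun m => z m + p.1 • ξ m)
      (.inr (freshName L)) ((z (.inl k) + p.1 • ξ (.inl k)).1, p.2)) σ)
    (continuous_phi_sub A _) (fun y hy => ?_)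
  · have hz : ∀ τ : ℝ, z (.inl k) + τ • ξ (.inl k) = z (.inl k) := fun τ => by
      rw [hξ.2 _ hk', smul_zero, add_zero]
    have e1 : ∀ y τ, Function.update (fun m => z m + τ • ξ m) (.inr (freshName L))
          ((z (.inl k) + τ • ξ (.inl k)).1, y)
        = fun m => Function.update z (.inr (freshName L)) ((z (.inl k)).1, y) m + τ • ξ m :=
      fun y τ => (update_add_smul hξ hn hk' z y τ).symm
    simp only [e1] at h
    have e2 : ∀ τ : ℝ, absorbInt A k Ψ L (fun m => z m + τ • ξ m) σ
        = ∫ y in Metric.ball (z (.inl k)).2 A.δ, (A.φ (y - (z (.inl k)).2) : ℂ) *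
          Ψ (insert (freshName L) L) (fun m => Function.update z (.inr (freshName L))
            ((z (.inl k)).1, y) m + τ • ξ m) σ := by
      intro τ
      simp only [absorbInt, ← e1, hz]
    simp only [e2]
    exact h
  · exact hΨ.smooth (E := ℝ × Space)
      (ζ := fun p => Function.update (fun m => z m + p.1 • ξ m)
        (.inr (freshName L)) ((z (.inl k) + p.1 • ξ (.inl k)).1, p.2)) σ
      (contDiff_update (contDiff_add_smul z ξ contDiff_fst) _ k contDiff_snd)
      (Admissible.insert (y := Prod.snd) (hsep.admissible_left hξ (E := ℝ × Space) (e₀ := (0, y))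
        (a := Prod.fst) rfl) _ k (by simpa using hy))

theorem integrable_absorb_absorb (hΨ : IsSmoothLabelled S Ψ)
    (hsep : Separated S F F' L z) {k k' : Fin M} (σ : Name M → Fin 4) (n₀ n₁ : ℕ) :
    Integrable (fun p : Space × Space =>
      (A.φ (p.1 - (z (.inl k)).2) : ℂ) * ((A.φ (p.2 - (z (.inl k')).2) : ℂ) *
        Ψ (insert n₁ (insert n₀ L)) (Function.update (Function.update z (.inr n₀)
          ((z (.inl k)).1, p.1)) (.inr n₁) ((z (.inl k')).1, p.2)) σ))
      ((volume.restrict (Metric.ball (z (.inl k)).2 A.δ)).prod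
        (volume.restrict (Metric.ball (z (.inl k')).2 A.δ))) := by
  refine integrable_prod_ball (ContinuousOn.mul ?_ (ContinuousOn.mul ?_ ?_))
  · exact ((continuous_phi_sub A _).comp continuous_fst).continuousOn
  · exact ((continuous_phi_sub A _).comp continuous_snd).continuousOn
  · rintro ⟨y, y'⟩ ⟨hy, hy'⟩
    refine (ContDiffAt.continuousAt (𝕜 := ℝ) (n := ∞) ?_).continuousWithinAt
    have hadm : Admissible S L (fun _ : Space × Space => z) (y, y') := by
      simpa using hsep.admissible_left (isDirection_zero F) (E := Space × Space) (e₀ := (y, y'))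
        (a := fun _ => 0) rfl
    exact hΨ.smooth (E := Space × Space)
      (ζ := fun p => Function.update (Function.update z (.inr n₀)
          ((z (.inl k)).1, p.1)) (.inr n₁) ((z (.inl k')).1, p.2)) σ
      (contDiff_update (ζ := fun p : Space × Space =>
          Function.update z (.inr n₀) ((z (.inl k)).1, p.1))
        (contDiff_update (ζ := fun _ => z) (fun _ => contDiff_const) n₀ k contDiff_fst) n₁ k'
        contDiff_snd)
      (Admissible.insert (y := Prod.snd) (hadm.insert n₀ k (y := Prod.fst) hy) n₁ k'
        (by simpa using hy'))

theorem hasDerivAt_absorbH (hΨ : IsSmoothLabelled S Ψ) (hFF' : Disjoint F F')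
    (hsep : Separated S F F' L z) (hn : .inr (freshName L) ∉ F) {ξ : Name M → Spacetime}
    (hξ : IsDirection F ξ) {k : Fin M} (hk : .inl k ∈ F') (σ : Name M → Fin 4) :
    HasDerivAt (fun τ : ℝ => absorbH A k Ψ L (fun m => z m + τ • ξ m) σ)
      ((Real.sqrt (L.card + 1) : ℂ) * ∑ r, ∑ s, conj (A.g r (σ (.inl k)) s) *
        absorbInt A k (derivAlong (some ξ) Ψ) L z
          (Function.update (Function.update σ (.inl k) r) (.inr (freshName L)) s)) 0 := by
  have h : ∀ r s, HasDerivAt (fun τ : ℝ => conj (A.g r (σ (.inl k)) s) *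
      absorbInt A k Ψ L (fun m => z m + τ • ξ m)
        (Function.update (Function.update σ (.inl k) r) (.inr (freshName L)) s))
      (conj (A.g r (σ (.inl k)) s) * absorbInt A k (derivAlong (some ξ) Ψ) L z
        (Function.update (Function.update σ (.inl k) r) (.inr (freshName L)) s)) 0 := fun r s =>
    (hasDerivAt_absorbInt hΨ hFF' hsep hn hξ hk _).const_mul _
  exact (HasDerivAt.fun_sum fun r _ => HasDerivAt.fun_sum fun s _ => h r s).const_mul _

theorem regular_absorbH (hΨ : IsSmoothLabelled S Ψ) (hFF' : Disjoint F F')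
    (hsep : Separated S F F' L z) (hn : .inr (freshName L) ∉ F) {k : Fin M} (hk : .inl k ∈ F') :
    Regular A F L z (absorbH A k Ψ) where
  differentiableAt σ ξ hξ := (hasDerivAt_absorbH hΨ hFF' hsep hn hξ hk σ).differentiableAt
  integrableOn σ k' hk' := by
    simp only [absorbH_eq, Finset.mul_sum]
    refine integrable_finsetSum _ fun r _ => integrable_finsetSum _ fun s _ => ?_
    have h := (integrable_absorb_absorb hΨ hsep (k := k') (k' := k)
      (Function.update (Function.update σ (.inl k) r)
        (.inr (freshName (insert (freshName L) L))) s)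
      (freshName L) (freshName (insert (freshName L) L))).integral_prod_left
    refine ((h.const_mul (conj (A.g r (σ (.inl k)) s))).const_mul
      (Real.sqrt ((insert (freshName L) L).card + 1) : ℂ)).congr
      (Eventually.of_forall fun y => ?_)
    simp only [integral_const_mul, absorbInt]
    rw [Function.update_of_ne (by simp : (Sum.inl k : Name M) ≠ _)]
    ring

theorem FreeTerm.op_absorbH (ht : t.IsOn F) (hΨ : IsSmoothLabelled S Ψ) (hFF' : Disjoint F F')
    (hsep : Separated S F F' L z) (hn : .inr (freshName L) ∉ F) {k : Fin M} (hk : .inl k ∈ F')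
    (σ : Name M → Fin 4) :
    t.op (absorbH A k Ψ) L z σ = absorbH A k (t.op Ψ) L z σ := by
  have hk' : .inl k ∉ F := Finset.disjoint_right.1 hFF' hk
  have h1 : ∀ σ, derivAlong t.dir (absorbH A k Ψ) L z σ
      = (Real.sqrt (L.card + 1) : ℂ) * ∑ r, ∑ s, conj (A.g r (σ (.inl k)) s) *
      absorbInt A k (derivAlong t.dir Ψ) L z
        (Function.update (Function.update σ (.inl k) r) (.inr (freshName L)) s) := by
    intro σ
    have hd := ht.dir
    generalize t.dir = o at hd
    rcases o with _ | ξ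
    · rfl
    · exact (hasDerivAt_absorbH hΨ hFF' hsep hn hd hk σ).deriv
  have h2 : ∀ r s, absorbInt A k (t.op Ψ) L z
        (Function.update (Function.update σ (.inl k) r) (.inr (freshName L)) s)
      = if ∀ p ∈ t.site, Present L p.1 then t.coef σ * absorbInt A k (derivAlong t.dir Ψ) L z
        (Function.update (Function.update (t.spin σ) (.inl k) r) (.inr (freshName L)) s)
        else 0 := by
    intro r s
    unfold absorbInt
    simp only [FreeTerm.op, ht.present_insert_iff hn, ht.spin_update _ hn, ht.spin_update _ hk',
      ht.coef_update _ hn, ht.coef_update _ hk']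
    split_ifs
    · rw [← integral_const_mul]
      congr 1
      funext y
      ring
    · simp
  rw [absorbH_eq]
  simp only [h2]
  rw [FreeTerm.op, h1, ht.spin_apply σ hk']
  split_ifs
  · simp only [Finset.mul_sum]
    exact Finset.sum_congr rfl fun r _ => Finset.sum_congr rfl fun s _ => by ring
  · simp

/-- The absorption operators of the particles of a family. -/
def absorbPart (A : CutoffModel) (F : Finset (Name M)) (Ψ : LabelledFun M) : LabelledFun M :=
  ∑ k : Fin M with .inl k ∈ F, absorbH A k Ψ

theorem linearAt_absorbPart : LinearAt A F L z (absorbPart A F) :=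
  LinearAt.sum fun _ hk => linearAt_absorbH (Finset.mem_filter.1 hk).2

theorem regular_absorbPart (hΨ : IsSmoothLabelled S Ψ) (hFF' : Disjoint F F')
    (hsep : Separated S F F' L z) (hn : .inr (freshName L) ∉ F) :
    Regular A F L z (absorbPart A F' Ψ) :=
  Regular.sum fun _ hk => regular_absorbH hΨ hFF' hsep hn (Finset.mem_filter.1 hk).2

theorem freePart_absorbPart_comm (hΨ : IsSmoothLabelled S Ψ) (hFF' : Disjoint F F')
    (hsep : Separated S F F' L z) (hn : .inr (freshName L) ∉ F)
    (σ : Name M → Fin 4) :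
    freePart A F (absorbPart A F' Ψ) L z σ = absorbPart A F' (freePart A F Ψ) L z σ := by
  simp only [freePart_eq_sum, absorbPart]
  exact sum_commute (A := A) (F := fun _ => F) (F' := fun _ => F')
    (fun i hi => (freePartTerm_isOn A hi).linearAt A L z)
    (fun k hk => linearAt_absorbH (Finset.mem_filter.1 hk).2)
    (fun i hi _ _ => (freePartTerm_isOn A hi).regular hΨ hFF'.symm hsep.symm hn)
    (fun _ _ k hk => regular_absorbH hΨ hFF' hsep hn (Finset.mem_filter.1 hk).2)
    (fun i hi k hk => FreeTerm.op_absorbH (freePartTerm_isOn A hi) hΨ hFF' hsep hn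
      (Finset.mem_filter.1 hk).2 σ)

end

/-! ### Two absorptions -/

theorem update_update_comp_swap {X : Type} (w : Name M → X) {a b : Name M} (hab : a ≠ b)
    (p p' : X) :
    Function.update (Function.update w a p) b p' ∘ Equiv.swap a b
      = Function.update (Function.update w a p') b p := by
  funext m
  by_cases ha : m = a
  · subst ha
    simp [hab]
  · by_cases hb : m = b
    · subst hb
      simp [hab]
    · simp [Equiv.swap_apply_of_ne_of_ne ha hb, Function.update_of_ne ha, Function.update_of_ne hb]

section

variable {A : CutoffModel} {S : Separation M A.δ} {F F' : Finset (Name M)} {L : Finset ℕ}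
  {z : Name M → Spacetime} {Ψ : LabelledFun M}

/-- The double integral for the absorption of two particles, for fixed spin indices. -/
def doubleAbsorbInt (A : CutoffModel) (k k' : Fin M) (Ψ : LabelledFun M) : LabelledFun M :=
  fun L z σ => ∫ y in Metric.ball (z (.inl k)).2 A.δ, ∫ y' in Metric.ball (z (.inl k')).2 A.δ,
    (A.φ (y - (z (.inl k)).2) : ℂ) * ((A.φ (y' - (z (.inl k')).2) : ℂ) *
      Ψ (insert (freshName (insert (freshName L) L)) (insert (freshName L) L))
        (Function.update (Function.update z (.inr (freshName L)) ((z (.inl k)).1, y))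
          (.inr (freshName (insert (freshName L) L))) ((z (.inl k')).1, y')) σ)

theorem absorbInt_absorbH (hΨ : IsSmoothLabelled S Ψ) (hsep : Separated S F F' L z)
    (k k' : Fin M) (σ : Name M → Fin 4) :
    absorbInt A k (absorbH A k' Ψ) L z σ
      = (Real.sqrt ((insert (freshName L) L).card + 1) : ℂ) * ∑ r', ∑ s',
        conj (A.g r' (σ (.inl k')) s') * doubleAbsorbInt A k k' Ψ L z
          (Function.update (Function.update σ (.inl k') r')
            (.inr (freshName (insert (freshName L) L))) s') := by
  let τ : Fin 4 → Fin 4 → Name M → Fin 4 := fun r' s' =>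
    Function.update (Function.update σ (.inl k') r')
      (.inr (freshName (insert (freshName L) L))) s'
  let J : Fin 4 → Fin 4 → Space → ℂ := fun r' s' y => ∫ y' in Metric.ball (z (.inl k')).2 A.δ,
    (A.φ (y - (z (.inl k)).2) : ℂ) * ((A.φ (y' - (z (.inl k')).2) : ℂ) *
      Ψ (insert (freshName (insert (freshName L) L)) (insert (freshName L) L))
        (Function.update (Function.update z (.inr (freshName L)) ((z (.inl k)).1, y))
          (.inr (freshName (insert (freshName L) L))) ((z (.inl k')).1, y')) (τ r' s'))
  have hint : ∀ r' s', IntegrableOn (J r' s') (Metric.ball (z (.inl k)).2 A.δ) := fun r' s' =>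
    (integrable_absorb_absorb hΨ hsep (k := k) (k' := k') (τ r' s')
      (freshName L) (freshName (insert (freshName L) L))).integral_prod_left
  have h1 : absorbInt A k (absorbH A k' Ψ) L z σ = ∫ y in Metric.ball (z (.inl k)).2 A.δ,
      (Real.sqrt ((insert (freshName L) L).card + 1) : ℂ) * ∑ r', ∑ s',
        conj (A.g r' (σ (.inl k')) s') * J r' s' y := by
    unfold absorbInt
    refine integral_congr_ae (Eventually.of_forall fun y => ?_)
    simp only [absorbH_eq, absorbInt, J, integral_const_mul, Finset.mul_sum]
    refine Finset.sum_congr rfl fun r' _ => Finset.sum_congr rfl fun s' _ => ?_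
    rw [Function.update_of_ne (by simp : (Sum.inl k' : Name M) ≠ _)]
    ring
  rw [h1, integral_const_mul, integral_finsetSum _ fun r' _ =>
    integrable_finsetSum _ fun s' _ => (hint r' s').const_mul _]
  congr 1
  refine Finset.sum_congr rfl fun r' _ => ?_
  rw [integral_finsetSum _ fun s' _ => (hint r' s').const_mul _]
  exact Finset.sum_congr rfl fun s' _ => integral_const_mul _ _

theorem absorbH_absorbH (hΨ : IsSmoothLabelled S Ψ) (hsep : Separated S F F' L z)
    {k k' : Fin M} (hkk' : k ≠ k') (σ : Name M → Fin 4) :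
    absorbH A k (absorbH A k' Ψ) L z σ
      = (Real.sqrt (L.card + 1) : ℂ) * (Real.sqrt ((insert (freshName L) L).card + 1) : ℂ) *
        ∑ r, ∑ s, ∑ r', ∑ s', conj (A.g r (σ (.inl k)) s) * conj (A.g r' (σ (.inl k')) s') *
        doubleAbsorbInt A k k' Ψ L z
            (Function.update (Function.update (Function.update (Function.update σ
              (.inl k) r) (.inl k') r') (.inr (freshName L)) s)
              (.inr (freshName (insert (freshName L) L))) s') := by
  rw [absorbH_eq]
  simp only [absorbInt_absorbH hΨ hsep, Finset.mul_sum]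
  refine Finset.sum_congr rfl fun r _ => Finset.sum_congr rfl fun s _ =>
    Finset.sum_congr rfl fun r' _ => Finset.sum_congr rfl fun s' _ => ?_
  rw [Function.update_of_ne (by simp : (Sum.inl k' : Name M) ≠ _),
    Function.update_of_ne (by simpa using hkk'.symm),
    Function.update_comm (by simp : (Sum.inr (freshName L) : Name M) ≠ .inl k')]
  ring

theorem doubleAbsorbInt_comm (hΨ : IsSmoothLabelled S Ψ) (hsym : SwapSymmetric S Ψ)
    (hsep : Separated S F F' L z) (k k' : Fin M) (σ : Name M → Fin 4) (s s' : Fin 4) :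
    doubleAbsorbInt A k k' Ψ L z (Function.update (Function.update σ (.inr (freshName L)) s)
        (.inr (freshName (insert (freshName L) L))) s')
      = doubleAbsorbInt A k' k Ψ L z (Function.update (Function.update σ (.inr (freshName L)) s')
        (.inr (freshName (insert (freshName L) L))) s) := by
  have hne : (Sum.inr (freshName L) : Name M) ≠ .inr (freshName (insert (freshName L) L)) :=
    fun h => (lt_freshName (Finset.mem_insert_self (freshName L) L)).ne (Sum.inr_injective h)
  unfold doubleAbsorbInt
  rw [integral_integral_swap (integrable_absorb_absorb hΨ hsep (k := k) (k' := k') _ _ _)]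
  refine setIntegral_congr_fun measurableSet_ball fun y' hy' =>
    setIntegral_congr_fun measurableSet_ball fun y hy => ?_
  have hadm : Admissible S L (fun _ : Unit => z) () := by
    simpa using hsep.admissible_left (isDirection_zero F) (E := Unit) (e₀ := ())
      (a := fun _ => 0) rfl
  have hadm2 := Admissible.insert (y := fun _ : Unit => y)
    (hadm.insert (freshName L) k' (y := fun _ : Unit => y')
      (Metric.ball_subset_closedBall hy')) (freshName (insert (freshName L) L)) k
    (by simpa using (Metric.mem_ball.1 hy).le)
  have h := hsym (Finset.mem_insert_of_mem (Finset.mem_insert_self _ _))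
    (Finset.mem_insert_self (freshName (insert (freshName L) L)) (insert (freshName L) L))
    (Function.update (Function.update z (.inr (freshName L)) ((z (.inl k')).1, y'))
      (.inr (freshName (insert (freshName L) L))) ((z (.inl k)).1, y))
    (Function.update (Function.update σ (.inr (freshName L)) s')
      (.inr (freshName (insert (freshName L) L))) s)
    (fun m n hm hn => by simpa using hadm2 m n hm hn)
  rw [update_update_comp_swap _ hne, update_update_comp_swap _ hne] at h
  simp only [h]
  ring

theorem absorbH_comm (hΨ : IsSmoothLabelled S Ψ) (hsym : SwapSymmetric S Ψ)
    (hsep : Separated S F F' L z) {k k' : Fin M} (hkk' : k ≠ k') (σ : Name M → Fin 4) :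
    absorbH A k (absorbH A k' Ψ) L z σ = absorbH A k' (absorbH A k Ψ) L z σ := by
  rw [absorbH_absorbH hΨ hsep hkk', absorbH_absorbH hΨ hsep hkk'.symm]
  congr 1
  have h : ∀ f : Fin 4 → Fin 4 → Fin 4 → Fin 4 → ℂ,
      ∑ r, ∑ s, ∑ r', ∑ s', f r s r' s' = ∑ r', ∑ s', ∑ r, ∑ s, f r s r' s' := by
    intro f
    rw [Finset.sum_congr rfl fun r _ => Finset.sum_comm, Finset.sum_comm]
    refine Finset.sum_congr rfl fun r' _ => ?_
    rw [Finset.sum_congr rfl fun r _ => Finset.sum_comm, Finset.sum_comm]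
  rw [h]
  refine Finset.sum_congr rfl fun r _ => Finset.sum_congr rfl fun s _ =>
    Finset.sum_congr rfl fun r' _ => Finset.sum_congr rfl fun s' _ => ?_
  rw [doubleAbsorbInt_comm hΨ hsym hsep,
    Function.update_comm (by simpa using hkk' : (Sum.inl k : Name M) ≠ .inl k')]
  ring

theorem absorbPart_comm (hΨ : IsSmoothLabelled S Ψ) (hFF' : Disjoint F F')
    (hsym : ∀ k k', .inl k ∈ F → .inl k' ∈ F' → SwapSymmetric S Ψ)
    (hsep : Separated S F F' L z) (hn : .inr (freshName L) ∉ F) (hn' : .inr (freshName L) ∉ F')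
    (σ : Name M → Fin 4) :
    absorbPart A F (absorbPart A F' Ψ) L z σ = absorbPart A F' (absorbPart A F Ψ) L z σ := by
  refine sum_commute (A := A) (F := fun _ => F) (F' := fun _ => F')
    (fun k hk => linearAt_absorbH (Finset.mem_filter.1 hk).2)
    (fun k hk => linearAt_absorbH (Finset.mem_filter.1 hk).2)
    (fun k hk _ _ => regular_absorbH hΨ hFF'.symm hsep.symm hn' (Finset.mem_filter.1 hk).2)
    (fun _ _ k hk => regular_absorbH hΨ hFF' hsep hn (Finset.mem_filter.1 hk).2)
    (fun k hk k' hk' => ?_)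
  have h := (Finset.mem_filter.1 hk).2
  have h' := (Finset.mem_filter.1 hk').2
  refine absorbH_comm hΨ (hsym k k' h h') hsep ?_ σ
  rintro rfl
  exact Finset.disjoint_left.1 hFF' h h'

end

/-! ### Emission terms -/

/-- Coefficients of an emission term: a function of the space-time difference for each emitted
particle and each choice of spin indices. -/
abbrev EmissionCoef := ℕ → Fin 4 → Fin 4 → Fin 4 → Spacetime → ℂ

/-- The emission term of the particle `x_k` with general coefficients. This covers the Green
functions as well as the cut-off function restricted to the `y`-particles of a family. -/
def emitH (γ : EmissionCoef) (k : Fin M) (Ψ : LabelledFun M) : LabelledFun M := fun L z σ =>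
  (1 / Real.sqrt L.card : ℂ) * ∑ l ∈ L, ∑ r' : Fin 4,
    γ l (σ (.inl k)) r' (σ (.inr l)) (z (.inr l) - z (.inl k)) *
      Ψ (L.erase l) z (Function.update σ (.inl k) r')

/-- The summand of the emission term. -/
def emitTerm (γ : EmissionCoef) (k : Fin M) (l : ℕ) (r' : Fin 4) (Ψ : LabelledFun M) :
    LabelledFun M := fun L z σ =>
  γ l (σ (.inl k)) r' (σ (.inr l)) (z (.inr l) - z (.inl k)) *
    Ψ (L.erase l) z (Function.update σ (.inl k) r')

/-- The coefficients of the emission of `y_l` solve the free Dirac equation of the `y`-particle. -/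
def SolvesDirac (A : CutoffModel) (γ : EmissionCoef) (l : ℕ) : Prop :=
  ∀ r r' s (t : ℝ) (y : Space),
    Complex.I * deriv (fun τ : ℝ => γ l r r' s (τ, y)) t
      = diracFree A.my (fun u v => γ l r r' u (t, v)) y s

theorem emitH_eq (γ : EmissionCoef) (k : Fin M) (Ψ : LabelledFun M) (L : Finset ℕ)
    (z : Name M → Spacetime) (σ : Name M → Fin 4) :
    emitH γ k Ψ L z σ = (1 / Real.sqrt L.card : ℂ) * ∑ l ∈ L, ∑ r' : Fin 4,
      emitTerm γ k l r' Ψ L z σ :=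
  rfl

section

variable {A : CutoffModel} {S : Separation M A.δ} {F F' : Finset (Name M)} {L : Finset ℕ}
  {z : Name M → Spacetime} {Ψ : LabelledFun M} {γ γ' : EmissionCoef}

theorem linearAt_emitH (k : Fin M) : LinearAt A F L z (emitH γ k) := by
  intro Θ₁ Θ₂ c σ _ _
  simp only [emitH, Pi.add_apply, Pi.smul_apply, smul_eq_mul, mul_add, Finset.sum_add_distrib,
    Finset.mul_sum]
  congr 1
  exact Finset.sum_congr rfl fun r _ => Finset.sum_congr rfl fun s _ => by ring

theorem IsSmoothLabelled.contDiffAt_emitTerm (hΨ : IsSmoothLabelled S Ψ)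
    (hγ : ∀ l r r' s, ContDiff ℝ ∞ (γ l r r' s)) {E : Type} [NormedAddCommGroup E]
    [NormedSpace ℝ E] {ζ : E → Name M → Spacetime} {e₀ : E} (σ : Name M → Fin 4)
    (hζ : ∀ m, ContDiff ℝ ∞ (fun e => ζ e m)) (h : Admissible S L ζ e₀) (k : Fin M) (l : ℕ)
    (r' : Fin 4) : ContDiffAt ℝ ∞ (fun e => emitTerm γ k l r' Ψ L (ζ e) σ) e₀ :=
  ((hγ _ _ _ _).comp ((hζ _).sub (hζ _))).contDiffAt.mul
    (hΨ.smooth _ hζ (h.mono (Finset.erase_subset l L)))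

theorem continuousOn_emitTerm_insert (hΨ : IsSmoothLabelled S Ψ)
    (hγ : ∀ l r r' s, ContDiff ℝ ∞ (γ l r r' s)) (hsep : Separated S F F' L z) (k k' : Fin M)
    (l : ℕ) (r' : Fin 4) (σ : Name M → Fin 4) :
    ContinuousOn (fun y => emitTerm γ k l r' Ψ (insert (freshName L) L)
      (Function.update z (.inr (freshName L)) ((z (.inl k')).1, y)) σ)
      (Metric.closedBall (z (.inl k')).2 A.δ) := by
  intro y hy
  have hadm : Admissible S L (fun _ : Space => z) y := by
    simpa using hsep.admissible_left (isDirection_zero F) (E := Space) (e₀ := y)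
      (a := fun _ => 0) rfl
  exact (hΨ.contDiffAt_emitTerm hγ (E := Space) (e₀ := y) σ
    (contDiff_update (ζ := fun _ => z) (fun _ => contDiff_const) (freshName L) k' contDiff_id)
    (hadm.insert (freshName L) k' (y := fun y => y) hy) k l r').continuousAt.continuousWithinAt

theorem differentiableAt_emitTerm (hΨ : IsSmoothLabelled S Ψ)
    (hγ : ∀ l r r' s, ContDiff ℝ ∞ (γ l r r' s)) (hsep : Separated S F F' L z)
    {ξ : Name M → Spacetime} (hξ : IsDirection F ξ) (k : Fin M) (l : ℕ) (r' : Fin 4)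
    (σ : Name M → Fin 4) :
    DifferentiableAt ℝ (fun τ : ℝ => emitTerm γ k l r' Ψ L (fun m => z m + τ • ξ m) σ) 0 :=
  (hΨ.contDiffAt_emitTerm hγ (E := ℝ) σ (contDiff_add_smul z ξ contDiff_id)
    (hsep.admissible_left hξ (a := fun τ => τ) rfl) k l r').differentiableAt (by simp)

theorem regular_emitTerm (hΨ : IsSmoothLabelled S Ψ) (hγ : ∀ l r r' s, ContDiff ℝ ∞ (γ l r r' s))
    (hsep : Separated S F F' L z) (k : Fin M) (l : ℕ) (r' : Fin 4) :
    Regular A F L z (emitTerm γ k l r' Ψ) where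
  differentiableAt σ _ hξ := differentiableAt_emitTerm hΨ hγ hsep hξ k l r' σ
  integrableOn σ k' _ := integrableOn_ball_of_continuousOn
    ((continuous_phi_sub A _).continuousOn.mul
      (continuousOn_emitTerm_insert hΨ hγ hsep k k' l r' σ))

theorem regular_emitH (hΨ : IsSmoothLabelled S Ψ) (hγ : ∀ l r r' s, ContDiff ℝ ∞ (γ l r r' s))
    (hsep : Separated S F F' L z) (k : Fin M) : Regular A F L z (emitH γ k Ψ) where
  differentiableAt σ _ hξ :=
    (DifferentiableAt.fun_sum fun l _ => DifferentiableAt.fun_sum fun r' _ =>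
      differentiableAt_emitTerm hΨ hγ hsep hξ k l r' σ).const_mul _
  integrableOn σ k' _ := integrableOn_ball_of_continuousOn
    ((continuous_phi_sub A _).continuousOn.mul (continuousOn_const.mul
      (continuousOn_finsetSum _ fun l _ => continuousOn_finsetSum _ fun r' _ =>
        continuousOn_emitTerm_insert hΨ hγ hsep k k' l r' σ)))

/-! ### Emission and the free part -/

theorem diracFree_const_mul (mass : ℝ) (c : ℂ) (f : Fin 4 → Space → ℂ) (v : Space) (s : Fin 4) :
    diracFree mass (fun u v => c * f u v) v s = c * diracFree mass f v s := by
  have h : ∀ u a, lineDeriv ℝ (fun v => c * f u v) v (EuclideanSpace.single a (1 : ℝ))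
      = c * lineDeriv ℝ (f u) v (EuclideanSpace.single a (1 : ℝ)) := fun u a =>
    deriv_const_mul_field c
  simp only [diracFree, h, mul_add, Finset.mul_sum]
  congr 1
  · exact Finset.sum_congr rfl fun a _ => Finset.sum_congr rfl fun u _ => by ring
  · exact Finset.sum_congr rfl fun u _ => by ring

theorem diracFree_comp_sub (mass : ℝ) (f : Fin 4 → Space → ℂ) (w v : Space) (s : Fin 4) :
    diracFree mass (fun u v => f u (v - w)) v s = diracFree mass f (v - w) s := by
  simp only [diracFree, lineDeriv, add_sub_right_comm]

theorem freeH_emitTerm_of_ne (mass : ℝ) {m : Name M} {k : Fin M} {l : ℕ} (hk : m ≠ .inl k)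
    (hl : m ≠ .inr l) (r' : Fin 4) (σ : Name M → Fin 4) :
    freeH mass m (emitTerm γ k l r' Ψ) L z σ
      = γ l (σ (.inl k)) r' (σ (.inr l)) (z (.inr l) - z (.inl k)) *
        freeH mass m Ψ (L.erase l) z (Function.update σ (.inl k) r') := by
  simp only [freeH, emitTerm, Function.update_of_ne hk.symm, Function.update_of_ne hl.symm,
    diracFree_const_mul, Function.update_of_ne hk, Function.update_comm hk]

theorem freeH_emitTerm_self (hΨ : IsSmoothLabelled S Ψ) (mass : ℝ) (k : Fin M) (l : ℕ)
    (r' : Fin 4) (σ : Name M → Fin 4) :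
    freeH mass (.inr l) (emitTerm γ k l r' Ψ) L z σ
      = diracFree mass (fun u v => γ l (σ (.inl k)) r' u ((z (.inr l) - z (.inl k)).1, v))
          (z (.inr l) - z (.inl k)).2 (σ (.inr l)) *
        Ψ (L.erase l) z (Function.update σ (.inl k) r') := by
  have hne : ∀ m : Name M, Present (L.erase l) m → m ≠ .inr l := by
    rintro m hm rfl
    exact Finset.notMem_erase l L hm
  have hkl : (Sum.inl k : Name M) ≠ .inr l := by simp
  have h1 : ∀ u v, emitTerm γ k l r' Ψ L (Function.update z (.inr l) ((z (.inr l)).1, v))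
      (Function.update σ (.inr l) u) = Ψ (L.erase l) z (Function.update σ (.inl k) r') *
        γ l (σ (.inl k)) r' u ((z (.inr l) - z (.inl k)).1, v - (z (.inl k)).2) := by
    intro u v
    simp only [emitTerm, Function.update_self, Function.update_of_ne hkl]
    rw [mul_comm]
    congr 1
    refine hΨ.congr (fun m hm => Function.update_of_ne (hne m hm) _ _) fun m hm => ?_
    by_cases hmk : m = .inl k
    · subst hmk
      simp
    · simp [Function.update_of_ne hmk, Function.update_of_ne (hne m hm)]
  simp only [freeH, h1, diracFree_const_mul]
  rw [mul_comm]
  congr 1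
  exact diracFree_comp_sub mass
    (fun u v => γ l (σ (.inl k)) r' u ((z (.inr l) - z (.inl k)).1, v)) (z (.inl k)).2
    (z (.inr l)).2 (σ (.inr l))

theorem freePart_congr {Θ Θ' : LabelledFun M} (h : Θ L = Θ' L) :
    freePart A F Θ L = freePart A F Θ' L := by
  unfold freePart timeDeriv freeH
  simp only [h]

/-- The free part of the operator of a family commutes with emission by a particle of another
family. If the emitted particle belongs to the first family, this is the free Dirac equation for the
coefficients. -/
theorem freePart_emitTerm (hΨ : IsSmoothLabelled S Ψ) (hγ : ∀ l r r' s, ContDiff ℝ ∞ (γ l r r' s))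
    (hsep : Separated S F F' L z) {k : Fin M} (hk : .inl k ∉ F) {l : ℕ} (hl : l ∈ L)
    (hD : .inr l ∈ F → SolvesDirac A γ l) (r' : Fin 4) (σ : Name M → Fin 4) :
    freePart A F (emitTerm γ k l r' Ψ) L z σ
      = γ l (σ (.inl k)) r' (σ (.inr l)) (z (.inr l) - z (.inl k)) *
        freePart A F Ψ (L.erase l) z (Function.update σ (.inl k) r') := by
  set c := γ l (σ (.inl k)) r' (σ (.inr l)) (z (.inr l) - z (.inl k)) with hc
  have hξk : timeDir F (.inl k) = 0 := (isDirection_timeDir F).2 _ hk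
  have hT : timeDeriv F (emitTerm γ k l r' Ψ) L z σ
      = deriv (fun τ : ℝ => γ l (σ (.inl k)) r' (σ (.inr l))
          (z (.inr l) - z (.inl k) + τ • timeDir F (.inr l))) 0 *
        Ψ (L.erase l) z (Function.update σ (.inl k) r')
        + c * timeDeriv F Ψ (L.erase l) z (Function.update σ (.inl k) r') := by
    rw [timeDeriv_eq_derivAlong, timeDeriv_eq_derivAlong]
    have d1 : DifferentiableAt ℝ (fun τ : ℝ => γ l (σ (.inl k)) r' (σ (.inr l))
          (z (.inr l) - z (.inl k) + τ • timeDir F (.inr l))) 0 :=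
      (((hγ _ _ _ _).comp (contDiff_const.add (contDiff_id.smul contDiff_const))).differentiable
        (n := ∞) (by simp)) 0
    have d2 : DifferentiableAt ℝ (fun τ : ℝ => Ψ (L.erase l) (fun m => z m + τ • timeDir F m)
        (Function.update σ (.inl k) r')) 0 :=
      (hΨ.smooth (E := ℝ) _ (contDiff_add_smul z _ contDiff_id)
        ((hsep.admissible_left (isDirection_timeDir F) (a := fun τ => τ) rfl).mono
          (Finset.erase_subset l L))).differentiableAt (by simp)
    have h := (d1.hasDerivAt.mul d2.hasDerivAt).deriv
    simp only [zero_smul, add_zero] at h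
    rw [hc, derivAlong, derivAlong, ← h]
    congr 1
    funext τ
    simp only [emitTerm, hξk, smul_zero, add_zero, Pi.mul_apply]
    rw [add_sub_right_comm]
  have hfree : ∀ m ∈ F, m ≠ .inr l →
      (if Present L m then freeH (A.mass m) m (emitTerm γ k l r' Ψ) L z σ else 0)
      = c * if Present (L.erase l) m then
          freeH (A.mass m) m Ψ (L.erase l) z (Function.update σ (.inl k) r') else 0 := by
    intro m hm hml
    simp only [present_erase_iff hml]
    split_ifs
    · exact freeH_emitTerm_of_ne _ (fun h => hk (h ▸ hm)) hml r' σ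
    · rw [mul_zero]
  unfold freePart
  rw [hT, mul_sub, Finset.mul_sum]
  by_cases hlF : .inr l ∈ F
  · have hξl : timeDir F (.inr l) = (1, 0) := by simp [timeDir, hlF]
    have hDl := hD hlF (σ (.inl k)) r' (σ (.inr l)) (z (.inr l) - z (.inl k)).1
      (z (.inr l) - z (.inl k)).2
    have hshift : deriv (fun τ : ℝ => γ l (σ (.inl k)) r' (σ (.inr l))
          (z (.inr l) - z (.inl k) + τ • timeDir F (.inr l))) 0
        = deriv (fun τ : ℝ => γ l (σ (.inl k)) r' (σ (.inr l))
          (τ, (z (.inr l) - z (.inl k)).2)) (z (.inr l) - z (.inl k)).1 := by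
      have h1 : ∀ τ : ℝ, z (.inr l) - z (.inl k) + τ • timeDir F (.inr l)
          = ((z (.inr l) - z (.inl k)).1 + τ, (z (.inr l) - z (.inl k)).2) := by
        intro τ
        rw [hξl]
        refine Prod.ext ?_ ?_ <;> simp
      simp only [h1]
      have h2 := deriv_comp_const_add (fun τ : ℝ => γ l (σ (.inl k)) r' (σ (.inr l))
          (τ, (z (.inr l) - z (.inl k)).2)) (z (.inr l) - z (.inl k)).1 0
      rw [add_zero] at h2
      exact h2
    rw [← Finset.add_sum_erase _ _ hlF, ← Finset.add_sum_erase _ _ hlF,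
      Finset.sum_congr rfl fun m hm =>
        hfree m (Finset.mem_of_mem_erase hm) (Finset.ne_of_mem_erase hm),
      if_pos (show Present L (.inr l) from hl),
      if_neg (show ¬ Present (L.erase l) (.inr l) from Finset.notMem_erase l L),
      freeH_emitTerm_self hΨ, hshift, CutoffModel.mass, ← hDl]
    ring
  · have hξl : timeDir F (.inr l) = 0 := (isDirection_timeDir F).2 _ hlF
    rw [Finset.sum_congr rfl fun m hm => hfree m hm fun h => hlF (h ▸ hm)]
    simp only [hξl, smul_zero, add_zero, deriv_const]
    ring

theorem freePart_emitH_comm (hΨ : IsSmoothLabelled S Ψ)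
    (hγ : ∀ l r r' s, ContDiff ℝ ∞ (γ l r r' s))
    (hsep : Separated S F F' L z) {k : Fin M} (hk : .inl k ∉ F)
    (hD : ∀ l, .inr l ∈ F → SolvesDirac A γ l) (σ : Name M → Fin 4) :
    freePart A F (emitH γ k Ψ) L z σ = emitH γ k (freePart A F Ψ) L z σ := by
  have h1 : emitH γ k Ψ L
      = ((1 / Real.sqrt L.card : ℂ) • ∑ l ∈ L, ∑ r', emitTerm γ k l r' Ψ) L := by
    funext z σ
    simp only [emitH_eq, Pi.smul_apply, Finset.sum_apply, smul_eq_mul]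
  have hreg : ∀ l r', Regular A F L z (emitTerm γ k l r' Ψ) :=
    regular_emitTerm hΨ hγ hsep k
  have hlin := linearAt_freePart A F L z
  rw [freePart_congr h1, hlin.map_smul (Regular.sum fun l _ => Regular.sum fun r' _ => hreg l r'),
    hlin.map_sum fun l _ => Regular.sum fun r' _ => hreg l r']
  unfold emitH
  congr 1
  refine Finset.sum_congr rfl fun l hl => ?_
  rw [hlin.map_sum fun r' _ => hreg l r']
  exact Finset.sum_congr rfl fun r' _ =>
    freePart_emitTerm hΨ hγ hsep hk hl (hD l) r' σ

/-! ### Emission and absorption, and two emissions -/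

theorem absorbH_emitH_comm (hΨ : IsSmoothLabelled S Ψ)
    (hγ : ∀ l r r' s, ContDiff ℝ ∞ (γ l r r' s)) (hsep : Separated S F F' L z) {k k' : Fin M}
    (hkk' : k ≠ k')
    (hγ0 : ∀ r r' s, ∀ y ∈ Metric.ball (z (.inl k)).2 A.δ,
      γ (freshName L) r r' s (((z (.inl k)).1, y) - z (.inl k')) = 0)
    (σ : Name M → Fin 4) :
    absorbH A k (emitH γ k' Ψ) L z σ = emitH γ k' (absorbH A k Ψ) L z σ := by
  have hk'k : (Sum.inl k' : Name M) ≠ .inl k := by simpa using hkk'.symm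
  have hk'n : (Sum.inl k' : Name M) ≠ .inr (freshName L) := by simp
  have hln : ∀ l ∈ L, (Sum.inr l : Name M) ≠ .inr (freshName L) := fun l hl h =>
    (lt_freshName hl).ne (Sum.inr_injective h)
  have hcard : ((insert (freshName L) L).card : ℝ) = L.card + 1 := by
    rw [Finset.card_insert_of_notMem (freshName_notMem L)]
    push_cast
    rfl
  -- The emission of the particle absorbed by `x_k` does not contribute, so only particles of `L` are
  -- emitted. When `y_l` is removed first, the absorbed particle may get another name, still the last.
  have h1 : ∀ r s, absorbInt A k (emitH γ k' Ψ) L z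
        (Function.update (Function.update σ (.inl k) r) (.inr (freshName L)) s)
      = (1 / Real.sqrt (L.card + 1) : ℂ) * ∑ l ∈ L, ∑ r',
        γ l (σ (.inl k')) r' (σ (.inr l)) (z (.inr l) - z (.inl k')) *
        absorbInt A k Ψ (L.erase l) z (Function.update (Function.update (Function.update σ
          (.inl k') r') (.inl k) r) (.inr (freshName (L.erase l))) s) := by
    intro r s
    set τ := Function.update (Function.update σ (.inl k) r) (.inr (freshName L)) s with hτ
    let J : ℕ → Fin 4 → Space → ℂ := fun l r' y => (A.φ (y - (z (.inl k)).2) : ℂ) *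
      emitTerm γ k' l r' Ψ (insert (freshName L) L)
        (Function.update z (.inr (freshName L)) ((z (.inl k)).1, y)) τ
    have hint : ∀ l r', IntegrableOn (J l r') (Metric.ball (z (.inl k)).2 A.δ) := fun l r' =>
      integrableOn_ball_of_continuousOn ((continuous_phi_sub A _).continuousOn.mul
        (continuousOn_emitTerm_insert hΨ hγ hsep k' k l r' τ))
    have e1 : absorbInt A k (emitH γ k' Ψ) L z τ
        = ∫ y in Metric.ball (z (.inl k)).2 A.δ, (1 / Real.sqrt (L.card + 1) : ℂ) *
          ∑ l ∈ L, ∑ r', J l r' y := by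
      refine setIntegral_congr_fun measurableSet_ball fun y hy => ?_
      -- the term in which the absorbed particle is emitted vanishes by `hγ0`
      simp only [emitH_eq, Finset.sum_insert (freshName_notMem L), J, ← Finset.mul_sum]
      have e2 : ∀ r', emitTerm γ k' (freshName L) r' Ψ (insert (freshName L) L)
          (Function.update z (.inr (freshName L)) ((z (.inl k)).1, y)) τ = 0 := by
        intro r'
        simp only [emitTerm, Function.update_self, Function.update_of_ne hk'n, hγ0 _ _ _ y hy,
          zero_mul]
      simp only [e2, Finset.sum_const_zero, zero_add, hcard]
      ring
    rw [e1, integral_const_mul, integral_finsetSum _ fun l _ =>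
      integrable_finsetSum _ fun r' _ => hint l r']
    congr 1
    refine Finset.sum_congr rfl fun l hl => ?_
    rw [integral_finsetSum _ fun r' _ => hint l r']
    refine Finset.sum_congr rfl fun r' _ => ?_
    rw [absorbInt, ← integral_const_mul]
    refine integral_congr_ae (Eventually.of_forall fun y => ?_)
    have e3 : (insert (freshName L) L).erase l = insert (freshName L) (L.erase l) :=
      Finset.erase_insert_of_ne (lt_freshName hl).ne'
    have e4 := hΨ.insert_congr (L := L.erase l) (a := freshName L) (b := freshName (L.erase l))
      (fun i hi => lt_freshName (Finset.mem_of_mem_erase hi)) (fun i hi => lt_freshName hi) z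
      (Function.update (Function.update σ (.inl k') r') (.inl k) r) ((z (.inl k)).1, y) s
    simp only [J, emitTerm, Function.update_of_ne hk'n, Function.update_of_ne (hln l hl), e3, hτ,
      Function.update_of_ne hk'k]
    rw [Function.update_of_ne (by simp : (Sum.inr l : Name M) ≠ .inl k), ← e4,
      Function.update_comm hk'n.symm, Function.update_comm hk'k.symm]
    ring
  rw [absorbH_eq]
  simp only [h1]
  unfold emitH
  simp only [absorbH_eq, Function.update_of_ne hk'k.symm]
  simp only [Finset.mul_sum]
  rw [Finset.sum_congr rfl fun r _ => Finset.sum_comm, Finset.sum_comm]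
  refine Finset.sum_congr rfl fun l hl => ?_
  rw [Finset.sum_congr rfl fun r _ => Finset.sum_comm, Finset.sum_comm]
  refine Finset.sum_congr rfl fun r' _ => Finset.sum_congr rfl fun r _ =>
    Finset.sum_congr rfl fun s _ => ?_
  have hpos : 0 < L.card := Finset.card_pos.2 ⟨l, hl⟩
  have hc : ((L.erase l).card : ℝ) + 1 = L.card := by
    have := Finset.card_erase_add_one hl
    exact_mod_cast this
  have s1 : (Real.sqrt L.card : ℂ) ≠ 0 := by
    rw [Complex.ofReal_ne_zero]
    exact (Real.sqrt_pos.2 (by exact_mod_cast hpos)).ne'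
  have s2 : (Real.sqrt (L.card + 1) : ℂ) ≠ 0 := by
    rw [Complex.ofReal_ne_zero]
    exact (Real.sqrt_pos.2 (by positivity)).ne'
  rw [hc]
  field_simp

theorem emitH_comm {k k' : Fin M} (hkk' : k ≠ k') (σ : Name M → Fin 4) :
    emitH γ k (emitH γ' k' Ψ) L z σ = emitH γ' k' (emitH γ k Ψ) L z σ := by
  have hkk : (Sum.inl k : Name M) ≠ .inl k' := by simpa using hkk'
  have h : ∀ (γ γ' : EmissionCoef) {k k' : Fin M}, (Sum.inl k : Name M) ≠ .inl k' →
      emitH γ k (emitH γ' k' Ψ) L z σ = ∑ l ∈ L, ∑ l' ∈ L.erase l, ∑ r, ∑ r',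
        (1 / Real.sqrt L.card : ℂ) * (1 / Real.sqrt (L.card - 1 : ℕ) : ℂ) *
        (γ l (σ (.inl k)) r (σ (.inr l)) (z (.inr l) - z (.inl k)) *
        γ' l' (σ (.inl k')) r' (σ (.inr l')) (z (.inr l') - z (.inl k'))) *
        Ψ ((L.erase l).erase l') z (Function.update (Function.update σ (.inl k) r)
          (.inl k') r') := by
    intro γ γ' k k' hkk
    unfold emitH
    simp only [Finset.mul_sum]
    refine Finset.sum_congr rfl fun l hl => ?_
    rw [Finset.sum_comm]
    refine Finset.sum_congr rfl fun l' hl' => Finset.sum_congr rfl fun r _ =>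
      Finset.sum_congr rfl fun r' _ => ?_
    rw [Function.update_of_ne hkk.symm,
      Function.update_of_ne (by simp : (Sum.inr l' : Name M) ≠ .inl k),
      Finset.card_erase_of_mem hl]
    ring
  rw [h γ γ' hkk, h γ' γ hkk.symm]
  rw [Finset.sum_comm' (t' := L) (s' := fun l' => L.erase l') (fun l l' => by
    simp only [Finset.mem_erase]
    tauto)]
  refine Finset.sum_congr rfl fun l' _ => Finset.sum_congr rfl fun l _ => ?_
  rw [Finset.sum_comm]
  refine Finset.sum_congr rfl fun r' _ => Finset.sum_congr rfl fun r _ => ?_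
  rw [Finset.erase_right_comm, Function.update_comm hkk]
  ring

end

/-! ### The commutator of the operators of two families -/

/-- The emission operators of the particles of a family. -/
def emitPart (γ : EmissionCoef) (F : Finset (Name M)) (Ψ : LabelledFun M) : LabelledFun M :=
  ∑ k : Fin M with .inl k ∈ F, emitH γ k Ψ

/-- The operator `i ∂_t - H` of a family, with general emission coefficients. -/
def familyOp (A : CutoffModel) (γ : EmissionCoef) (F : Finset (Name M)) (Ψ : LabelledFun M) :
    LabelledFun M :=
  freePart A F Ψ - absorbPart A F Ψ - emitPart γ F Ψ

section

variable {A : CutoffModel} {S : Separation M A.δ} {F F' : Finset (Name M)} {L : Finset ℕ}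
  {z : Name M → Spacetime} {Ψ : LabelledFun M} {γ γ' : EmissionCoef}

theorem linearAt_emitPart : LinearAt A F L z (emitPart γ F) :=
  LinearAt.sum fun k _ => linearAt_emitH k

theorem regular_emitPart (hΨ : IsSmoothLabelled S Ψ) (hγ : ∀ l r r' s, ContDiff ℝ ∞ (γ l r r' s))
    (hsep : Separated S F F' L z) : Regular A F L z (emitPart γ F' Ψ) :=
  Regular.sum fun k _ => regular_emitH hΨ hγ hsep k

theorem freePart_emitPart_comm (hΨ : IsSmoothLabelled S Ψ) (hFF' : Disjoint F F')
    (hγ : ∀ l r r' s, ContDiff ℝ ∞ (γ l r r' s)) (hsep : Separated S F F' L z)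
    (hD : ∀ l, .inr l ∈ F → SolvesDirac A γ l) (σ : Name M → Fin 4) :
    freePart A F (emitPart γ F' Ψ) L z σ = emitPart γ F' (freePart A F Ψ) L z σ := by
  unfold emitPart
  rw [(linearAt_freePart A F L z).map_sum fun k _ => regular_emitH hΨ hγ hsep k]
  simp only [Finset.sum_apply]
  exact Finset.sum_congr rfl fun k hk => freePart_emitH_comm hΨ hγ hsep
    (Finset.disjoint_right.1 hFF' (Finset.mem_filter.1 hk).2) hD σ

theorem ne_of_mem_disjoint (hFF' : Disjoint F F') {k k' : Fin M} (hk : .inl k ∈ F)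
    (hk' : .inl k' ∈ F') : k ≠ k' := by
  rintro rfl
  exact Finset.disjoint_left.1 hFF' hk hk'

theorem absorbPart_emitPart_comm (hΨ : IsSmoothLabelled S Ψ) (hFF' : Disjoint F F')
    (hγ : ∀ l r r' s, ContDiff ℝ ∞ (γ l r r' s)) (hsep : Separated S F F' L z)
    (hn' : .inr (freshName L) ∉ F')
    (hγ0 : ∀ k k', .inl k ∈ F → .inl k' ∈ F' → ∀ r r' s, ∀ y ∈ Metric.ball (z (.inl k)).2 A.δ,
      γ (freshName L) r r' s (((z (.inl k)).1, y) - z (.inl k')) = 0)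
    (σ : Name M → Fin 4) :
    absorbPart A F (emitPart γ F' Ψ) L z σ = emitPart γ F' (absorbPart A F Ψ) L z σ :=
  sum_commute (A := A) (F := fun _ => F) (F' := fun _ => F')
    (fun _ hk => linearAt_absorbH (Finset.mem_filter.1 hk).2) (fun k _ => linearAt_emitH k)
    (fun _ hk _ _ =>
      regular_absorbH hΨ hFF'.symm hsep.symm hn' (Finset.mem_filter.1 hk).2)
    (fun _ _ k _ => regular_emitH hΨ hγ hsep k)
    (fun k hk k' hk' => absorbH_emitH_comm hΨ hγ hsep
      (ne_of_mem_disjoint hFF' (Finset.mem_filter.1 hk).2 (Finset.mem_filter.1 hk').2)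
      (hγ0 k k' (Finset.mem_filter.1 hk).2 (Finset.mem_filter.1 hk').2) σ)

theorem emitPart_comm (hΨ : IsSmoothLabelled S Ψ) (hFF' : Disjoint F F')
    (hγ : ∀ l r r' s, ContDiff ℝ ∞ (γ l r r' s)) (hγ' : ∀ l r r' s, ContDiff ℝ ∞ (γ' l r r' s))
    (hsep : Separated S F F' L z) (σ : Name M → Fin 4) :
    emitPart γ F (emitPart γ' F' Ψ) L z σ = emitPart γ' F' (emitPart γ F Ψ) L z σ :=
  sum_commute (A := A) (F := fun _ => F) (F' := fun _ => F')
    (fun k _ => linearAt_emitH k) (fun k _ => linearAt_emitH k)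
    (fun k _ _ _ => regular_emitH hΨ hγ hsep.symm k) (fun _ _ k _ => regular_emitH hΨ hγ' hsep k)
    (fun _ hk _ hk' => emitH_comm
      (ne_of_mem_disjoint hFF' (Finset.mem_filter.1 hk).2 (Finset.mem_filter.1 hk').2) σ)

theorem linearAt_familyOp : LinearAt A F L z (familyOp A γ F) :=
  ((linearAt_freePart A F L z).sub linearAt_absorbPart).sub linearAt_emitPart

theorem regular_familyOp (hΨ : IsSmoothLabelled S Ψ) (hFF' : Disjoint F F')
    (hsep : Separated S F F' L z) (hn : .inr (freshName L) ∉ F) (hn' : .inr (freshName L) ∉ F')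
    (hγ : ∀ l r r' s, ContDiff ℝ ∞ (γ l r r' s)) : Regular A F L z (familyOp A γ F' Ψ) :=
  ((regular_freePart hΨ hFF' hsep hn').sub (regular_absorbPart hΨ hFF' hsep hn)).sub
    (regular_emitPart hΨ hγ hsep)

/-- The operators of two disjoint families commute. The conditions on the emission coefficients are
the free Dirac equation for the emission of particles of the other family, and that a particle just
absorbed by one family cannot have been emitted by the other. -/
theorem familyOp_comm (hΨ : IsSmoothLabelled S Ψ)
    (hsym : ∀ k k', .inl k ∈ F → .inl k' ∈ F' → SwapSymmetric S Ψ) (hFF' : Disjoint F F')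
    (hsep : Separated S F F' L z) (hn : .inr (freshName L) ∉ F) (hn' : .inr (freshName L) ∉ F')
    (hγ : ∀ l r r' s, ContDiff ℝ ∞ (γ l r r' s)) (hγ' : ∀ l r r' s, ContDiff ℝ ∞ (γ' l r r' s))
    (hD : ∀ l, .inr l ∈ F' → SolvesDirac A γ l) (hD' : ∀ l, .inr l ∈ F → SolvesDirac A γ' l)
    (hγ0 : ∀ k k', .inl k ∈ F' → .inl k' ∈ F → ∀ r r' s, ∀ y ∈ Metric.ball (z (.inl k)).2 A.δ,
      γ (freshName L) r r' s (((z (.inl k)).1, y) - z (.inl k')) = 0)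
    (hγ0' : ∀ k k', .inl k ∈ F → .inl k' ∈ F' → ∀ r r' s, ∀ y ∈ Metric.ball (z (.inl k)).2 A.δ,
      γ' (freshName L) r r' s (((z (.inl k)).1, y) - z (.inl k')) = 0)
    (σ : Name M → Fin 4) :
    familyOp A γ F (familyOp A γ' F' Ψ) L z σ = familyOp A γ' F' (familyOp A γ F Ψ) L z σ := by
  have expand : ∀ {F F' : Finset (Name M)} {γ γ' : EmissionCoef}, Disjoint F F' →
      Separated S F F' L z → .inr (freshName L) ∉ F → .inr (freshName L) ∉ F' →
      (∀ l r r' s, ContDiff ℝ ∞ (γ' l r r' s)) →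
      familyOp A γ F (familyOp A γ' F' Ψ) L z σ
        = familyOp A γ F (freePart A F' Ψ) L z σ - familyOp A γ F (absorbPart A F' Ψ) L z σ
          - familyOp A γ F (emitPart γ' F' Ψ) L z σ := by
    intro F F' γ γ' hFF' hsep hn hn' hγ'
    have h1 := regular_freePart hΨ hFF' hsep hn'
    have h2 := regular_absorbPart hΨ hFF' hsep hn
    have h3 := regular_emitPart hΨ hγ' hsep
    conv_lhs => rw [familyOp.eq_1 A γ' F' Ψ]
    rw [linearAt_familyOp.map_sub (h1.sub h2) h3, linearAt_familyOp.map_sub h1 h2]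
  rw [expand hFF' hsep hn hn' hγ', expand hFF'.symm hsep.symm hn' hn hγ]
  have zz := freePart_comm hΨ hFF' hsep hn hn' σ
  have za := freePart_absorbPart_comm hΨ hFF' hsep hn σ
  have az := freePart_absorbPart_comm hΨ hFF'.symm hsep.symm hn' σ
  have ze := freePart_emitPart_comm hΨ hFF' hγ' hsep hD' σ
  have ez := freePart_emitPart_comm hΨ hFF'.symm hγ hsep.symm hD σ
  have aa := absorbPart_comm hΨ hFF' hsym hsep hn hn' σ
  have ae := absorbPart_emitPart_comm hΨ hFF' hγ' hsep hn' hγ0' σ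
  have ea := absorbPart_emitPart_comm hΨ hFF'.symm hγ hsep.symm hn hγ0 σ
  have ee := emitPart_comm hΨ hFF' hγ hγ' hsep σ
  simp only [familyOp, Pi.sub_apply]
  linear_combination zz - za - ze + az + ez + aa + ae - ea + ee

end

/-! ### The operators of the multi-time equations -/

theorem sum_family_eq (F : Finset (Name M)) (L : Finset ℕ) (f : Name M → ℂ)
    (hf : ∀ l, l ∉ L → f (.inr l) = 0) :
    ∑ m ∈ F, f m =
      ∑ k : Fin M with .inl k ∈ F, f (.inl k) + ∑ l ∈ L with .inr l ∈ F, f (.inr l) := by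
  rw [← Finset.toLeft_disjSum_toRight (u := F), Finset.sum_disjSum]
  simp only [Finset.toLeft_disjSum_toRight]
  congr 1
  · refine Finset.sum_congr ?_ fun _ _ => rfl
    ext k
    simp
  · symm
    refine Finset.sum_subset (fun l hl => ?_) fun l hl hl' => hf l fun h => hl' ?_
    · exact Finset.mem_toRight.2 (Finset.mem_filter.1 hl).2
    · exact Finset.mem_filter.2 ⟨h, Finset.mem_toRight.1 hl⟩

/-- The emission coefficients of the operators in terms of the cut-off function. -/
def familyCoef (A : CutoffModel) (F : Finset (Name M)) : EmissionCoef := fun l r r' s p =>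
  if .inr l ∈ F then A.g r r' s * (A.φ p.2 : ℂ) else 0

theorem emitFamilyH_eq (A : CutoffModel) (F : Finset (Name M)) (k : Fin M) :
    emitFamilyH A F k = emitH (familyCoef A F) k := by
  funext Ψ L z σ
  simp only [emitFamilyH, emitH, familyCoef, Finset.sum_filter]
  congr 1
  refine Finset.sum_congr rfl fun l _ => ?_
  split_ifs <;> simp

theorem freePart_apply (A : CutoffModel) (F : Finset (Name M)) (Ψ : LabelledFun M)
    (L : Finset ℕ) (z : Name M → Spacetime) (σ : Name M → Fin 4) :
    freePart A F Ψ L z σ = Complex.I * timeDeriv F Ψ L z σ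
      - (∑ k : Fin M with .inl k ∈ F, freeH A.mx (.inl k) Ψ L z σ
        + ∑ l ∈ L with .inr l ∈ F, freeH A.my (.inr l) Ψ L z σ) := by
  rw [freePart, sum_family_eq F L _ fun l hl => if_neg hl]
  congr 2
  exact Finset.sum_congr rfl fun l hl => if_pos (Finset.mem_filter.1 hl).1

theorem familyK_eq (A : CutoffModel) (F : Finset (Name M)) :
    familyK A F = familyOp A (familyCoef A F) F := by
  funext Ψ L z σ
  simp only [familyK, familyH, familyOp, Pi.sub_apply, freePart_apply, absorbPart, emitPart,
    emitFamilyH_eq, Finset.sum_apply, Finset.sum_add_distrib]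
  ring

theorem familyGreenK_eq (A : CutoffModel) (G : Fin 4 → Fin 4 → Fin 4 → Spacetime → ℂ)
    (F : Finset (Name M)) : familyGreenK A G F = familyOp A (fun _ => G) F := by
  funext Ψ L z σ
  have h : ∀ k, emitGreenH G k Ψ L z σ = emitH (fun _ => G) k Ψ L z σ := fun _ => rfl
  rw [familyGreenK, sum_family_eq F L _ fun l hl => if_neg hl]
  simp only [particleH, familyOp, Pi.sub_apply, freePart_apply, absorbPart, emitPart,
    Finset.sum_apply, Finset.sum_add_distrib, h]
  rw [Finset.sum_congr rfl fun l hl => if_pos (Finset.mem_filter.1 hl).1]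
  ring

theorem particleK_eq (A : CutoffModel) (G : Fin 4 → Fin 4 → Fin 4 → Spacetime → ℂ)
    (m : Name M) : particleK A G m = familyOp A (fun _ => G) {m} := by
  rw [← familyGreenK_eq]
  funext Ψ L z σ
  simp only [particleK, familyGreenK, Finset.sum_singleton]

theorem sumParticleK_eq (A : CutoffModel) (G : Fin 4 → Fin 4 → Fin 4 → Spacetime → ℂ)
    (F : Finset (Name M)) (Ψ : LabelledFun M) :
    sumParticleK A G F Ψ = ∑ m ∈ F, familyOp A (fun _ => G) {m} Ψ := by
  funext L z σ
  simp only [sumParticleK, particleK_eq, Finset.sum_apply]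

theorem contDiff_familyCoef (A : CutoffModel) (F : Finset (Name M)) (l : ℕ) (r r' s : Fin 4) :
    ContDiff ℝ ∞ (familyCoef A F l r r' s) := by
  unfold familyCoef
  split_ifs
  · exact contDiff_const.mul
      (Complex.ofRealCLM.contDiff.comp (A.φ_smooth.comp contDiff_snd))
  · exact contDiff_const

theorem solvesDirac_familyCoef (A : CutoffModel) {F : Finset (Name M)} {l : ℕ}
    (hl : .inr l ∉ F) : SolvesDirac A (familyCoef A F) l := by
  intro r r' s t y
  simp [familyCoef, hl, diracFree, lineDeriv]

/-- The Green functions vanish at a point within distance `δ` of one `x`-particle, seen from another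
`x`-particle at the safety distance. -/
theorem IsCutoffGreen.eq_zero_near {A : CutoffModel} {G : Fin 4 → Fin 4 → Fin 4 → Spacetime → ℂ}
    (hG : IsCutoffGreen A G) {p p' : Spacetime}
    (h : ‖p.2 - p'.2‖ > |p.1 - p'.1| + 2 * A.δ) {y : Space} (hy : y ∈ Metric.ball p.2 A.δ)
    (r r' s : Fin 4) : G r r' s ((p.1, y) - p') = 0 := by
  refine dirac_eq_zero_of_spacelike (m := A.my) (δ := A.δ) (hG.smooth r r') (hG.dirac r r')
    (fun s v hv => ?_) (t := p.1 - p'.1) (y := y - p'.2) ?_ s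
  · have h0 : A.φ v = 0 := by
      refine image_eq_zero_of_notMem_tsupport fun hv' => ?_
      have := A.φ_supp hv'
      rw [mem_closedBall_zero_iff] at this
      linarith
    rw [hG.initial, h0, Complex.ofReal_zero, mul_zero]
  · rw [mem_ball_iff_norm, norm_sub_rev] at hy
    linarith [norm_sub_le_norm_sub_add_norm_sub p.2 y p'.2]

theorem IsCutoffGreen.familyOp_comm {A : CutoffModel}
    {G : Fin 4 → Fin 4 → Fin 4 → Spacetime → ℂ} (hG : IsCutoffGreen A G) {S : Separation M A.δ}
    {F F' : Finset (Name M)} {L : Finset ℕ} {z : Name M → Spacetime} {Ψ : LabelledFun M}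
    (hΨ : IsSmoothLabelled S Ψ)
    (hsym : ∀ k k', .inl k ∈ F → .inl k' ∈ F' → SwapSymmetric S Ψ) (hFF' : Disjoint F F')
    (hsep : Separated S F F' L z) (hn : .inr (freshName L) ∉ F) (hn' : .inr (freshName L) ∉ F')
    (hsafe : ∀ k k', .inl k ∈ F → .inl k' ∈ F' →
      ‖(z (.inl k)).2 - (z (.inl k')).2‖ > |(z (.inl k)).1 - (z (.inl k')).1| + 2 * A.δ)
    (σ : Name M → Fin 4) :
    familyOp A (fun _ => G) F (familyOp A (fun _ => G) F' Ψ) L z σ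
      = familyOp A (fun _ => G) F' (familyOp A (fun _ => G) F Ψ) L z σ := by
  refine MultiTime.familyOp_comm hΨ hsym hFF' hsep hn hn' (fun _ => hG.smooth)
    (fun _ => hG.smooth) (fun _ _ => hG.dirac) (fun _ _ => hG.dirac) ?_ ?_ σ
  · intro k k' hk hk' r r' s y hy
    refine hG.eq_zero_near ?_ hy r r' s
    rw [norm_sub_rev, abs_sub_comm]
    exact hsafe k' k hk' hk
  · intro k k' hk hk' r r' s y hy
    exact hG.eq_zero_near (hsafe k k' hk hk') hy r r' s

/-! ### Families of a partition -/

section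

variable {N : ℕ}

theorem nameData_apply {X : Type} [Inhabited X] (q : Fin M ⊕ Fin N → X) (m : Fin M ⊕ Fin N) :
    nameData q (Sum.map id Fin.val m) = q m := by
  rcases m with k | l
  · rfl
  · simp [nameData]

theorem sumMap_val_injective :
    Function.Injective (Sum.map id Fin.val : Fin M ⊕ Fin N → Name M) :=
  Sum.map_injective.2 ⟨Function.injective_id, Fin.val_injective⟩

theorem mem_names {F : Finset (Fin M ⊕ Fin N)} {m : Fin M ⊕ Fin N} :
    Sum.map id Fin.val m ∈ names F ↔ m ∈ F :=
  sumMap_val_injective.mem_finset_image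

theorem exists_of_present_range {m : Name M} (hm : Present (Finset.range N) m) :
    ∃ m₀ : Fin M ⊕ Fin N, Sum.map id Fin.val m₀ = m := by
  rcases m with k | l
  · exact ⟨.inl k, rfl⟩
  · exact ⟨.inr ⟨l, Finset.mem_range.1 hm⟩, rfl⟩

theorem freshName_notMem_names (F : Finset (Fin M ⊕ Fin N)) :
    .inr (freshName (Finset.range N)) ∉ names F := by
  intro h
  obtain ⟨m, _, hm⟩ := Finset.mem_image.1 h
  rcases m with k | l
  · simp at hm
  · refine freshName_notMem (Finset.range N) ?_
    rw [← Sum.inr_injective hm]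
    exact Finset.mem_range.2 l.2

theorem disjoint_names {P : LabelPartition M N} {F F' : Finset (Fin M ⊕ Fin N)}
    (hF : F ∈ P.parts) (hF' : F' ∈ P.parts) (hne : F ≠ F') : Disjoint (names F) (names F') :=
  (Finset.disjoint_image sumMap_val_injective).2 (P.disjoint hF hF' hne)

theorem separated_of_partition {δ : ℝ} {S : Separation M δ} {P : LabelPartition M N}
    {F F' : Finset (Fin M ⊕ Fin N)} (hF : F ∈ P.parts) (hF' : F' ∈ P.parts) {q : Config M N}
    (htime : ∀ E ∈ P.parts, ∀ m ∈ E, ∀ n ∈ E, (q m).1 = (q n).1)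
    (hrel : ∀ E ∈ P.parts, ∀ E' ∈ P.parts, E ≠ E' → ∀ m ∈ E, ∀ n ∈ E',
      S.rel (Sum.map id Fin.val m) (Sum.map id Fin.val n) (q m) (q n)) :
    Separated S (names F) (names F') (Finset.range N) (nameData q) := by
  intro m n hm hn
  obtain ⟨m, rfl⟩ := exists_of_present_range hm
  obtain ⟨n, rfl⟩ := exists_of_present_range hn
  simp only [nameData_apply, mem_names]
  have hmp := P.mem_part (Finset.mem_univ m)
  have hnp := P.mem_part (Finset.mem_univ n)
  have hmP := P.part_mem.2 (Finset.mem_univ m)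
  have hnP := P.part_mem.2 (Finset.mem_univ n)
  by_cases h : P.part m = P.part n
  · right
    have hiff : ∀ E ∈ P.parts, (m ∈ E ↔ n ∈ E) := by
      intro E hE
      rw [← P.part_eq_iff_mem hE, ← P.part_eq_iff_mem hE, h]
    exact ⟨htime _ hmP m hmp n (h ▸ hnp), hiff F hF, hiff F' hF'⟩
  · exact .inl (hrel _ hmP _ hnP h m hmp n hnp)

theorem commutatorAt_eq_zero {X Y : LabelledFun M → LabelledFun M} {Φ : WaveFun M}
    {q : Config M N} {σ : Fin M ⊕ Fin N → Fin 4}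
    (h : X (Y (toLabelled Φ)) (Finset.range N) (nameData q) (nameData σ)
      = Y (X (toLabelled Φ)) (Finset.range N) (nameData q) (nameData σ)) :
    commutatorAt X Y Φ q σ = 0 :=
  sub_eq_zero.2 h

theorem separated_trivial (δ : ℝ) (F F' : Finset (Name M)) (L : Finset ℕ)
    (z : Name M → Spacetime) : Separated (Separation.trivial M δ) F F' L z :=
  fun _ _ _ _ => .inl trivial

theorem keepsSafety_of_mem_names {δ : ℝ} {F F' : Finset (Fin M ⊕ Fin N)}
    {q : Config M N} (h : ∀ k k' : Fin M, .inl k ∈ F → .inl k' ∈ F' →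
      KeepsSafety δ q (.inl k) (.inl k')) (k k' : Fin M) (hk : .inl k ∈ names F)
    (hk' : .inl k' ∈ names F') :
    ‖(nameData q (.inl k)).2 - (nameData q (.inl k')).2‖
      > |(nameData q (.inl k)).1 - (nameData q (.inl k')).1| + 2 * δ :=
  h k k' ((mem_names (m := .inl k)).1 hk) ((mem_names (m := .inl k')).1 hk')

theorem names_singleton_fresh (m : Fin M ⊕ Fin N) :
    .inr (freshName (Finset.range N)) ∉ ({Sum.map id Fin.val m} : Finset (Name M)) := by
  have h := freshName_notMem_names ({m} : Finset (Fin M ⊕ Fin N))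
  rwa [names, Finset.image_singleton] at h

theorem separated_safe {δ : ℝ} {P : LabelPartition M N} {F F' : Finset (Fin M ⊕ Fin N)}
    (hF : F ∈ P.parts) (hF' : F' ∈ P.parts) {q : Config M N} (hq : q ∈ SdeltaPart δ P) :
    Separated (Separation.safe M δ) (names F) (names F') (Finset.range N) (nameData q) := by
  refine separated_of_partition hF hF' hq.1 fun E hE E' hE' hne m hm n hn => ?_
  have h : ‖(q m).2 - (q n).2‖ > _ := hq.2 E hE E' hE' hne m hm n hn
  have h' : nameDist δ (Sum.map id Fin.val m : Name M) (Sum.map id Fin.val n)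
      = safetyDist δ m n := by
    rcases m with k | l <;> rcases n with k' | l' <;> rfl
  change _ > _ + nameDist δ _ _
  rwa [h']

theorem separated_safeX {δ : ℝ} {P : LabelPartition M N} {F F' : Finset (Fin M ⊕ Fin N)}
    (hF : F ∈ P.parts) (hF' : F' ∈ P.parts) {q : Config M N} (hq : q ∈ SdeltaHatPart δ P) :
    Separated (Separation.safeX M δ) (names F) (names F') (Finset.range N) (nameData q) := by
  refine separated_of_partition hF hF' hq.1 fun E hE E' hE' hne m hm n hn hm' hn' => ?_
  rcases m with k | l
  · rcases n with k' | l'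
    · exact hq.2 E hE E' hE' hne k k' hm hn
    · simp at hn'
  · simp at hm'

/-- Single particles: no condition on the configuration is needed unless both are `x`-particles. -/
theorem IsCutoffGreen.particleK_comm {A : CutoffModel}
    {G : Fin 4 → Fin 4 → Fin 4 → Spacetime → ℂ} (hG : IsCutoffGreen A G) {Φ : WaveFun M}
    (hΦ : SmoothEverywhere Φ) {m n : Fin M ⊕ Fin N} (hmn : m ≠ n)
    (hsym : m.isLeft → n.isLeft → BosonSymmetricOn (fun _ => Set.univ) Φ) {q : Config M N}
    (hsafe : m.isLeft → n.isLeft → KeepsSafety A.δ q m n) (σ : Name M → Fin 4) :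
    particleK A G (Sum.map id Fin.val m) (particleK A G (Sum.map id Fin.val n) (toLabelled Φ))
        (Finset.range N) (nameData q) σ
      = particleK A G (Sum.map id Fin.val n) (particleK A G (Sum.map id Fin.val m) (toLabelled Φ))
        (Finset.range N) (nameData q) σ := by
  have hleft : ∀ {m : Fin M ⊕ Fin N} {k : Fin M},
      .inl k ∈ ({Sum.map id Fin.val m} : Finset (Name M)) → m = .inl k := fun {m k} hk =>
    (sumMap_val_injective (a₁ := .inl k) (Finset.mem_singleton.1 hk)).symm
  rw [particleK_eq, particleK_eq]
  refine hG.familyOp_comm (isSmoothLabelled_of_smoothEverywhere (δ := A.δ) hΦ)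
    (fun k k' hk hk' => ?_) (Finset.disjoint_singleton.2 (sumMap_val_injective.ne hmn))
    (separated_trivial _ _ _ _ _) (names_singleton_fresh m) (names_singleton_fresh n)
    (fun k k' hk hk' => ?_) σ
  · obtain rfl := hleft hk
    obtain rfl := hleft hk'
    exact swapSymmetric_trivial (hsym rfl rfl)
  · obtain rfl := hleft hk
    obtain rfl := hleft hk'
    exact hsafe rfl rfl

theorem IsCutoffGreen.sumParticleK_comm {A : CutoffModel}
    {G : Fin 4 → Fin 4 → Fin 4 → Spacetime → ℂ} (hG : IsCutoffGreen A G) {Φ : WaveFun M}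
    (hΦ : SmoothEverywhere Φ) (hsym : BosonSymmetricOn (fun _ => Set.univ) Φ)
    {F F' : Finset (Fin M ⊕ Fin N)} (hFF' : Disjoint F F') {q : Config M N}
    (hsafe : ∀ k k' : Fin M, .inl k ∈ F → .inl k' ∈ F' → KeepsSafety A.δ q (.inl k) (.inl k'))
    (σ : Name M → Fin 4) :
    sumParticleK A G (names F) (sumParticleK A G (names F') (toLabelled Φ))
        (Finset.range N) (nameData q) σ
      = sumParticleK A G (names F') (sumParticleK A G (names F) (toLabelled Φ))
        (Finset.range N) (nameData q) σ := by
  have hΨ := isSmoothLabelled_of_smoothEverywhere (δ := A.δ) hΦ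
  have hreg : ∀ m n : Fin M ⊕ Fin N, m ≠ n →
      Regular A {Sum.map id Fin.val m} (Finset.range N) (nameData q)
        (familyOp A (fun _ => G) {Sum.map id Fin.val n} (toLabelled Φ)) := fun m n hmn =>
    regular_familyOp hΨ (Finset.disjoint_singleton.2 (sumMap_val_injective.ne hmn))
      (separated_trivial _ _ _ _ _) (names_singleton_fresh m) (names_singleton_fresh n)
      fun _ => hG.smooth
  simp only [sumParticleK_eq, names, Finset.sum_image sumMap_val_injective.injOn]
  refine sum_commute (A := A)
    (F := fun m : Fin M ⊕ Fin N => ({Sum.map id Fin.val m} : Finset (Name M)))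
    (F' := fun m : Fin M ⊕ Fin N => ({Sum.map id Fin.val m} : Finset (Name M)))
    (X := fun m => familyOp A (fun _ => G) {Sum.map id Fin.val m})
    (Y := fun m => familyOp A (fun _ => G) {Sum.map id Fin.val m})
    (fun _ _ => linearAt_familyOp) (fun _ _ => linearAt_familyOp)
    (fun m hm n hn => hreg n m (Finset.disjoint_left.1 hFF' hm <| · ▸ hn))
    (fun m hm n hn => hreg m n (Finset.disjoint_left.1 hFF' hm <| · ▸ hn))
    (fun m hm n hn => ?_)
  have h := hG.particleK_comm hΦ (m := m) (n := n) (q := q)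
    (Finset.disjoint_left.1 hFF' hm <| · ▸ hn) (fun _ _ => hsym) (fun hm' hn' => ?_) σ
  · simpa only [particleK_eq] using h
  · obtain ⟨k, rfl⟩ := Sum.isLeft_iff.1 hm'
    obtain ⟨k', rfl⟩ := Sum.isLeft_iff.1 hn'
    exact hsafe k k' hm hn

end

end

end MultiTime

theorem mainTheorem7 {M : ℕ} (A : CutoffModel) :
    -- on wave functions on the `δ`-spacelike configurations, operators with the cut-off function
    (∀ Φ : WaveFun M, SmoothOnSdelta A.δ Φ → BosonSymmetricOn (Sdelta M A.δ) Φ →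
      ∀ (N : ℕ) (P : LabelPartition M N), ∀ F ∈ P.parts, ∀ F' ∈ P.parts,
      ∀ q ∈ SdeltaPart A.δ P, ∀ σ,
        commutatorAt (familyK A (names F)) (familyK A (names F')) Φ q σ = 0) ∧
    ∀ G : Fin 4 → Fin 4 → Fin 4 → Spacetime → ℂ, IsCutoffGreen A G →
      -- the same with the operators in terms of the Green functions
      (∀ Φ : WaveFun M, SmoothOnSdelta A.δ Φ → BosonSymmetricOn (Sdelta M A.δ) Φ →
        ∀ (N : ℕ) (P : LabelPartition M N), ∀ F ∈ P.parts, ∀ F' ∈ P.parts,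
        ∀ q ∈ SdeltaPart A.δ P, ∀ σ,
          commutatorAt (familyGreenK A G (names F)) (familyGreenK A G (names F')) Φ q σ = 0) ∧
      -- on wave functions on the larger set
      (∀ Φ : WaveFun M, SmoothOnSdeltaHat A.δ Φ → BosonSymmetricOn (SdeltaHat M A.δ) Φ →
        ∀ (N : ℕ) (P : LabelPartition M N), ∀ F ∈ P.parts, ∀ F' ∈ P.parts,
        ∀ q ∈ SdeltaHatPart A.δ P, ∀ σ,
          commutatorAt (familyGreenK A G (names F)) (familyGreenK A G (names F')) Φ q σ = 0) ∧
      -- on wave functions on all space-time configurations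
      (∀ Φ : WaveFun M, SmoothEverywhere Φ → BosonSymmetricOn (fun _ => Set.univ) Φ →
        ∀ (N : ℕ) (P : LabelPartition M N), ∀ F ∈ P.parts, ∀ F' ∈ P.parts,
        ∀ q ∈ SdeltaHatPart A.δ P, ∀ σ,
          commutatorAt (sumParticleK A G (names F)) (sumParticleK A G (names F')) Φ q σ = 0) ∧
      -- `yy`
      (∀ Φ : WaveFun M, SmoothEverywhere Φ →
        ∀ (N : ℕ) (l l' : Fin N) (q : Config M N) (σ : Fin M ⊕ Fin N → Fin 4),
          commutatorAt (particleK A G (.inr l)) (particleK A G (.inr l')) Φ q σ = 0) ∧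
      -- `xy`
      (∀ Φ : WaveFun M, SmoothEverywhere Φ →
        ∀ (N : ℕ) (k : Fin M) (l : Fin N) (q : Config M N) (σ : Fin M ⊕ Fin N → Fin 4),
          commutatorAt (particleK A G (.inl k)) (particleK A G (.inr l)) Φ q σ = 0) ∧
      -- `xx`
      (∀ Φ : WaveFun M, SmoothEverywhere Φ → BosonSymmetricOn (fun _ => Set.univ) Φ →
        ∀ (N : ℕ) (k k' : Fin M) (q : Config M N) (σ : Fin M ⊕ Fin N → Fin 4),
          KeepsSafety A.δ q (.inl k) (.inl k') →
          commutatorAt (particleK A G (.inl k)) (particleK A G (.inl k')) Φ q σ = 0) := by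

  refine ⟨fun Φ hΦ hsym N P F hF F' hF' q hq σ => ?_, fun G hG =>
    ⟨fun Φ hΦ hsym N P F hF F' hF' q hq σ => ?_, fun Φ hΦ hsym N P F hF F' hF' q hq σ => ?_,
      fun Φ hΦ hsym N P F hF F' hF' q hq σ => ?_, fun Φ hΦ N l l' q σ => ?_,
      fun Φ hΦ N k l q σ => ?_, fun Φ hΦ hsym N k k' q σ hsafe => ?_⟩⟩
  · rcases eq_or_ne F F' with rfl | hne
    · exact sub_self _
    have hdisj := disjoint_names hF hF' hne
    rw [familyK_eq, familyK_eq]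
    refine commutatorAt_eq_zero (familyOp_comm (isSmoothLabelled_of_smoothOnSdelta hΦ)
      (fun _ _ _ _ => swapSymmetric_safe hsym) hdisj (separated_safe hF hF' hq)
      (freshName_notMem_names F) (freshName_notMem_names F') (contDiff_familyCoef A _)
      (contDiff_familyCoef A _)
      (fun l hl => solvesDirac_familyCoef A (Finset.disjoint_right.1 hdisj hl))
      (fun l hl => solvesDirac_familyCoef A (Finset.disjoint_left.1 hdisj hl))
      (fun k k' _ _ r r' s y _ => ?_) (fun k k' _ _ r r' s y _ => ?_) _)
    · exact if_neg (freshName_notMem_names F)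
    · exact if_neg (freshName_notMem_names F')
  · rcases eq_or_ne F F' with rfl | hne
    · exact sub_self _
    rw [familyGreenK_eq, familyGreenK_eq]
    exact commutatorAt_eq_zero (hG.familyOp_comm (isSmoothLabelled_of_smoothOnSdelta hΦ)
      (fun _ _ _ _ => swapSymmetric_safe hsym) (disjoint_names hF hF' hne)
      (separated_safe hF hF' hq) (freshName_notMem_names F) (freshName_notMem_names F')
      (keepsSafety_of_mem_names fun k k' hk hk' => hq.2 F hF F' hF' hne _ hk _ hk') _)
  · rcases eq_or_ne F F' with rfl | hne
    · exact sub_self _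
    rw [familyGreenK_eq, familyGreenK_eq]
    exact commutatorAt_eq_zero (hG.familyOp_comm (isSmoothLabelled_of_smoothOnSdeltaHat hΦ)
      (fun _ _ _ _ => swapSymmetric_safeX hsym) (disjoint_names hF hF' hne)
      (separated_safeX hF hF' hq) (freshName_notMem_names F) (freshName_notMem_names F')
      (keepsSafety_of_mem_names fun k k' hk hk' => hq.2 F hF F' hF' hne _ _ hk hk') _)
  · rcases eq_or_ne F F' with rfl | hne
    · exact sub_self _
    exact commutatorAt_eq_zero (hG.sumParticleK_comm hΦ hsym (P.disjoint hF hF' hne)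
      (fun k k' hk hk' => hq.2 F hF F' hF' hne k k' hk hk') _)
  · rcases eq_or_ne l l' with rfl | hne
    · exact sub_self _
    exact commutatorAt_eq_zero (hG.particleK_comm hΦ (m := .inr l) (n := .inr l')
      (by simpa using hne) (by simp) (by simp) _)
  · exact commutatorAt_eq_zero (hG.particleK_comm hΦ (m := .inl k) (n := .inr l)
      (by simp) (by simp) (by simp) _)
  · have hne : k ≠ k' := by
      rintro rfl
      have h : ‖(q (.inl k)).2 - (q (.inl k)).2‖ > |(q (.inl k)).1 - (q (.inl k)).1| + 2 * A.δ :=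
        hsafe
      simp only [sub_self, norm_zero, abs_zero, zero_add] at h
      linarith [A.δ_pos]
    exact commutatorAt_eq_zero (hG.particleK_comm hΦ (m := .inl k) (n := .inl k')
      (by simpa using hne) (fun _ _ => hsym) (fun _ _ => hsafe) _)
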